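/- Let $X$ be a compact complex manifold of dimension $n\ge 3$ and let $\omega,\gamma$ be Hermitian metrics on $X$, identified with their fundamental forms (smooth positive definite real $(1,1)$-forms); for a $(1,1)$-form $\alpha$ write $\alpha_p=\alpha^p/p!$. For a Hermitian metric $\gamma$ let $\star_\gamma$ be its ($\mathbb C$-linear) Hodge star operator, defined by $u\wedge\star_\gamma\bar v=\langle u,v\rangle_\gamma\,\gamma_n$, let $\Lambda_\gamma$ be the pointwise adjoint of $\gamma\wedge\cdot$, and let $(\gamma_{n-2}\wedge\cdot)^{-1}$ be the inverse of the pointwise bijection $\gamma_{n-2}\wedge\cdot:\Lambda^{1,1}T^\star X\to\Lambda^{n-1,n-1}T^\star X$. Put $$\rho_{\omega,\gamma}=(\gamma_{n-2}\wedge\cdot)^{-1}(i\partial\bar\partial\omega_{n-2}),\qquad T_\gamma(\eta)=(\gamma_{n-2}\wedge\cdot)^{-1}(\star_\gamma\eta),\qquad P_\omega(\alpha)=(\omega_{n-2}\wedge\cdot)^{-1}(i\partial\bar\partial\alpha\wedge\omega_{n-3})$$ for smooth $(1,1)$-forms $\eta,\alpha$, and, with the formal adjoints $\partial^\star=-\star_\omega\bar\partial\star_\omega$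 and $\bar\partial^\star=-\star_\omega\partial\star_\omega$ with respect to $\omega$, $$Q_\omega(\alpha)=P_\omega(\alpha)+(i\partial^\star\bar\partial^\star\alpha)\,\omega-i\partial\Lambda_\omega(\bar\partial\alpha)-i\partial^\star(\omega\wedge\bar\partial^\star\alpha)-\frac1{n-1}\,\big(\bar\partial^\star\Lambda_\omega(\bar\partial\alpha)\big)\,\omega .$$ Then, for every smooth $(1,1)$-form $\eta$ on $X$, $$\int_X\eta\wedge\star_\gamma\rho_{\omega,\gamma}=\frac{n-1}{n-2}\int_X P_\omega\big(T_\gamma(\eta)\big)\wedge\omega_{n-1}.$$ If moreover $\omega$ is balanced (that is, $d\omega^{n-1}=0$), then for every smooth $(1,1)$-form $\eta$ on $X$, $$\int_X\eta\wedge\star_\gamma\rho_{\omega,\gamma}=\frac{n-1}{n-2}\int_X Q_\omega\big(T_\gamma(\eta)\big)\wedge\omega_{n-1}.$$ -/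

import Mathlib

open scoped Manifold

noncomputable section

/-! ## Multilinear algebra on the model space `ℂⁿ` -/

/-- The model space `ℂⁿ` of an `n`-dimensional complex manifold. -/
abbrev Cn (n : ℕ) : Type := Fin n → ℂ

/-- `Alt n k` is `Λᵏ(ℂⁿ)^* ⊗ ℂ`: the complex-valued, real-multilinear alternating `k`-forms on the
real vector space underlying `ℂⁿ`. -/
abbrev Alt (n k : ℕ) : Type := Cn n [⋀^Fin k]→L[ℝ] ℂ

namespace Alt

variable {n : ℕ}

/-- Relabelling of a form along an equality of degrees. -/
def castDeg {k l : ℕ} (h : k = l) (a : Alt n k) : Alt n l where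
  toContinuousMultilinearMap := a.toContinuousMultilinearMap.domDomCongr (finCongr h)
  map_eq_zero_of_eq' := by
    subst h
    exact a.map_eq_zero_of_eq'

theorem update_castAdd {k l : ℕ} [DecidableEq (Fin (k + l))] (v : Fin (k + l) → Cn n) (i : Fin k)
    (z : Cn n) :
    (fun j => Function.update v (Fin.castAdd l i) z (Fin.castAdd l j)) =
        Function.update (fun j => v (Fin.castAdd l j)) i z ∧
      (fun j => Function.update v (Fin.castAdd l i) z (Fin.natAdd k j)) =
        fun j => v (Fin.natAdd k j) := by
  constructor
  · funext j
    rcases eq_or_ne j i with rfl | h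
    · simp
    · rw [Function.update_of_ne h, Function.update_of_ne]
      exact fun h' => h (Fin.castAdd_injective k l h')
  · funext j
    apply Function.update_of_ne
    intro h
    have := congrArg Fin.val h
    simp at this
    omega

theorem update_natAdd {k l : ℕ} [DecidableEq (Fin (k + l))] (v : Fin (k + l) → Cn n) (i : Fin l)
    (z : Cn n) :
    (fun j => Function.update v (Fin.natAdd k i) z (Fin.natAdd k j)) =
        Function.update (fun j => v (Fin.natAdd k j)) i z ∧
      (fun j => Function.update v (Fin.natAdd k i) z (Fin.castAdd l j)) =
        fun j => v (Fin.castAdd l j) := by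
  constructor
  · funext j
    rcases eq_or_ne j i with rfl | h
    · simp
    · rw [Function.update_of_ne h, Function.update_of_ne]
      exact fun h' => h (Fin.natAdd_injective l k h')
  · funext j
    apply Function.update_of_ne
    intro h
    have := congrArg Fin.val h
    simp at this
    omega

/-- The (not yet antisymmetrised) product
`(v₁, …, v_{k+l}) ↦ a (v₁, …, v_k) * b (v_{k+1}, …, v_{k+l})`. -/
def tensorMul {k l : ℕ} (a : Alt n k) (b : Alt n l) :
    ContinuousMultilinearMap ℝ (fun _ : Fin (k + l) => Cn n) ℂ where
  toFun v := a (fun i => v (Fin.castAdd l i)) * b (fun j => v (Fin.natAdd k j))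
  map_update_add' := by
    intro inst v i x y
    refine Fin.addCases (fun i => ?_) (fun i => ?_) i
    · rw [(update_castAdd v i _).1, (update_castAdd v i _).2, (update_castAdd v i _).1,
        (update_castAdd v i _).2, (update_castAdd v i _).1, (update_castAdd v i _).2,
        a.map_update_add, add_mul]
    · rw [(update_natAdd v i _).1, (update_natAdd v i _).2, (update_natAdd v i _).1,
        (update_natAdd v i _).2, (update_natAdd v i _).1, (update_natAdd v i _).2,
        b.map_update_add, mul_add]
  map_update_smul' := by
    intro inst v i c x
    refine Fin.addCases (fun i => ?_) (fun i => ?_) i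
    · rw [(update_castAdd v i _).1, (update_castAdd v i _).2, (update_castAdd v i _).1,
        (update_castAdd v i _).2, a.map_update_smul, smul_mul_assoc]
    · rw [(update_natAdd v i _).1, (update_natAdd v i _).2, (update_natAdd v i _).1,
        (update_natAdd v i _).2, b.map_update_smul, mul_smul_comm]
  cont := by
    have h1 := a.cont
    have h2 := b.cont
    refine Continuous.mul ?_ ?_
    · exact h1.comp (by fun_prop)
    · exact h2.comp (by fun_prop)

/-- The wedge product
`(a ∧ b)(v) = 1/(k! l!) ∑_σ sgn σ a(v_{σ1}, …, v_{σk}) b(v_{σ(k+1)}, …, v_{σ(k+l)})`,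
so that `dx ∧ dy` is `1` on the corresponding pair of basis vectors. -/
def wedge {k l : ℕ} (a : Alt n k) (b : Alt n l) : Alt n (k + l) :=
  ((1 : ℝ) / ((k.factorial : ℝ) * (l.factorial : ℝ))) •
    ContinuousMultilinearMap.alternatization (tensorMul a b)

/-- The `p`-fold wedge power `a ∧ ⋯ ∧ a` of a `2`-form. -/
def wedgePow (a : Alt n 2) : (p : ℕ) → Alt n (2 * p)
  | 0 => ContinuousAlternatingMap.constOfIsEmpty ℝ (Cn n) (Fin 0) (1 : ℂ)
  | p + 1 => wedge (wedgePow a p) a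

/-- The divided power `a_p = aᵖ / p!` of a `2`-form. -/
def dpow (a : Alt n 2) (p : ℕ) : Alt n (2 * p) :=
  ((1 : ℝ) / (p.factorial : ℝ)) • wedgePow a p

/-- A `2`-form is of type `(1,1)` if and only if it is invariant under multiplication by `i`. -/
def IsType11 (a : Alt n 2) : Prop :=
  ∀ u v : Cn n, a ![Complex.I • u, Complex.I • v] = a ![u, v]

theorem append_update {m l : ℕ} (v : Fin m → Cn n) (w : Fin l → Cn n) (i : Fin l) (x : Cn n) :
    Fin.append v (Function.update w i x) =
      Function.update (Fin.append v w) (Fin.natAdd m i) x := by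
  funext j
  refine Fin.addCases (fun j => ?_) (fun j => ?_) j
  · rw [Fin.append_left, Function.update_of_ne, Fin.append_left]
    intro h
    have := congrArg Fin.val h
    simp at this
    omega
  · rw [Fin.append_right]
    rcases eq_or_ne j i with rfl | h
    · simp
    · rw [Function.update_of_ne h, Function.update_of_ne, Fin.append_right]
      exact fun h' => h (Fin.natAdd_injective l m h')

/-- Contraction with a fixed tuple of vectors in the first slots:
`(contract v a)(w₁, …, w_l) = a (v₁, …, v_m, w₁, …, w_l)`. -/
def contract {m l k : ℕ} (h : m + l = k) (v : Fin m → Cn n) (a : Alt n k) : Alt n l where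
  toFun w := castDeg h.symm a (Fin.append v w)
  map_update_add' := by
    intro inst w i x y
    rw [Subsingleton.elim inst (instDecidableEqFin l)]
    simp only [append_update, ContinuousAlternatingMap.map_update_add]
  map_update_smul' := by
    intro inst w i c x
    rw [Subsingleton.elim inst (instDecidableEqFin l)]
    simp only [append_update, ContinuousAlternatingMap.map_update_smul]
  map_eq_zero_of_eq' := by
    intro w i j hij hne
    refine (castDeg h.symm a).map_eq_zero_of_eq (Fin.append v w)
      (i := Fin.natAdd m i) (j := Fin.natAdd m j) ?_ ?_
    · simpa using hij
    · intro h'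
      exact hne (Fin.natAdd_injective l m h')
  cont := by
    refine (castDeg h.symm a).cont.comp ?_
    refine continuous_pi fun i => ?_
    refine Fin.addCases (fun i => ?_) (fun i => ?_) i
    · simp only [Fin.append_left]
      exact continuous_const
    · simp only [Fin.append_right]
      exact continuous_apply i

/-- The standard positively oriented real frame `(e₁, i e₁, e₂, i e₂, …, e_n, i e_n)` of `ℂⁿ`. -/
def frame (n : ℕ) (j : Fin (2 * n)) : Cn n :=
  Pi.single (⟨(j : ℕ) / 2, by have := j.isLt; omega⟩ : Fin n) (Complex.I ^ ((j : ℕ) % 2))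

/-- The Gram matrix, in the standard real frame, of the Riemannian metric `g(u, v) = γ(u, iv)`
attached to a positive `(1,1)`-form `γ`. -/
def gram (γ : Alt n 2) : Matrix (Fin (2 * n)) (Fin (2 * n)) ℂ :=
  Matrix.of fun p q => γ ![frame n p, Complex.I • frame n q]

/-- The `ℂ`-linear Hodge star operator of the Hermitian metric `γ`, with volume form
`dV = γⁿ / n!`, in index notation
`(⋆a)_{j₁ … j_l} = (1/k!) g^{p₁ q₁} ⋯ g^{p_k q_k} a_{p₁ … p_k} dV_{q₁ … q_k j₁ … j_l}`;
equivalently `u ∧ ⋆(conj v) = ⟨u, v⟩_γ dV` for all `k`-forms `u`, `v`. -/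
def hodgeStar {k l : ℕ} (h : k + l = 2 * n) (γ : Alt n 2) (a : Alt n k) : Alt n l :=
  ((1 : ℂ) / (k.factorial : ℂ)) • ∑ p : Fin k → Fin (2 * n), ∑ q : Fin k → Fin (2 * n),
    ((∏ i, (gram γ)⁻¹ (p i) (q i)) * a (fun i => frame n (p i))) •
      contract h (fun i => frame n (q i)) (dpow γ n)

/-- The trace operator `Λ_γ`, the pointwise adjoint of `γ ∧ ·`: in a real `γ`-orthonormal basis
`(f_j)` it is `(Λ a)(w) = 1/2 ∑_j a(f_j, i f_j, w)`. In particular `Λ_γ γ = n`. -/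
def trace {k : ℕ} (γ : Alt n 2) (a : Alt n (k + 2)) : Alt n k :=
  ((1 : ℂ) / 2) • ∑ p : Fin (2 * n), ∑ q : Fin (2 * n),
    ((gram γ)⁻¹ p q) • contract (Nat.add_comm 2 k) ![frame n p, Complex.I • frame n q] a

/-- Division by `γ_{n-2}`: the inverse of the bijection `γ_{n-2} ∧ · : Λ^{1,1} → Λ^{n-1,n-1}`.
The value at `b` is the `(1,1)`-form `β` with `γ_{n-2} ∧ β = b`. -/
def divide {k : ℕ} (h : 2 * (n - 2) + 2 = k) (γ : Alt n 2) (b : Alt n k) : Alt n 2 :=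
  Function.invFunOn (fun β : Alt n 2 => castDeg h (wedge (dpow γ (n - 2)) β)) {β | IsType11 β} b

/-- `∂` on forms in `ℂⁿ`, i.e. `∑_j dz_j ∧ ∂a/∂z_j`: antisymmetrisation of the `ℂ`-linear part
`v ↦ (Da(v) - i Da(iv)) / 2` of the derivative. -/
def del {k : ℕ} (a : Cn n → Alt n k) (y : Cn n) : Alt n (k + 1) :=
  ContinuousAlternatingMap.alternatizeUncurryFin
    (((1 : ℂ) / 2) • (fderiv ℝ a y -
      Complex.I • (fderiv ℝ a y).comp (Complex.I • ContinuousLinearMap.id ℝ (Cn n))))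

/-- `∂̄` on forms in `ℂⁿ`, i.e. `∑_j dz̄_j ∧ ∂a/∂z̄_j`: antisymmetrisation of the `ℂ`-antilinear
part `v ↦ (Da(v) + i Da(iv)) / 2` of the derivative. -/
def delbar {k : ℕ} (a : Cn n → Alt n k) (y : Cn n) : Alt n (k + 1) :=
  ContinuousAlternatingMap.alternatizeUncurryFin
    (((1 : ℂ) / 2) • (fderiv ℝ a y +
      Complex.I • (fderiv ℝ a y).comp (Complex.I • ContinuousLinearMap.id ℝ (Cn n))))

end Alt

/-! ## Differential forms on a complex manifold -/

/-- A complex-valued differential form of degree `k` (no regularity required) on a complex manifold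
modelled on `ℂⁿ`; the tangent space at every point is, as always in Mathlib
(`TangentSpace 𝓘(ℂ, Cn n) x`), a copy of `ℂⁿ`. -/
abbrev DForm (X : Type*) (n k : ℕ) := X → Alt n k

namespace DForm

variable {X : Type*} {n : ℕ} [TopologicalSpace X] [ChartedSpace (Cn n) X]

/-- The manifold derivative of a chart at a point, as a `ℂ`-linear map of `ℂⁿ`. -/
def chartDeriv (e : OpenPartialHomeomorph X (Cn n)) (x : X) : Cn n →L[ℂ] Cn n :=
  mfderiv 𝓘(ℂ, Cn n) 𝓘(ℂ, Cn n) e x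

/-- The manifold derivative of the inverse of a chart at a point, as a `ℂ`-linear map of `ℂⁿ`. -/
def chartSymmDeriv (e : OpenPartialHomeomorph X (Cn n)) (y : Cn n) : Cn n →L[ℂ] Cn n :=
  mfderiv 𝓘(ℂ, Cn n) 𝓘(ℂ, Cn n) e.symm y

/-- The expression `(e⁻¹)^* a` of a form in the chart `e`, a form on the open set `e.target`. -/
def inChart {k : ℕ} (e : OpenPartialHomeomorph X (Cn n)) (a : DForm X n k) (y : Cn n) : Alt n k :=
  (a (e.symm y)).compContinuousLinearMap ((chartSymmDeriv e y).restrictScalars ℝ)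

/-- Pull back, to the tangent space at `x`, of a covector at `chartAt x x` by the chart at `x`. -/
def atPoint {k : ℕ} (x : X) (b : Alt n k) : Alt n k :=
  b.compContinuousLinearMap ((chartDeriv (chartAt (Cn n) x) x).restrictScalars ℝ)

/-- A form is smooth if its expressions in all charts of the atlas are real `C^∞`. -/
def IsSmooth {k : ℕ} (a : DForm X n k) : Prop :=
  ∀ e ∈ atlas (Cn n) X, ContDiffOn ℝ (⊤ : ℕ∞) (inChart e a) e.target

/-- The exterior derivative. -/
def d {k : ℕ} (a : DForm X n k) : DForm X n (k + 1) := fun x =>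
  atPoint x (extDeriv (inChart (chartAt (Cn n) x) a) (chartAt (Cn n) x x))

/-- The operator `∂`. -/
def del {k : ℕ} (a : DForm X n k) : DForm X n (k + 1) := fun x =>
  atPoint x (Alt.del (inChart (chartAt (Cn n) x) a) (chartAt (Cn n) x x))

/-- The operator `∂̄`. -/
def delbar {k : ℕ} (a : DForm X n k) : DForm X n (k + 1) := fun x =>
  atPoint x (Alt.delbar (inChart (chartAt (Cn n) x) a) (chartAt (Cn n) x x))

/-- The operator `i∂∂̄`. -/
def iddbar {k : ℕ} (a : DForm X n k) : DForm X n (k + 1 + 1) := fun x =>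
  Complex.I • del (delbar a) x

/-- Pointwise wedge product. -/
def wedge {k l : ℕ} (a : DForm X n k) (b : DForm X n l) : DForm X n (k + l) := fun x =>
  Alt.wedge (a x) (b x)

/-- The divided power `a_p = aᵖ / p!`. -/
def dpow (a : DForm X n 2) (p : ℕ) : DForm X n (2 * p) := fun x => Alt.dpow (a x) p

/-- The Hodge star operator `⋆_γ`. -/
def star {k l : ℕ} (h : k + l = 2 * n) (γ : DForm X n 2) (a : DForm X n k) : DForm X n l :=
  fun x => Alt.hodgeStar h (γ x) (a x)

/-- The trace operator `Λ_γ`. -/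
def trace {k : ℕ} (γ : DForm X n 2) (a : DForm X n (k + 2)) : DForm X n k := fun x =>
  Alt.trace (γ x) (a x)

/-- The pointwise inverse `(γ_{n-2} ∧ ·)⁻¹` from `(n-1,n-1)`-forms to `(1,1)`-forms. -/
def divide {k : ℕ} (h : 2 * (n - 2) + 2 = k) (γ : DForm X n 2) (b : DForm X n k) : DForm X n 2 :=
  fun x => Alt.divide h (γ x) (b x)

/-- Forms of type `(1,1)`. -/
def IsType11 (a : DForm X n 2) : Prop := ∀ x, Alt.IsType11 (a x)

/-- A Hermitian metric, identified with its fundamental form: a smooth real positive definite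
`(1,1)`-form. -/
structure IsHermitianMetric (ω : DForm X n 2) : Prop where
  smooth : IsSmooth ω
  type11 : IsType11 ω
  real : ∀ x u v, (ω x ![u, v]).im = 0
  pos : ∀ x u, u ≠ 0 → 0 < (ω x ![u, Complex.I • u]).re

/-- A metric is balanced if `d(ω^{n-1}) = 0`. -/
def IsBalanced (ω : DForm X n 2) : Prop := ∀ x, d (fun y => Alt.wedgePow (ω y) (n - 1)) x = 0

/-- The formal adjoint `∂^* = -⋆ ∂̄ ⋆` of `∂` with respect to `ω`. -/
def delStar {k : ℕ} (h : k + 1 ≤ 2 * n) (ω : DForm X n 2) (a : DForm X n (k + 1)) : DForm X n k :=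
  fun x => -star (l := k) (by omega) ω
    (delbar (star (l := 2 * n - (k + 1)) (by omega) ω a)) x

/-- The formal adjoint `∂̄^* = -⋆ ∂ ⋆` of `∂̄` with respect to `ω`. -/
def delbarStar {k : ℕ} (h : k + 1 ≤ 2 * n) (ω : DForm X n 2) (a : DForm X n (k + 1)) :
    DForm X n k :=
  fun x => -star (l := k) (by omega) ω
    (del (star (l := 2 * n - (k + 1)) (by omega) ω a)) x

/-- The product of a `0`-form, i.e. a function, with a form. -/
def funMul {k : ℕ} (f : DForm X n 0) (a : DForm X n k) : DForm X n k := fun x => f x ![] • a x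

/-- `ρ_{ω,γ} = (γ_{n-2} ∧ ·)⁻¹ (i∂∂̄ ω_{n-2})`. -/
def rho (ω γ : DForm X n 2) : DForm X n 2 := divide rfl γ (iddbar (dpow ω (n - 2)))

/-- `T_γ = (γ_{n-2} ∧ ·)⁻¹ ∘ ⋆_γ` on `(1,1)`-forms. -/
def opT (hn : 3 ≤ n) (γ η : DForm X n 2) : DForm X n 2 :=
  divide rfl γ (star (by omega) γ η)

/-- `P_ω(α) = (ω_{n-2} ∧ ·)⁻¹ (i∂∂̄α ∧ ω_{n-3})`. -/
def opP (hn : 3 ≤ n) (ω α : DForm X n 2) : DForm X n 2 :=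
  divide (by omega) ω (wedge (iddbar α) (dpow ω (n - 3)))

/-- `R_ω(α) = (i ∂^* ∂̄^* α) ω`. -/
def opR (hn : 3 ≤ n) (ω α : DForm X n 2) : DForm X n 2 := fun x =>
  Complex.I • funMul (delStar (by omega) ω (delbarStar (k := 1) (by omega) ω α)) ω x

/-- `Q_ω(α) = P_ω(α) + R_ω(α) - i∂Λ_ω(∂̄α) - i∂^*(ω ∧ ∂̄^*α) - (1/(n-1)) (∂̄^* Λ_ω(∂̄α)) ω`. -/
def opQ (hn : 3 ≤ n) (ω α : DForm X n 2) : DForm X n 2 := fun x =>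
  opP hn ω α x + opR hn ω α x
    - Complex.I • del (trace (k := 1) ω (delbar α)) x
    - Complex.I • delStar (k := 2) (by omega) ω (wedge ω (delbarStar (k := 1) (by omega) ω α)) x
    - ((1 : ℂ) / ((n : ℂ) - 1)) •
        funMul (delbarStar (by omega) ω (trace (k := 1) ω (delbar α))) ω x

end DForm

/-! ## Integration of top-degree forms -/

section Integration

variable (X : Type*) {n : ℕ} [TopologicalSpace X] [ChartedSpace (Cn n) X]

/-- The smooth manifold underlying a complex manifold. -/
theorem isManifold_real [IsManifold 𝓘(ℂ, Cn n) (⊤ : ℕ∞) X] : IsManifold 𝓘(ℝ, Cn n) (⊤ : ℕ∞) X := by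
  refine isManifold_of_contDiffOn 𝓘(ℝ, Cn n) (⊤ : ℕ∞) X fun e e' he he' => ?_
  have h := (contDiffGroupoid (⊤ : ℕ∞) 𝓘(ℂ, Cn n)).compatible he he'
  rw [contDiffGroupoid, mem_groupoid_of_pregroupoid] at h
  have h1 := h.1
  simp only [contDiffPregroupoid] at h1
  exact h1.restrict_scalars ℝ

variable [T2Space X] [CompactSpace X] [IsManifold 𝓘(ℂ, Cn n) (⊤ : ℕ∞) X]

/-- A smooth partition of unity subordinate to the domains of the charts `chartAt x`, `x : X`. -/
def chartPartition : SmoothPartitionOfUnity X 𝓘(ℝ, Cn n) X Set.univ :=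
  haveI := isManifold_real X (n := n)
  (SmoothPartitionOfUnity.exists_isSubordinate_chartAt_source 𝓘(ℝ, Cn n) X).choose

variable {X}

/-- The integral over `X`, with its complex orientation, of a form of top degree `2n`: the sum over
a partition of unity `(χ_x)` subordinate to charts of the Lebesgue integrals over `ℂⁿ` of the
coefficients of `χ_x a` with respect to `dx₁ ∧ dy₁ ∧ ⋯ ∧ dx_n ∧ dy_n`. -/
def DForm.integral {k : ℕ} (h : k = 2 * n) (a : DForm X n k) : ℂ :=
  ∑ᶠ x : X, ∫ y in (chartAt (Cn n) x).target,
    ((chartPartition X (n := n) x ((chartAt (Cn n) x).symm y) : ℝ) : ℂ) *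
      Alt.castDeg h (DForm.inChart (chartAt (Cn n) x) a y) (Alt.frame n)

end Integration

end

/-! Pointwise, the pairing `a ∧ ⋆b` is symmetric because the inverse Gram matrix is. Put `b =
i∂∂̄ω_{n-2}` and `β = ρ_{ω,γ}`, so that `γ_{n-2} ∧ β = b`. Then `η ∧ ⋆β = β ∧ ⋆η = β ∧ γ_{n-2} ∧
T_γ(η) = b ∧ T_γ(η)` (`toExt_mul_hodgeStar_divide`). Two applications of Stokes move `i∂∂̄` from
`ω_{n-2}` to `α = T_γ(η)` (`integral_iddbar_wedge`). Finally `ω_{n-2} ∧ ω = (n-1) ω_{n-1}` and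
`ω_{n-3} ∧ ω = (n-2) ω_{n-2}` give `(n-1) P_ω(α) ∧ ω_{n-1} = (n-2) i∂∂̄α ∧ ω_{n-2}`, which is where
the constant comes from (`toExt_divide_mul_dpow`).

For the second formula, each of the four terms of `Q_ω - P_ω` integrates to zero against `ω_{n-1}`.
The two multiples of `ω` have a coefficient `f = -⋆∂u` or `-⋆∂̄u`, so that `f ω ∧ ω_{n-1} = n f ω_n`
is exact, for any Hermitian `ω`. The term `∂Λ_ω(∂̄α)` dies by integration by parts, since `∂ω_{n-1}
= 0`. For `∂^⋆(ω ∧ v)`, the identity `⋆ω_{n-1} = ω` and integration by parts leave `⋆(ω ∧ v) ∧ ∂̄ω`;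
here `⋆(ω ∧ v)` is a multiple of `ω_{n-2}`, and `ω_{n-2} ∧ ∂̄ω = ∂̄ω_{n-1} = 0`.

Forms of every degree are sent by the injective map `toExt` into one complex exterior algebra, where
degree casts disappear, the wedge is the product and the star is contraction of the volume form
(`toExt_hodgeStar`). The metric algebra all follows from one rule: contracting `γ_{k+1}` with a
raised covector gives `γ_k` times that covector composed with `-J` (`conG_dpow_succ`). It yields `⋆β
= -γ_{n-2} ∧ β + (Λ_γ β) γ_{n-1}` on `(1,1)`-forms, hence the bijectivity of `γ_{n-2} ∧ ·` and an
explicit, visibly smooth formula for `T_γ`.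

No bidegree decomposition is used: type `(1,1)` or `(n-1,n-1)` is replaced by invariance under `J`,
and `∂`, `∂̄` are the cases `ε = ∓i` of `dolb ε = (d + ε d_J)/2`, with `d_J` the conjugate of `d` by
`J`. -/

set_option linter.unusedSectionVars false

/-! ### Forms on `ℂⁿ` as elements of a complex exterior algebra. -/

noncomputable section

namespace Alt

variable {n : ℕ}

/-! ### The real frame of `ℂⁿ` -/

/-- The real coordinates of a vector of `ℂⁿ` in the standard frame. -/
def frameCoord (v : Cn n) (j : Fin (2 * n)) : ℝ :=
  if (j : ℕ) % 2 = 0 then (v ⟨(j : ℕ) / 2, by have := j.isLt; omega⟩).re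
  else (v ⟨(j : ℕ) / 2, by have := j.isLt; omega⟩).im

theorem sum_smul_frame_apply (c : Fin (2 * n) → ℝ) (m : Fin n) :
    (∑ j, c j • frame n j) m =
      c ⟨2 * m, by omega⟩ + c ⟨2 * m + 1, by omega⟩ * Complex.I := by
  rw [Finset.sum_apply, Finset.sum_eq_add (⟨2 * m, by omega⟩ : Fin (2 * n)) ⟨2 * m + 1, by omega⟩]
  · have h1 : (2 * (m : ℕ)) / 2 = m := by omega
    have h2 : (2 * (m : ℕ) + 1) / 2 = m := by omega
    have h3 : (2 * (m : ℕ) + 1) % 2 = 1 := by omega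
    simp [frame, h1, h2, h3]
  · simp
  · intro j _ hj
    have : m ≠ ⟨(j : ℕ) / 2, by have := j.isLt; omega⟩ := by
      intro h
      have h' := congrArg Fin.val h
      simp only at h'
      have h1 : (j : ℕ) ≠ 2 * m := fun h => hj.1 (Fin.ext h)
      have h2 : (j : ℕ) ≠ 2 * m + 1 := fun h => hj.2 (Fin.ext h)
      omega
    simp [frame, Pi.single_eq_of_ne this]
  · simp
  · simp

theorem sum_frameCoord (v : Cn n) : ∑ j, frameCoord v j • frame n j = v := by
  funext m
  rw [sum_smul_frame_apply]
  have h1 : (2 * (m : ℕ)) / 2 = m := by omega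
  have h2 : (2 * (m : ℕ) + 1) / 2 = m := by omega
  have h3 : (2 * (m : ℕ) + 1) % 2 = 1 := by omega
  simp [frameCoord, h1, h2, h3]

/-- The standard real frame as a basis. -/
def frameBasis (n : ℕ) : Module.Basis (Fin (2 * n)) ℝ (Cn n) :=
  Module.Basis.ofEquivFun
    { toFun := frameCoord
      map_add' := by intro u v; funext j; simp only [frameCoord, Pi.add_apply]; split_ifs <;> simp
      map_smul' := by intro c v; funext j; simp only [frameCoord, Pi.smul_apply]; split_ifs <;> simp
      invFun := fun c => ∑ j, c j • frame n j
      left_inv := sum_frameCoord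
      right_inv := by
        intro c
        funext j
        simp only [frameCoord, sum_smul_frame_apply]
        split_ifs with h
        · have : 2 * ((j : ℕ) / 2) = j := by omega
          simp [this]
        · have : 2 * ((j : ℕ) / 2) + 1 = j := by omega
          simp [this] }

@[simp] theorem frameBasis_apply (j : Fin (2 * n)) : frameBasis n j = frame n j := by
  rw [frameBasis, Module.Basis.coe_ofEquivFun]
  change ∑ i, (Pi.single j (1 : ℝ) : Fin (2 * n) → ℝ) i • frame n i = _
  simp [Pi.single_apply]

@[simp] theorem frameBasis_repr (v : Cn n) (j : Fin (2 * n)) :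
    (frameBasis n).repr v j = frameCoord v j := rfl

theorem frameCoord_frame (i j : Fin (2 * n)) : frameCoord (frame n i) j = if i = j then 1 else 0 := by
  rw [← frameBasis_repr, ← frameBasis_apply, Module.Basis.repr_self, Finsupp.single_apply]

theorem ext_frame {k : ℕ} {a b : Alt n k}
    (h : ∀ p : Fin k → Fin (2 * n), a (fun i => frame n (p i)) = b (fun i => frame n (p i))) :
    a = b := by
  apply ContinuousAlternatingMap.toContinuousMultilinearMap_injective
  apply ContinuousMultilinearMap.toMultilinearMap_injective
  refine Module.Basis.ext_multilinear (fun _ => frameBasis n) fun p => ?_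
  simpa using h p

theorem apply_comp_perm {k : ℕ} (a : Alt n k) (v : Fin k → Cn n) (σ : Equiv.Perm (Fin k)) :
    a (fun i => v (σ i)) = ((Equiv.Perm.sign σ : ℤ) : ℂ) * a v := by
  have h := a.toAlternatingMap.map_perm v σ
  rw [Units.smul_def, zsmul_eq_mul] at h
  exact h

/-! ### Forms as elements of the complex exterior algebra -/

/-- The complex exterior algebra on the covectors dual to the standard real frame. -/
abbrev Ext (n : ℕ) : Type := ExteriorAlgebra ℂ (Fin (2 * n) → ℂ)

/-- The `j`-th covector of the dual frame. -/
def cov (j : Fin (2 * n)) : Ext n := ExteriorAlgebra.ι ℂ (Pi.single j 1)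

/-- The product of covectors of the dual frame. -/
def mono {k : ℕ} (p : Fin k → Fin (2 * n)) : Ext n :=
  ExteriorAlgebra.ιMulti ℂ k fun i => Pi.single (p i) 1

theorem mono_zero (p : Fin 0 → Fin (2 * n)) : mono p = 1 := by simp [mono]

theorem mono_cons {k : ℕ} (j : Fin (2 * n)) (p : Fin k → Fin (2 * n)) :
    mono (Fin.cons j p : Fin (k + 1) → Fin (2 * n)) = cov j * mono p := by
  simp only [mono, cov, ExteriorAlgebra.ιMulti_succ_apply, Fin.cons_zero]
  rfl

theorem mono_append {k l : ℕ} (p : Fin k → Fin (2 * n)) (q : Fin l → Fin (2 * n)) :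
    mono (Fin.append p q) = mono p * mono q := by
  simp only [mono, ExteriorAlgebra.ιMulti_mul_ιMulti]
  congr 1
  funext i
  refine Fin.addCases (fun i => ?_) (fun i => ?_) i <;> simp

theorem mono_comp_perm {k : ℕ} (p : Fin k → Fin (2 * n)) (σ : Equiv.Perm (Fin k)) :
    mono (fun i => p (σ i)) = ((Equiv.Perm.sign σ : ℤ) : ℂ) • mono p := by
  have h := (ExteriorAlgebra.ιMulti ℂ k (M := Fin (2 * n) → ℂ)).map_perm
    (fun i => Pi.single (p i) 1) σ
  rw [Units.smul_def] at h
  rw [Int.cast_smul_eq_zsmul]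
  exact h

/-- The coefficient functional of a product of covectors. -/
def minor {k : ℕ} (q : Fin k → Fin (2 * n)) : Ext n →ₗ[ℂ] ℂ :=
  ExteriorAlgebra.liftAlternating (R := ℂ)
    (Pi.single k ((Matrix.detRowAlternating (R := ℂ) (n := Fin k)).compLinearMap
      (LinearMap.funLeft ℂ ℂ q)))

theorem minor_mono {k : ℕ} (q p : Fin k → Fin (2 * n)) :
    minor q (mono p) =
      ∑ σ : Equiv.Perm (Fin k), ((Equiv.Perm.sign σ : ℤ) : ℂ) *
        if (fun i => p (σ i)) = q then 1 else 0 := by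
  rw [minor, mono, ExteriorAlgebra.liftAlternating_apply_ιMulti, Pi.single_eq_same]
  simp only [AlternatingMap.compLinearMap_apply]
  change Matrix.det (Matrix.of fun i => LinearMap.funLeft ℂ ℂ q (Pi.single (p i) 1)) = _
  rw [Matrix.det_apply']
  refine Finset.sum_congr rfl fun σ _ => ?_
  congr 1
  simp only [Matrix.of_apply, LinearMap.funLeft_apply, Pi.single_apply]
  rw [Finset.prod_ite_zero]
  simp only [Finset.mem_univ, true_implies, Finset.prod_const_one, funext_iff]
  congr 1
  simp [eq_comm]

/-- The element `1/k! ∑_p a(f_{p₁}, …, f_{p_k}) e^{p₁} ⋯ e^{p_k}` of the exterior algebra attached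
to a form. -/
def toExt {k : ℕ} : Alt n k →ₗ[ℂ] Ext n where
  toFun a := ((k.factorial : ℂ)⁻¹) • ∑ p : Fin k → Fin (2 * n), a (fun i => frame n (p i)) • mono p
  map_add' a b := by
    simp only [ContinuousAlternatingMap.add_apply, add_smul, Finset.sum_add_distrib, smul_add]
  map_smul' c a := by
    simp only [ContinuousAlternatingMap.smul_apply, smul_eq_mul, mul_smul, ← Finset.smul_sum,
      RingHom.id_apply]
    rw [smul_comm]

theorem toExt_apply {k : ℕ} (a : Alt n k) :
    toExt a = ((k.factorial : ℂ)⁻¹) • ∑ p : Fin k → Fin (2 * n),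
      a (fun i => frame n (p i)) • mono p := rfl

theorem factorial_smul_toExt {k : ℕ} (a : Alt n k) :
    (k.factorial : ℂ) • toExt a = ∑ p : Fin k → Fin (2 * n),
      a (fun i => frame n (p i)) • mono p := by
  rw [toExt_apply, smul_inv_smul₀ (by exact_mod_cast k.factorial_ne_zero)]

/-- All `k!` permutations contribute the same value, since the sign from the monomial cancels the
sign from the form; this is what the factor `1/k!` in `toExt` normalises. The components of a form
are thus recovered from its image, whence the injectivity of `toExt`. -/
theorem minor_toExt {k : ℕ} (q : Fin k → Fin (2 * n)) (a : Alt n k) :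
    minor q (toExt a) = a (fun i => frame n (q i)) := by
  have hk : (k.factorial : ℂ) ≠ 0 := by exact_mod_cast k.factorial_ne_zero
  rw [toExt_apply, map_smul, map_sum, smul_eq_mul, inv_mul_eq_iff_eq_mul₀ hk]
  simp only [map_smul, minor_mono, smul_eq_mul, Finset.mul_sum]
  rw [Finset.sum_comm]
  have key : ∀ σ : Equiv.Perm (Fin k), ∑ p : Fin k → Fin (2 * n),
      a (fun i => frame n (p i)) * (((Equiv.Perm.sign σ : ℤ) : ℂ) *
        if (fun i => p (σ i)) = q then 1 else 0) = a (fun i => frame n (q i)) := by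
    intro σ
    rw [Finset.sum_eq_single (fun i => q (σ⁻¹ i))]
    · have h := apply_comp_perm a (fun i => frame n (q i)) σ⁻¹
      simp only [Equiv.Perm.sign_inv] at h
      rw [h]
      simp only [Equiv.Perm.coe_inv, Equiv.symm_apply_apply, if_true, mul_one]
      rw [mul_right_comm, ← Int.cast_mul, ← Units.val_mul, Int.units_mul_self]
      simp
    · intro p _ hp
      rw [if_neg]
      · simp
      · rintro rfl
        exact hp (by simp)
    · simp
  rw [Finset.sum_congr rfl fun σ _ => key σ]
  simp [Fintype.card_perm]

theorem toExt_injective {k : ℕ} : Function.Injective (toExt : Alt n k → Ext n) := by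
  intro a b h
  apply ext_frame
  intro p
  rw [← minor_toExt, h, minor_toExt]

@[simp] theorem castDeg_apply {k l : ℕ} (h : k = l) (a : Alt n k) (v : Fin l → Cn n) :
    castDeg h a v = a (fun i => v (Fin.cast h i)) := rfl

-- The exterior algebra does not record the degree index, so identities between forms of
-- propositionally equal degrees can be stated there without casts.
@[simp] theorem toExt_castDeg {k l : ℕ} (h : k = l) (a : Alt n k) : toExt (castDeg h a) = toExt a := by
  subst h
  rfl

theorem castDeg_eq_of_toExt_eq {k l m : ℕ} (h : k = m) (h' : l = m) {a : Alt n k} {b : Alt n l}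
    (hab : toExt a = toExt b) : castDeg h a = castDeg h' b :=
  toExt_injective (by simpa using hab)

theorem wedge_apply {k l : ℕ} (a : Alt n k) (b : Alt n l) (v : Fin (k + l) → Cn n) :
    wedge a b v = ((k.factorial : ℂ) * l.factorial)⁻¹ * ∑ σ : Equiv.Perm (Fin (k + l)),
      ((Equiv.Perm.sign σ : ℤ) : ℂ) *
        (a (fun i => v (σ (Fin.castAdd l i))) * b (fun j => v (σ (Fin.natAdd k j)))) := by
  rw [wedge, ContinuousAlternatingMap.smul_apply, ContinuousMultilinearMap.alternatization_apply_apply]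
  rw [Complex.real_smul]
  congr 1
  · push_cast; rw [one_div]
  · refine Finset.sum_congr rfl fun σ _ => ?_
    rw [Units.smul_def, zsmul_eq_mul]
    rfl

/-- For a fixed permutation `σ`, relabelling the indices by `σ` turns the summand into a product of
two independent sums, and the sign of `σ` cancels the one from reordering the monomial. The `(k+l)!`
equal terms absorb the normalisation. -/
theorem toExt_wedge {k l : ℕ} (a : Alt n k) (b : Alt n l) :
    toExt (wedge a b) = toExt a * toExt b := by
  have hkl : ((k + l).factorial : ℂ) ≠ 0 := by exact_mod_cast (k + l).factorial_ne_zero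
  rw [toExt_apply (wedge a b), inv_smul_eq_iff₀ hkl]
  simp only [wedge_apply, mul_smul, ← Finset.smul_sum, Finset.sum_smul]
  rw [Finset.sum_comm]
  have key : ∀ σ : Equiv.Perm (Fin (k + l)), ∑ p : Fin (k + l) → Fin (2 * n),
      ((Equiv.Perm.sign σ : ℤ) : ℂ) • a (fun i => frame n (p (σ (Fin.castAdd l i)))) •
        b (fun j => frame n (p (σ (Fin.natAdd k j)))) • mono p =
      ((k.factorial : ℂ) • toExt a) * ((l.factorial : ℂ) • toExt b) := by
    intro σ
    rw [factorial_smul_toExt, factorial_smul_toExt, Finset.sum_mul_sum, ← Fintype.sum_prod_type',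
      ← (Equiv.arrowCongr σ (Equiv.refl (Fin (2 * n)))).sum_comp,
      ← (Fin.appendEquiv k l).sum_comp]
    refine Finset.sum_congr rfl fun pq _ => ?_
    have h1 := mono_comp_perm (fun i => Fin.append pq.1 pq.2 i) σ⁻¹
    rw [Equiv.Perm.sign_inv] at h1
    have h2 : (Equiv.arrowCongr σ (Equiv.refl (Fin (2 * n)))) ((Fin.appendEquiv k l) pq) =
        fun i => Fin.append pq.1 pq.2 (σ⁻¹ i) := rfl
    rw [h2, h1]
    simp only [Equiv.Perm.coe_inv, Equiv.symm_apply_apply, Fin.append_left, Fin.append_right]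
    rw [mono_append, smul_mul_smul_comm, smul_smul, smul_smul, smul_smul]
    congr 1
    have : ((Equiv.Perm.sign σ : ℤ) : ℂ) * ((Equiv.Perm.sign σ : ℤ) : ℂ) = 1 := by
      rw [← Int.cast_mul, ← Units.val_mul, Int.units_mul_self]; simp
    linear_combination (a fun i ↦ frame n (pq.1 i)) * (b fun i ↦ frame n (pq.2 i)) * this
  rw [Finset.sum_congr rfl fun σ _ => key σ]
  have hk : (k.factorial : ℂ) ≠ 0 := by exact_mod_cast k.factorial_ne_zero
  have hl : (l.factorial : ℂ) ≠ 0 := by exact_mod_cast l.factorial_ne_zero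
  simp only [Finset.sum_const, Finset.card_univ, Fintype.card_perm, Fintype.card_fin, smul_mul_smul_comm,
    ← Nat.cast_smul_eq_nsmul ℂ, smul_smul]
  field_simp

theorem toExt_smul_real {k : ℕ} (c : ℝ) (a : Alt n k) : toExt (c • a) = (c : ℂ) • toExt a := by
  rw [← map_smul]
  congr 1

theorem toExt_wedgePow (a : Alt n 2) (p : ℕ) : toExt (wedgePow a p) = toExt a ^ p := by
  induction p with
  | zero => simp [wedgePow, toExt_apply, mono_zero]
  | succ p ih => rw [wedgePow, toExt_wedge, ih, pow_succ]

theorem toExt_dpow (a : Alt n 2) (p : ℕ) :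
    toExt (dpow a p) = ((p.factorial : ℂ)⁻¹) • toExt a ^ p := by
  rw [dpow, toExt_smul_real, toExt_wedgePow]
  simp

end Alt
end

/-! ### Alternatization, graded commutativity and contractions in the exterior algebra. -/

noncomputable section

namespace Alt

variable {n : ℕ}

theorem sum_fin_cons {M : Type*} [AddCommMonoid M] {ι : Type*} [Fintype ι] {k : ℕ}
    (F : (Fin (k + 1) → ι) → M) :
    ∑ p, F p = ∑ j : ι, ∑ p : Fin k → ι, F (Fin.cons j p) := by
  rw [← (Fin.consEquiv fun _ : Fin (k + 1) => ι).sum_comp, Fintype.sum_prod_type]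
  rfl

theorem sum_fin_snoc {M : Type*} [AddCommMonoid M] {ι : Type*} [Fintype ι] {k : ℕ}
    (F : (Fin (k + 1) → ι) → M) :
    ∑ p, F p = ∑ j : ι, ∑ p : Fin k → ι, F (Fin.snoc p j) := by
  rw [← (Fin.snocEquiv fun _ : Fin (k + 1) => ι).sum_comp, Fintype.sum_prod_type]
  rfl

theorem sum_fin_insertNth {M : Type*} [AddCommMonoid M] {ι : Type*} [Fintype ι] {k : ℕ}
    (i : Fin (k + 1)) (F : (Fin (k + 1) → ι) → M) :
    ∑ p, F p = ∑ j : ι, ∑ p : Fin k → ι, F (i.insertNth j p) := by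
  rw [← (Fin.insertNthEquiv (fun _ : Fin (k + 1) => ι) i).sum_comp, Fintype.sum_prod_type]
  rfl

theorem mono_snoc {k : ℕ} (p : Fin k → Fin (2 * n)) (j : Fin (2 * n)) :
    mono (Fin.snoc p j : Fin (k + 1) → Fin (2 * n)) = mono p * cov j := by
  have h : (Fin.snoc p j : Fin (k + 1) → Fin (2 * n)) = Fin.append p (fun _ : Fin 1 => j) := by
    rw [Fin.append_right_eq_snoc]
  have h2 : (fun _ : Fin 1 => j) = Fin.cons j (fun i : Fin 0 => i.elim0) := by
    funext i; fin_cases i; rfl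
  rw [h, mono_append, h2, mono_cons, mono_zero, mul_one]

theorem mono_insertNth {k : ℕ} (i : Fin (k + 1)) (j : Fin (2 * n)) (p : Fin k → Fin (2 * n)) :
    mono (i.insertNth j p : Fin (k + 1) → Fin (2 * n)) = ((-1 : ℂ) ^ (i : ℕ)) • (cov j * mono p) := by
  rw [← mono_cons]
  have h := Fin.cons_comp_cycleRange j p i
  rw [← h]
  have h2 := mono_comp_perm (Fin.cons j p : Fin (k + 1) → Fin (2 * n)) i.cycleRange
  rw [Fin.sign_cycleRange] at h2
  simpa using h2

/-- The `k + 1` positions in which the new slot can be inserted contribute equally, because the sign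
of the alternatization is undone by moving the covector to the front. Exterior derivatives thereby
become sums of left multiplications by covectors. -/
theorem toExt_alternatizeUncurryFin {k : ℕ} (L : Cn n →L[ℝ] Alt n k) :
    toExt (ContinuousAlternatingMap.alternatizeUncurryFin L) =
      ∑ j, cov j * toExt (L (frame n j)) := by
  have hk : (((k + 1).factorial : ℕ) : ℂ) ≠ 0 := by exact_mod_cast (k + 1).factorial_ne_zero
  have hk' : ((k.factorial : ℕ) : ℂ) ≠ 0 := by exact_mod_cast k.factorial_ne_zero
  rw [toExt_apply, inv_smul_eq_iff₀ hk]
  simp only [ContinuousAlternatingMap.alternatizeUncurryFin_apply, Finset.sum_smul]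
  rw [Finset.sum_comm]
  have key : ∀ i : Fin (k + 1), ∑ p : Fin (k + 1) → Fin (2 * n),
      ((-1 : ℤ) ^ (i : ℕ) • L (frame n (p i)) (i.removeNth fun i => frame n (p i))) • mono p =
      (k.factorial : ℂ) • ∑ j, cov j * toExt (L (frame n j)) := by
    intro i
    rw [sum_fin_insertNth i, Finset.smul_sum]
    refine Finset.sum_congr rfl fun j _ => ?_
    rw [← mul_smul_comm, factorial_smul_toExt, Finset.mul_sum]
    refine Finset.sum_congr rfl fun p _ => ?_
    have h1 : (i.removeNth fun i' => frame n ((i.insertNth j p : Fin (k + 1) → Fin (2 * n)) i')) =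
        fun i' => frame n (p i') := by
      funext i'
      simp [Fin.removeNth]
    rw [h1, mono_insertNth, Fin.insertNth_apply_same, mul_smul_comm, smul_smul, zsmul_eq_mul]
    congr 1
    have : ((-1 : ℂ) ^ (i : ℕ)) * (-1 : ℂ) ^ (i : ℕ) = 1 := by rw [← mul_pow]; simp
    push_cast
    linear_combination L (frame n j) (fun i' => frame n (p i')) * this
  rw [Finset.sum_congr rfl fun i _ => key i, Finset.sum_const, Finset.card_univ, Fintype.card_fin,
    Nat.factorial_succ, ← Nat.cast_smul_eq_nsmul ℂ, smul_smul]
  push_cast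
  rfl

/-- Euler's identity for forms. It expresses a form through its contractions and so drives
inductions on the degree. -/
theorem sum_cov_mul_curryLeft {k : ℕ} (a : Alt n (k + 1)) :
    ∑ j, cov j * toExt (a.curryLeft (frame n j)) = ((k : ℂ) + 1) • toExt a := by
  rw [← toExt_alternatizeUncurryFin, ContinuousAlternatingMap.alternatizeUncurryFin_curryLeft,
    map_nsmul, ← Nat.cast_smul_eq_nsmul ℂ]
  push_cast
  rfl

theorem cov_mul_cov (i j : Fin (2 * n)) : cov i * cov j = -(cov j * cov i) :=
  eq_neg_of_add_eq_zero_left (ExteriorAlgebra.ι_add_mul_swap _ _)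

theorem cov_mul_mono {k : ℕ} (j : Fin (2 * n)) (p : Fin k → Fin (2 * n)) :
    cov j * mono p = (-1 : ℂ) ^ k • (mono p * cov j) := by
  induction k with
  | zero => simp [mono_zero]
  | succ k ih =>
    rw [← Fin.cons_self_tail p, mono_cons, ← mul_assoc, cov_mul_cov, neg_mul, mul_assoc, ih,
      mul_smul_comm, pow_succ, mul_neg_one, neg_smul, mul_assoc]

theorem cov_mul_toExt {k : ℕ} (j : Fin (2 * n)) (a : Alt n k) :
    cov j * toExt a = (-1 : ℂ) ^ k • (toExt a * cov j) := by
  simp only [toExt_apply, mul_smul_comm, smul_mul_assoc, Finset.mul_sum, Finset.sum_mul,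
    Finset.smul_sum, cov_mul_mono]
  refine Finset.sum_congr rfl fun p _ => ?_
  simp only [smul_smul]
  congr 1
  ring

theorem mono_mul_toExt {k l : ℕ} (p : Fin l → Fin (2 * n)) (a : Alt n k) :
    mono p * toExt a = (-1 : ℂ) ^ (l * k) • (toExt a * mono p) := by
  induction l with
  | zero => simp [mono_zero]
  | succ l ih =>
    rw [← Fin.cons_self_tail p, mono_cons, mul_assoc, ih, mul_smul_comm, ← mul_assoc,
      cov_mul_toExt, smul_mul_assoc, smul_smul, mul_assoc, ← pow_add]
    congr 2
    ring

theorem toExt_mul_comm {k l : ℕ} (a : Alt n k) (b : Alt n l) :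
    toExt a * toExt b = (-1 : ℂ) ^ (k * l) • (toExt b * toExt a) := by
  rw [toExt_apply a]
  simp only [mul_smul_comm, smul_mul_assoc, Finset.mul_sum, Finset.sum_mul,
    Finset.smul_sum, mono_mul_toExt]
  refine Finset.sum_congr rfl fun p _ => ?_
  simp only [smul_smul]
  congr 1
  ring

theorem toExt_commute_two {k : ℕ} (a : Alt n 2) (b : Alt n k) :
    toExt a * toExt b = toExt b * toExt a := by
  rw [toExt_mul_comm, pow_mul]
  simp

theorem eq_zero_of_lt {k : ℕ} (h : 2 * n < k) (a : Alt n k) : a = 0 := by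
  apply ext_frame
  intro p
  change a _ = 0
  obtain ⟨i, j, hij, hp⟩ : ∃ i j, i ≠ j ∧ p i = p j := by
    by_contra! hc
    have := Fintype.card_le_of_injective p fun i j hij => by
      by_contra hne
      exact hc i j hne hij
    simp at this
    omega
  exact a.map_eq_zero_of_eq _ (by simp only [hp]) hij

theorem toExt_mul_eq_zero {k l : ℕ} (h : 2 * n < k + l) (a : Alt n k) (b : Alt n l) :
    toExt a * toExt b = 0 := by
  rw [← toExt_wedge, eq_zero_of_lt h (wedge a b), map_zero]

/-! ### Contractions -/

/-- Contraction of an element of the exterior algebra with the complex tangent vector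
`∑_j d_j f_j`. -/
def con : (Fin (2 * n) → ℂ) →ₗ[ℂ] Ext n →ₗ[ℂ] Ext n :=
  (CliffordAlgebra.contractLeft (Q := (0 : QuadraticForm ℂ (Fin (2 * n) → ℂ)))).comp
    (dotProductBilin ℂ ℂ)

theorem con_cov_mul (d : Fin (2 * n) → ℂ) (j : Fin (2 * n)) (x : Ext n) :
    con d (cov j * x) = d j • x - cov j * con d x := by
  have h := CliffordAlgebra.contractLeft_ι_mul (Q := (0 : QuadraticForm ℂ (Fin (2 * n) → ℂ)))
    (dotProductBilin ℂ ℂ d) (Pi.single j 1) x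
  have h2 : dotProductBilin ℂ ℂ d (Pi.single j 1) = d j := by simp
  rw [h2] at h
  exact h

theorem con_one (d : Fin (2 * n) → ℂ) : con d (1 : Ext n) = 0 :=
  CliffordAlgebra.contractLeft_one _ _

theorem con_cov (d : Fin (2 * n) → ℂ) (j : Fin (2 * n)) : con d (cov j) = d j • (1 : Ext n) := by
  rw [← mul_one (cov j), con_cov_mul, con_one, mul_zero, sub_zero]

theorem con_con (d : Fin (2 * n) → ℂ) (x : Ext n) : con d (con d x) = 0 :=
  CliffordAlgebra.contractLeft_contractLeft _ x

theorem con_mono_mul (d : Fin (2 * n) → ℂ) {k : ℕ} (p : Fin k → Fin (2 * n)) (x : Ext n) :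
    con d (mono p * x) = con d (mono p) * x + (-1 : ℂ) ^ k • (mono p * con d x) := by
  induction k with
  | zero => simp [mono_zero, con_one]
  | succ k ih =>
    rw [← Fin.cons_self_tail p, mono_cons, mul_assoc, con_cov_mul, con_cov_mul, ih, mul_add, sub_mul,
      smul_mul_assoc, mul_smul_comm, pow_succ, mul_neg_one, neg_smul, mul_assoc, mul_assoc]
    abel

theorem con_toExt_mul (d : Fin (2 * n) → ℂ) {k : ℕ} (a : Alt n k) (x : Ext n) :
    con d (toExt a * x) = con d (toExt a) * x + (-1 : ℂ) ^ k • (toExt a * con d x) := by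
  simp only [toExt_apply, smul_mul_assoc, Finset.sum_mul, map_smul, map_sum, con_mono_mul, smul_add,
    Finset.sum_add_distrib, Finset.smul_sum]
  congr 1
  refine Finset.sum_congr rfl fun p _ => ?_
  simp only [smul_smul]
  congr 1
  ring

/-- The complexified coordinates of a vector in the standard frame. -/
def coords (v : Cn n) (j : Fin (2 * n)) : ℂ := (frameCoord v j : ℂ)

theorem coords_frame (i : Fin (2 * n)) : coords (frame n i) = Pi.single i 1 := by
  funext j
  simp only [coords, frameCoord_frame, Pi.single_apply, eq_comm]
  split_ifs <;> simp

theorem map_eq_sum_coords {k : ℕ} (L : Cn n →L[ℝ] Alt n k) (v : Cn n) :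
    L v = ∑ j, coords v j • L (frame n j) := by
  conv_lhs => rw [← sum_frameCoord v]
  rw [map_sum]
  refine Finset.sum_congr rfl fun j _ => ?_
  rw [map_smul]
  ext w
  simp [coords]

theorem toExt_zero_degree (a : Alt n 0) : toExt a = a ![] • (1 : Ext n) := by
  rw [toExt_apply]
  simp only [Nat.factorial_zero, Nat.cast_one, inv_one, one_smul, mono_zero]
  rw [Fintype.sum_unique]
  congr 2
  exact Subsingleton.elim _ _

theorem con_toExt_zero (d : Fin (2 * n) → ℂ) (a : Alt n 0) : con d (toExt a) = 0 := by
  rw [toExt_zero_degree, map_smul, con_one, smul_zero]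

theorem curryLeft_swap {k : ℕ} (a : Alt n (k + 2)) (u v : Cn n) :
    (a.curryLeft u).curryLeft v = -(a.curryLeft v).curryLeft u := by
  ext w
  have h := a.toAlternatingMap.map_swap (Fin.cons v (Fin.cons u w : Fin (k + 1) → Cn n))
    (i := 0) (j := 1) (by simp)
  have h2 : (Fin.cons v (Fin.cons u w : Fin (k + 1) → Cn n) : Fin (k + 2) → Cn n) ∘
      Equiv.swap (0 : Fin (k + 2)) 1 = Fin.cons u (Fin.cons v w : Fin (k + 1) → Cn n) := by
    funext i
    refine Fin.cases ?_ (fun i => Fin.cases ?_ (fun i => ?_) i) i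
    · simp
    · simp
    · rw [Function.comp_apply, Equiv.swap_apply_of_ne_of_ne]
      · rfl
      · simp
      · simp [Fin.ext_iff]
  rw [h2] at h
  exact h

/-- By induction on the degree: apply the antiderivation `con` to Euler's identity. The covectors
contribute the contraction once, and swapping the two insertions in the remaining terms contributes
it `k` more times. -/
theorem con_toExt {k : ℕ} (v : Cn n) (a : Alt n (k + 1)) :
    con (coords v) (toExt a) = toExt (a.curryLeft v) := by
  have hk : ((k : ℂ) + 1) ≠ 0 := by exact_mod_cast k.succ_ne_zero
  have key : ((k : ℂ) + 1) • con (coords v) (toExt a) = ((k : ℂ) + 1) • toExt (a.curryLeft v) := by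
    rw [← map_smul, ← sum_cov_mul_curryLeft, map_sum]
    simp only [con_cov_mul, Finset.sum_sub_distrib]
    have h1 : ∑ j, coords v j • toExt (a.curryLeft (frame n j)) = toExt (a.curryLeft v) := by
      rw [map_eq_sum_coords a.curryLeft v]
      simp
    rw [h1]
    cases k with
    | zero => simp [con_toExt_zero]
    | succ k =>
      have h2 : ∑ j, cov j * con (coords v) (toExt (a.curryLeft (frame n j))) =
          -(((k : ℂ) + 1) • toExt (a.curryLeft v)) := by
        rw [← sum_cov_mul_curryLeft, ← Finset.sum_neg_distrib]
        refine Finset.sum_congr rfl fun j _ => ?_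
        rw [con_toExt v, curryLeft_swap, map_neg, mul_neg]
      rw [h2]
      push_cast
      module
  exact smul_right_injective _ hk key

theorem contract_apply {m l k : ℕ} (h : m + l = k) (v : Fin m → Cn n) (a : Alt n k)
    (w : Fin l → Cn n) : contract h v a w = a (fun i => Fin.append v w (Fin.cast h.symm i)) := rfl

theorem contract_zero {l k : ℕ} (h : 0 + l = k) (v : Fin 0 → Cn n) (a : Alt n k) :
    toExt (contract h v a) = toExt a := by
  have : contract h v a = castDeg (by omega) a := by
    ext w
    rw [contract_apply, castDeg_apply]
    congr 1
    funext i
    subst h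
    rw [Fin.append_left_nil _ _ rfl]
    rfl
  rw [this, toExt_castDeg]

theorem contract_snoc {m l k : ℕ} (h : m + 1 + l = k) (v : Fin m → Cn n) (u : Cn n) (a : Alt n k) :
    contract h (Fin.snoc v u : Fin (m + 1) → Cn n) a =
      (contract (l := l + 1) (by omega) v a).curryLeft u := by
  ext w
  change _ = contract (l := l + 1) (by omega) v a (Fin.cons u w)
  rw [contract_apply, contract_apply]
  subst h
  congr 1
  funext i
  rw [← Fin.append_right_eq_snoc v (fun _ => u)]
  rw [Fin.append_assoc, Function.comp_apply, Fin.append_left_eq_cons]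
  have h1 : (Fin.append v (Fin.cons u w : Fin (l + 1) → Cn n)) =
      fun i => Fin.append v ((Fin.cons u w : Fin (l + 1) → Cn n) ∘ Fin.cast (Nat.add_comm 1 l))
        (Fin.cast (by omega) i) := by
    funext i
    refine Fin.addCases (fun i => ?_) (fun i => ?_) i
    · rw [Fin.append_left]
      exact (Fin.append_left v _ i).symm
    · rw [Fin.append_right]
      exact (Fin.append_right v ((Fin.cons u w : Fin (l + 1) → Cn n) ∘ Fin.cast (Nat.add_comm 1 l))
        (Fin.cast (Nat.add_comm l 1) i)).symm
  rw [h1]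
  rfl

theorem toExt_contract_snoc {m l k : ℕ} (h : m + 1 + l = k) (v : Fin m → Cn n) (u : Cn n)
    (a : Alt n k) :
    toExt (contract h (Fin.snoc v u : Fin (m + 1) → Cn n) a) =
      con (coords u) (toExt (contract (l := l + 1) (by omega) v a)) := by
  rw [contract_snoc, con_toExt]

/-- For a form `V` of top degree, `a ∧ V(v₁, …, v_m, ·) = a(v₁, …, v_m) V`. -/
theorem toExt_mul_contract {m l : ℕ} (h : m + l = 2 * n) (v : Fin m → Cn n) (a : Alt n m)
    (V : Alt n (2 * n)) : toExt a * toExt (contract h v V) = a v • toExt V := by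
  induction m generalizing l with
  | zero =>
    rw [contract_zero, toExt_zero_degree, smul_mul_assoc, one_mul]
    congr 2
    exact Subsingleton.elim _ _
  | succ m ih =>
    rw [← Fin.snoc_init_self v]
    set u := v (Fin.last m)
    set w : Fin m → Cn n := Fin.init v
    -- The product has degree `2n + 1` and vanishes; contracting it with `u` relates the two ways of
    -- placing the last vector.
    have h0 := con_toExt_mul (coords u) a (toExt (contract (l := l + 1) (by omega) w V))
    rw [toExt_mul_eq_zero (by omega), map_zero, con_toExt, ih] at h0
    have h1 : a (Fin.snoc w u) = (-1 : ℂ) ^ m * a.curryLeft u w := by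
      rw [Fin.snoc_eq_cons_rotate, apply_comp_perm, sign_finRotate]
      push_cast
      rfl
    rw [toExt_contract_snoc, h1, mul_smul]
    rw [pow_succ, mul_neg_one, neg_smul] at h0
    rw [← sub_eq_add_neg, eq_comm, sub_eq_zero] at h0
    rw [h0, smul_smul, ← mul_pow]
    simp

end Alt
end

/-! ### Positive `(1,1)`-forms, their Gram matrices, and the star as a contraction. -/

noncomputable section

namespace Alt

variable {n : ℕ}

/-! ### Two-forms -/

/-- A form is positive if it is the fundamental form of a Hermitian inner product. -/
structure IsPositive (γ : Alt n 2) : Prop where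
  type11 : IsType11 γ
  real : ∀ u v, (γ ![u, v]).im = 0
  pos : ∀ u, u ≠ 0 → 0 < (γ ![u, Complex.I • u]).re

theorem apply_two (a : Alt n 2) (u v : Cn n) : a ![u, v] = (a.curryLeft u).curryLeft v ![] := rfl

theorem apply_two_swap (a : Alt n 2) (u v : Cn n) : a ![u, v] = -a ![v, u] := by
  rw [apply_two, apply_two, curryLeft_swap]
  rfl

theorem apply_two_left (a : Alt n 2) (u v : Cn n) :
    a ![u, v] = ∑ j, coords u j * a ![frame n j, v] := by
  simp only [apply_two]
  rw [map_eq_sum_coords a.curryLeft u]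
  have : ∀ (s : Finset (Fin (2 * n))), ((∑ j ∈ s, coords u j • a.curryLeft (frame n j)).curryLeft v) ![]
      = ∑ j ∈ s, coords u j * ((a.curryLeft (frame n j)).curryLeft v ![]) := by
    intro s
    induction s using Finset.induction_on with
    | empty => simp
    | insert j s hj ih => rw [Finset.sum_insert hj, Finset.sum_insert hj, ← ih]; rfl
  exact this _

theorem apply_two_right (a : Alt n 2) (u v : Cn n) :
    a ![u, v] = ∑ j, coords v j * a ![u, frame n j] := by
  rw [apply_two_swap, apply_two_left, ← Finset.sum_neg_distrib]
  refine Finset.sum_congr rfl fun j _ => ?_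
  rw [apply_two_swap, mul_neg, neg_neg]

theorem toExt_one (a : Alt n 1) : toExt a = ∑ p, a ![frame n p] • cov p := by
  rw [toExt_apply, sum_fin_cons]
  simp only [Nat.factorial_one, Nat.cast_one, inv_one, one_smul, mono_cons, mono_zero, mul_one,
    Fintype.sum_unique]
  refine Finset.sum_congr rfl fun p _ => ?_
  congr 2
  funext i
  fin_cases i
  rfl

theorem toExt_two (a : Alt n 2) :
    toExt a = (2 : ℂ)⁻¹ • ∑ p, ∑ q, a ![frame n p, frame n q] • (cov p * cov q) := by
  rw [toExt_apply, sum_fin_cons]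
  simp only [sum_fin_cons (k := 0)]
  simp only [Nat.factorial_two, Nat.cast_ofNat, mono_cons, mono_zero, mul_one, Fintype.sum_unique]
  congr 1
  refine Finset.sum_congr rfl fun p _ => Finset.sum_congr rfl fun q _ => ?_
  congr 2
  funext i
  fin_cases i <;> rfl

theorem apply_two_I_left {γ : Alt n 2} (h : IsType11 γ) (u v : Cn n) :
    γ ![Complex.I • u, v] = -γ ![u, Complex.I • v] := by
  rw [← h u (Complex.I • v), smul_smul, Complex.I_mul_I, neg_one_smul]
  rw [apply_two_swap γ _ (-v), apply_two_swap γ _ v, apply_two, apply_two, map_neg]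
  simp

theorem apply_two_neg_right (γ : Alt n 2) (u v : Cn n) : γ ![u, -v] = -γ ![u, v] := by
  rw [apply_two, apply_two, map_neg]
  rfl

theorem gram_transpose {γ : Alt n 2} (h : IsType11 γ) : (gram γ).transpose = gram γ := by
  ext p q
  simp only [Matrix.transpose_apply, gram, Matrix.of_apply]
  rw [apply_two_swap, apply_two_I_left h, neg_neg]

theorem coords_linear (L : Cn n →L[ℝ] Cn n) (v : Cn n) (p : Fin (2 * n)) :
    coords (L v) p = ∑ r, coords v r * coords (L (frame n r)) p := by
  simp only [coords, ← frameBasis_repr]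
  conv_lhs => rw [← sum_frameCoord v]
  rw [map_sum, map_sum, Finsupp.finsetSum_apply]
  push_cast
  refine Finset.sum_congr rfl fun r _ => ?_
  rw [map_smul, map_smul, Finsupp.smul_apply, smul_eq_mul]
  push_cast
  rfl

/-- Multiplication by `i` as a real-linear map. -/
def mulI (n : ℕ) : Cn n →L[ℝ] Cn n := Complex.I • ContinuousLinearMap.id ℝ (Cn n)

@[simp] theorem mulI_apply (v : Cn n) : mulI n v = Complex.I • v := rfl

/-- The matrix of the complex structure in the standard real frame. -/
def cplx (p r : Fin (2 * n)) : ℂ := coords (Complex.I • frame n r) p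

theorem coords_I_smul (v : Cn n) (p : Fin (2 * n)) :
    coords (Complex.I • v) p = ∑ r, coords v r * cplx p r :=
  coords_linear (mulI n) v p

theorem frameCoord_sum (c : Fin (2 * n) → ℝ) : frameCoord (∑ j, c j • frame n j) = c := by
  have h := (frameBasis n).repr_sum_self c
  simp only [frameBasis_apply] at h
  exact h

/-- The Gram matrix has complex entries that happen to be real, so the real and imaginary parts of a
kernel vector lie in the kernel separately, and each is killed by positivity of the real quadratic
form. -/
theorem IsPositive.isUnit_det_gram {γ : Alt n 2} (h : IsPositive γ) : IsUnit (gram γ).det := by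
  rw [isUnit_iff_ne_zero]
  intro hdet
  obtain ⟨c, hc, hGc⟩ := Matrix.exists_mulVec_eq_zero_iff.mpr hdet
  have key : ∀ a : Fin (2 * n) → ℝ, (∀ p, ∑ q, (gram γ p q).re * a q = 0) → a = 0 := by
    intro a ha
    by_contra hne
    set u : Cn n := ∑ q, a q • frame n q with hu
    have hcoord : ∀ j, coords u j = a j := by
      intro j
      rw [coords, hu, frameCoord_sum]
    have hu0 : u ≠ 0 := by
      intro h0
      apply hne
      rw [← frameCoord_sum a, ← hu, h0]
      funext j
      simp [frameCoord]
    have hpos := h.pos u hu0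
    have hsum : γ ![u, Complex.I • u] = ∑ p, (a p : ℂ) * ∑ q, gram γ p q * (a q : ℂ) := by
      rw [apply_two_left]
      refine Finset.sum_congr rfl fun p _ => ?_
      rw [hcoord, ← neg_eq_iff_eq_neg.mpr (apply_two_I_left h.type11 (frame n p) u), apply_two_right,
        ← Finset.sum_neg_distrib]
      congr 1
      refine Finset.sum_congr rfl fun q _ => ?_
      rw [hcoord, apply_two_I_left h.type11, mul_neg, neg_neg, mul_comm]
      rfl
    rw [hsum, Complex.re_sum, Finset.sum_eq_zero] at hpos
    · exact lt_irrefl _ hpos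
    · intro p _
      rw [Complex.re_ofReal_mul, Complex.re_sum]
      simp only [Complex.mul_re, Complex.ofReal_re, Complex.ofReal_im, mul_zero, sub_zero]
      rw [ha, mul_zero]
  have him : ∀ p q, (gram γ p q).im = 0 := fun p q => h.real _ _
  apply hc
  have hre := key (fun q => (c q).re) fun p => by
    have := congrArg Complex.re (congrFun hGc p)
    simpa [Matrix.mulVec, dotProduct, Complex.mul_re, him] using this
  have him' := key (fun q => (c q).im) fun p => by
    have := congrArg Complex.im (congrFun hGc p)
    simpa [Matrix.mulVec, dotProduct, Complex.mul_im, him] using this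
  funext q
  exact Complex.ext (congrFun hre q) (congrFun him' q)

theorem gram_symm {γ : Alt n 2} (h : IsType11 γ) (p q : Fin (2 * n)) : gram γ p q = gram γ q p :=
  congrFun (congrFun (gram_transpose h) q) p

theorem apply_frame_eq_sum {γ : Alt n 2} (q r : Fin (2 * n)) :
    γ ![frame n q, frame n r] = -∑ s, cplx s r * gram γ q s := by
  -- Writing the second vector as `-J(Jv)` introduces the `J` that the Gram matrix requires.
  have h1 : frame n r = -(Complex.I • (Complex.I • frame n r)) := by
    rw [smul_smul, Complex.I_mul_I, neg_one_smul, neg_neg]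
  conv_lhs => rw [h1]
  rw [apply_two_neg_right]
  congr 1
  have h2 : ∀ v : Cn n, γ ![frame n q, Complex.I • v] = ∑ s, coords v s * gram γ q s := by
    intro v
    rw [apply_two_right]
    simp only [coords_I_smul, Finset.sum_mul, gram, Matrix.of_apply]
    rw [Finset.sum_comm]
    refine Finset.sum_congr rfl fun s _ => ?_
    rw [apply_two_right _ _ (Complex.I • frame n s), Finset.mul_sum]
    refine Finset.sum_congr rfl fun r _ => ?_
    rw [cplx]
    ring
  exact h2 _

/-- The inverse of the Gram matrix. -/
def gramInv (γ : Alt n 2) (p q : Fin (2 * n)) : ℂ := (gram γ)⁻¹ p q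

theorem gramInv_symm {γ : Alt n 2} (h : IsType11 γ) (p q : Fin (2 * n)) :
    gramInv γ p q = gramInv γ q p := by
  have h2 := Matrix.transpose_nonsing_inv (gram γ)
  rw [gram_transpose h] at h2
  exact congrFun (congrFun h2 q) p

theorem IsPositive.sum_gramInv_mul {γ : Alt n 2} (h : IsPositive γ) (p s : Fin (2 * n)) :
    ∑ q, gramInv γ p q * gram γ q s = if p = s then 1 else 0 := by
  have := congrFun (congrFun (Matrix.nonsing_inv_mul (gram γ) h.isUnit_det_gram) p) s
  rwa [Matrix.mul_apply, Matrix.one_apply] at this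

/-! ### The Hodge star as an operator on the exterior algebra -/

/-- Contraction with the dual of the `p`-th covector of the frame. -/
def conG (γ : Alt n 2) (p : Fin (2 * n)) : Ext n →ₗ[ℂ] Ext n := con (gramInv γ p)

/-- Contraction with the dual of a covector. -/
def conOp (γ : Alt n 2) : (Fin (2 * n) → ℂ) →ₗ[ℂ] (Module.End ℂ (Ext n))ᵐᵒᵖ where
  toFun m := MulOpposite.op (con fun q => ∑ p, m p * gramInv γ p q)
  map_add' a b := by
    rw [← MulOpposite.op_add, ← map_add]
    congr 2
    funext q
    simp [add_mul, Finset.sum_add_distrib]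
  map_smul' c a := by
    rw [RingHom.id_apply, ← MulOpposite.op_smul, ← map_smul]
    congr 2
    funext q
    simp [Finset.mul_sum, mul_assoc]

theorem conOp_mul_self (γ : Alt n 2) (m : Fin (2 * n) → ℂ) : conOp γ m * conOp γ m = 0 :=
  MulOpposite.unop_injective (LinearMap.ext fun x => con_con _ x)

/-- The action of the exterior algebra on itself by contractions with dual vectors. -/
def dualOp (γ : Alt n 2) : Ext n →ₐ[ℂ] (Module.End ℂ (Ext n))ᵐᵒᵖ :=
  ExteriorAlgebra.lift ℂ ⟨conOp γ, conOp_mul_self γ⟩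

/-- Contraction of `z` with the dual multivector of `x`. -/
def sharp (γ : Alt n 2) : Ext n →ₗ[ℂ] Ext n →ₗ[ℂ] Ext n where
  toFun x := (dualOp γ x).unop
  map_add' x y := by rw [map_add, MulOpposite.unop_add]
  map_smul' c x := by rw [map_smul, MulOpposite.unop_smul, RingHom.id_apply]

/-- Contractions compose in the order opposite to multiplication, which is why `dualOp` takes values
in the opposite algebra: the leftmost factor fills the first slot of `z`, as in the index definition
of the star. -/
theorem sharp_mul (γ : Alt n 2) (x y z : Ext n) : sharp γ (x * y) z = sharp γ y (sharp γ x z) := by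
  change (dualOp γ (x * y)).unop z = (dualOp γ y).unop ((dualOp γ x).unop z)
  rw [map_mul, MulOpposite.unop_mul]
  rfl

theorem sharp_one (γ : Alt n 2) (z : Ext n) : sharp γ 1 z = z := by
  change (dualOp γ 1).unop z = z
  rw [map_one]
  rfl

theorem sharp_cov (γ : Alt n 2) (p : Fin (2 * n)) (z : Ext n) : sharp γ (cov p) z = conG γ p z := by
  change (dualOp γ (cov p)).unop z = _
  rw [dualOp, cov, ExteriorAlgebra.lift_ι_apply]
  change con (fun q => ∑ r, (Pi.single p 1 : Fin (2 * n) → ℂ) r * gramInv γ r q) z = _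
  simp only [Pi.single_apply, ite_mul, one_mul, zero_mul, Finset.sum_ite_eq', Finset.mem_univ, if_true]
  rfl

theorem con_eq_sum (d : Fin (2 * n) → ℂ) (x : Ext n) :
    con d x = ∑ j, d j • con (coords (frame n j)) x := by
  have hd : d = ∑ j, d j • coords (frame n j) := by
    funext i
    simp [coords_frame, Finset.sum_apply, Pi.single_apply]
  conv_lhs => rw [hd]
  rw [map_sum, LinearMap.sum_apply]
  simp only [map_smul, LinearMap.smul_apply]

/-- The left side is the index formula for the star. Peeling off the last index corresponds to
splitting off the last factor of the monomial, whose raised covector is contracted last. -/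
theorem sum_contract_eq_sharp (γ : Alt n 2) {k l : ℕ} (h : k + l = 2 * n) (p : Fin k → Fin (2 * n))
    (V : Alt n (2 * n)) :
    ∑ q : Fin k → Fin (2 * n), (∏ i, gramInv γ (p i) (q i)) •
      toExt (contract h (fun i => frame n (q i)) V) = sharp γ (mono p) (toExt V) := by
  induction k generalizing l with
  | zero => simp [contract_zero, mono_zero, sharp_one]
  | succ k ih =>
    rw [sum_fin_snoc, ← Fin.snoc_init_self p, mono_snoc, sharp_mul, ← ih (l := l + 1) (by omega),
      sharp_cov, conG, con_eq_sum]
    refine Finset.sum_congr rfl fun j _ => ?_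
    rw [map_sum, Finset.smul_sum]
    refine Finset.sum_congr rfl fun q _ => ?_
    have h1 : (fun i => frame n ((Fin.snoc q j : Fin (k + 1) → Fin (2 * n)) i)) =
        (Fin.snoc (fun i => frame n (q i)) (frame n j) : Fin (k + 1) → Cn n) :=
      Fin.comp_snoc (frame n) q j
    rw [h1, toExt_contract_snoc, Fin.prod_univ_castSucc, map_smul, smul_smul]
    simp only [Fin.snoc_castSucc, Fin.snoc_last]
    exact congrArg (· • _) (mul_comm _ _)

theorem hodgeStar_eq (γ : Alt n 2) {k l : ℕ} (h : k + l = 2 * n) (a : Alt n k) :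
    hodgeStar h γ a = ((1 : ℂ) / (k.factorial : ℂ)) • ∑ p : Fin k → Fin (2 * n),
      ∑ q : Fin k → Fin (2 * n), ((∏ i, gramInv γ (p i) (q i)) * a (fun i => frame n (p i))) •
        contract h (fun i => frame n (q i)) (dpow γ n) := rfl

theorem toExt_hodgeStar (γ : Alt n 2) {k l : ℕ} (h : k + l = 2 * n) (a : Alt n k) :
    toExt (hodgeStar h γ a) = sharp γ (toExt a) (toExt (dpow γ n)) := by
  rw [toExt_apply a, map_smul, LinearMap.smul_apply, map_sum, LinearMap.sum_apply, hodgeStar_eq,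
    map_smul, map_sum, one_div]
  congr 1
  refine Finset.sum_congr rfl fun p _ => ?_
  rw [map_smul, LinearMap.smul_apply, ← sum_contract_eq_sharp γ h, map_sum, Finset.smul_sum]
  refine Finset.sum_congr rfl fun q _ => ?_
  rw [map_smul, smul_smul]
  exact congrArg (· • _) (mul_comm _ _)

end Alt
end

/-! ### The star on powers of the metric and on `(1,1)`-forms; its bijectivity. -/

noncomputable section

namespace Alt

variable {n : ℕ}

/-- The covector `-e^p ∘ J`. -/
def jcov (p : Fin (2 * n)) : Ext n := -∑ r, cplx p r • cov r

theorem toExt_curryLeft_two (a : Alt n 2) (u : Cn n) :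
    toExt (a.curryLeft u) = ∑ r, a ![u, frame n r] • cov r := by
  rw [toExt_one]
  rfl

theorem conG_eq_sum (γ : Alt n 2) (p : Fin (2 * n)) (x : Ext n) :
    conG γ p x = ∑ j, gramInv γ p j • con (coords (frame n j)) x := con_eq_sum _ _

/-- Since `γ` is the metric composed with `J`, raising the index of `e^p` cancels the Gram matrix
and only `J` remains; the result does not depend on `γ`. -/
theorem conG_toExt_self {γ : Alt n 2} (h : IsPositive γ) (p : Fin (2 * n)) :
    conG γ p (toExt γ) = jcov p := by
  rw [conG_eq_sum]
  simp only [con_toExt, toExt_curryLeft_two, Finset.smul_sum, smul_smul]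
  rw [Finset.sum_comm, jcov, ← Finset.sum_neg_distrib]
  refine Finset.sum_congr rfl fun r _ => ?_
  rw [← Finset.sum_smul, ← neg_smul]
  congr 1
  simp only [apply_frame_eq_sum, mul_neg, Finset.sum_neg_distrib, Finset.mul_sum]
  rw [Finset.sum_comm]
  congr 1
  calc ∑ s, ∑ q, gramInv γ p q * (cplx s r * gram γ q s)
      = ∑ s, cplx s r * ∑ q, gramInv γ p q * gram γ q s := by
        refine Finset.sum_congr rfl fun s _ => ?_
        rw [Finset.mul_sum]
        exact Finset.sum_congr rfl fun q _ => by ring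
    _ = cplx p r := by simp [h.sum_gramInv_mul]

theorem conG_cov (γ : Alt n 2) (p r : Fin (2 * n)) : conG γ p (cov r) = gramInv γ p r • (1 : Ext n) :=
  con_cov _ _

theorem conG_jcov (γ : Alt n 2) (q p : Fin (2 * n)) :
    conG γ q (jcov p) = (-∑ r, cplx p r * gramInv γ q r) • (1 : Ext n) := by
  rw [jcov, map_neg, map_sum, neg_smul, Finset.sum_smul]
  simp only [map_smul, conG_cov, smul_smul]

theorem conG_toExt_mul (γ : Alt n 2) (p : Fin (2 * n)) {k : ℕ} (a : Alt n (2 * k)) (x : Ext n) :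
    conG γ p (toExt a * x) = conG γ p (toExt a) * x + toExt a * conG γ p x := by
  rw [conG, con_toExt_mul, pow_mul]
  simp

theorem succ_smul_toExt_dpow (a : Alt n 2) (k : ℕ) :
    ((k : ℂ) + 1) • toExt (dpow a (k + 1)) = toExt (dpow a k) * toExt a := by
  rw [toExt_dpow, toExt_dpow, smul_mul_assoc, ← pow_succ, smul_smul, Nat.factorial_succ]
  congr 1
  have : ((k : ℂ) + 1) ≠ 0 := by exact_mod_cast k.succ_ne_zero
  push_cast
  field_simp

theorem toExt_dpow_zero (a : Alt n 2) : toExt (dpow a 0) = 1 := by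
  rw [toExt_dpow]
  simp

theorem toExt_dpow_one (a : Alt n 2) : toExt (dpow a 1) = toExt a := by
  rw [toExt_dpow]
  simp

theorem conG_dpow_zero (γ : Alt n 2) (p : Fin (2 * n)) : conG γ p (toExt (dpow γ 0)) = 0 := by
  rw [toExt_dpow_zero, conG, con_one]

theorem cov_commute_dpow (a : Alt n 2) (k : ℕ) (p : Fin (2 * n)) :
    cov p * toExt (dpow a k) = toExt (dpow a k) * cov p := by
  rw [cov_mul_toExt, pow_mul]
  simp

theorem jcov_commute_dpow (a : Alt n 2) (k : ℕ) (p : Fin (2 * n)) :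
    jcov p * toExt (dpow a k) = toExt (dpow a k) * jcov p := by
  simp only [jcov, neg_mul, mul_neg, Finset.sum_mul, Finset.mul_sum, smul_mul_assoc, mul_smul_comm,
    cov_commute_dpow]

theorem jcov_commute_toExt (a : Alt n 2) (p : Fin (2 * n)) :
    jcov p * toExt a = toExt a * jcov p := by
  have := jcov_commute_dpow a 1 p
  rwa [toExt_dpow_one] at this

/-- Contraction is a derivation on elements of even degree, and even elements commute with `jcov p`,
so a divided power is differentiated like `x^{k+1}/(k+1)!`. -/
theorem conG_dpow_succ {γ : Alt n 2} (h : IsPositive γ) (p : Fin (2 * n)) (k : ℕ) :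
    conG γ p (toExt (dpow γ (k + 1))) = toExt (dpow γ k) * jcov p := by
  have hk : ((k : ℂ) + 1) ≠ 0 := by exact_mod_cast k.succ_ne_zero
  apply smul_right_injective _ hk
  simp only
  rw [← map_smul, succ_smul_toExt_dpow, conG_toExt_mul, conG_toExt_self h]
  cases k with
  | zero => rw [conG_dpow_zero, zero_mul, zero_add, Nat.cast_zero, zero_add, one_smul]
  | succ k =>
    rw [conG_dpow_succ h p k, mul_assoc, jcov_commute_toExt, ← mul_assoc, ← succ_smul_toExt_dpow,
      smul_mul_assoc]
    push_cast
    module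

theorem sum_comm_four {ι M : Type*} [Fintype ι] [AddCommMonoid M] (F : ι → ι → ι → ι → M) :
    ∑ s, ∑ r, ∑ p, ∑ q, F s r p q = ∑ p, ∑ q, ∑ s, ∑ r, F s r p q :=
  calc ∑ s, ∑ r, ∑ p, ∑ q, F s r p q
      = ∑ s, ∑ p, ∑ r, ∑ q, F s r p q := Finset.sum_congr rfl fun _ _ => Finset.sum_comm
    _ = ∑ p, ∑ s, ∑ r, ∑ q, F s r p q := Finset.sum_comm
    _ = ∑ p, ∑ s, ∑ q, ∑ r, F s r p q :=
        Finset.sum_congr rfl fun _ _ => Finset.sum_congr rfl fun _ _ => Finset.sum_comm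
    _ = ∑ p, ∑ q, ∑ s, ∑ r, F s r p q := Finset.sum_congr rfl fun _ _ => Finset.sum_comm

/-- Type `(1,1)` means that `β` is unchanged when both arguments are composed with `J`; the minus
sign comes from the reversed order of the two factors. -/
theorem sum_apply_jcov_mul {β : Alt n 2} (hβ : IsType11 β) :
    (2 : ℂ)⁻¹ • ∑ p, ∑ q, β ![frame n p, frame n q] • (jcov q * jcov p) = -toExt β := by
  rw [toExt_two, ← smul_neg]
  congr 1
  have h1 : ∀ p q : Fin (2 * n), β ![frame n p, frame n q] • (jcov q * jcov p) =
      ∑ s, ∑ r, -((β ![frame n p, frame n q] * cplx p s * cplx q r) • (cov s * cov r)) := by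
    intro p q
    simp only [jcov, neg_mul_neg, Finset.sum_mul_sum, Finset.smul_sum, smul_mul_smul_comm, smul_smul]
    rw [Finset.sum_comm]
    refine Finset.sum_congr rfl fun s _ => Finset.sum_congr rfl fun r _ => ?_
    rw [cov_mul_cov r s, smul_neg]
    congr 2
    ring
  simp only [h1]
  have h2 : ∀ s r : Fin (2 * n), β ![frame n s, frame n r] =
      ∑ p, ∑ q, β ![frame n p, frame n q] * cplx p s * cplx q r := by
    intro s r
    rw [← hβ, apply_two_left]
    refine Finset.sum_congr rfl fun p _ => ?_
    rw [apply_two_right, Finset.mul_sum]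
    refine Finset.sum_congr rfl fun q _ => ?_
    rw [cplx, cplx]
    ring
  have h3 : ∑ s, ∑ r, β ![frame n s, frame n r] • (cov s * cov r) = ∑ s, ∑ r, ∑ p, ∑ q,
      (β ![frame n p, frame n q] * cplx p s * cplx q r) • (cov s * cov r) := by
    refine Finset.sum_congr rfl fun s _ => Finset.sum_congr rfl fun r _ => ?_
    rw [h2, Finset.sum_smul]
    exact Finset.sum_congr rfl fun p _ => Finset.sum_smul
  rw [h3]
  rw [sum_comm_four]
  simp only [Finset.sum_neg_distrib]

theorem trace_apply_zero (γ β : Alt n 2) :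
    trace (k := 0) γ β ![] =
      (2 : ℂ)⁻¹ * ∑ p, ∑ q, gramInv γ p q * β ![frame n p, Complex.I • frame n q] := by
  have h : trace (k := 0) γ β = ((1 : ℂ) / 2) • ∑ p : Fin (2 * n), ∑ q : Fin (2 * n),
    (gramInv γ p q) • contract (Nat.add_comm 2 0) ![frame n p, Complex.I • frame n q] β := rfl
  have hs : ∀ (ι : Type) (s : Finset ι) (f : ι → Alt n 0), (∑ i ∈ s, f i) ![] = ∑ i ∈ s, f i ![] := by
    intro ι s f
    classical
    induction s using Finset.induction_on with
    | empty => simp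
    | insert j s hj ih => rw [Finset.sum_insert hj, Finset.sum_insert hj, ← ih]; rfl
  rw [h, one_div, ContinuousAlternatingMap.smul_apply, hs, smul_eq_mul]
  congr 1
  refine Finset.sum_congr rfl fun p _ => ?_
  rw [hs]
  refine Finset.sum_congr rfl fun q _ => ?_
  rw [ContinuousAlternatingMap.smul_apply, smul_eq_mul, contract_apply]
  congr 2
  funext i
  fin_cases i <;> rfl

/-- The scalar left when the second contraction hits the covector produced by the first is the
metric pairing that defines the trace. -/
theorem sum_apply_conG_jcov (γ β : Alt n 2) :
    (2 : ℂ)⁻¹ • ∑ p, ∑ q, β ![frame n p, frame n q] • conG γ q (jcov p) =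
      (trace (k := 0) γ β ![]) • (1 : Ext n) := by
  rw [trace_apply_zero, mul_smul]
  congr 1
  simp only [conG_jcov, smul_smul, ← Finset.sum_smul]
  congr 1
  have h2 : ∀ r q : Fin (2 * n), β ![frame n q, Complex.I • frame n r] =
      -∑ p, cplx p r * β ![frame n p, frame n q] := by
    intro r q
    rw [apply_two_swap, apply_two_left]
    rfl
  have h3 : ∀ p q, gramInv γ p q * β ![frame n p, Complex.I • frame n q] =
      -∑ s, gramInv γ p q * (cplx s q * β ![frame n s, frame n p]) := by
    intro p q
    rw [h2, mul_neg, Finset.mul_sum]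
  simp only [h3, Finset.mul_sum, mul_neg, Finset.sum_neg_distrib]
  congr 1
  calc ∑ p, ∑ q, ∑ r, β ![frame n p, frame n q] * (cplx p r * gramInv γ q r)
      = ∑ q, ∑ p, ∑ r, β ![frame n p, frame n q] * (cplx p r * gramInv γ q r) := Finset.sum_comm
    _ = ∑ q, ∑ r, ∑ p, β ![frame n p, frame n q] * (cplx p r * gramInv γ q r) :=
        Finset.sum_congr rfl fun q _ => Finset.sum_comm
    _ = _ := Finset.sum_congr rfl fun q _ => Finset.sum_congr rfl fun r _ =>
        Finset.sum_congr rfl fun p _ => by ring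

theorem sharp_toExt_two (γ β : Alt n 2) (z : Ext n) :
    sharp γ (toExt β) z =
      (2 : ℂ)⁻¹ • ∑ p, ∑ q, β ![frame n p, frame n q] • conG γ q (conG γ p z) := by
  rw [toExt_two]
  simp only [map_smul, map_sum, LinearMap.smul_apply, LinearMap.sum_apply, sharp_mul, sharp_cov]

theorem sharp_dpow_one {γ : Alt n 2} (hγ : IsPositive γ) (β : Alt n 2) :
    sharp γ (toExt β) (toExt (dpow γ 1)) = (trace (k := 0) γ β ![]) • toExt (dpow γ 0) := by
  rw [sharp_toExt_two, toExt_dpow_zero, ← sum_apply_conG_jcov]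
  simp only [conG_dpow_succ hγ, toExt_dpow_zero, one_mul]

/-- `⋆β = -β ∧ γ_{n-2} + (Λ_γ β) γ_{n-1}` for `β` of type `(1,1)`, with `n` replaced by `k + 2`. -/
theorem sharp_dpow_add_two {γ β : Alt n 2} (hγ : IsPositive γ) (hβ : IsType11 β) (k : ℕ) :
    sharp γ (toExt β) (toExt (dpow γ (k + 2))) =
      -(toExt (dpow γ k) * toExt β) + (trace (k := 0) γ β ![]) • toExt (dpow γ (k + 1)) := by
  rw [sharp_toExt_two]
  -- The second contraction hits either `γ_{k+1}` or `jcov p`. Summed against `β`, the first case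
  -- produces `-β` and the second the trace.
  have h1 : ∀ p q, conG γ q (conG γ p (toExt (dpow γ (k + 2)))) =
      toExt (dpow γ k) * (jcov q * jcov p) + toExt (dpow γ (k + 1)) * conG γ q (jcov p) := by
    intro p q
    rw [conG_dpow_succ hγ, conG_toExt_mul, conG_dpow_succ hγ, mul_assoc]
  have h2 : ∀ (y : Ext n) (x : Fin (2 * n) → Fin (2 * n) → Ext n),
      ∑ p, ∑ q, β ![frame n p, frame n q] • (y * x p q) =
        y * ∑ p, ∑ q, β ![frame n p, frame n q] • x p q := by
    intro y x
    simp only [Finset.mul_sum, mul_smul_comm]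
  simp only [h1, smul_add, Finset.sum_add_distrib]
  rw [h2, h2, ← mul_smul_comm, ← mul_smul_comm, sum_apply_jcov_mul hβ, sum_apply_conG_jcov, mul_neg, mul_smul_comm, mul_one]

theorem trace_self {γ : Alt n 2} (h : IsPositive γ) : trace (k := 0) γ γ ![] = n := by
  rw [trace_apply_zero]
  have h1 : ∀ p, ∑ q, gramInv γ p q * γ ![frame n p, Complex.I • frame n q] = 1 := by
    intro p
    have h2 := h.sum_gramInv_mul p p
    rw [if_pos rfl] at h2
    rw [← h2]
    refine Finset.sum_congr rfl fun q _ => ?_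
    rw [gram_symm h.type11]
    rfl
  simp [h1]

theorem sharp_self_dpow {γ : Alt n 2} (h : IsPositive γ) (k : ℕ) :
    sharp γ (toExt γ) (toExt (dpow γ (k + 1))) = ((n : ℂ) - k) • toExt (dpow γ k) := by
  cases k with
  | zero => rw [sharp_dpow_one h, trace_self h]; simp
  | succ k =>
    rw [sharp_dpow_add_two h h.type11, trace_self h, ← succ_smul_toExt_dpow, ← neg_smul, ← add_smul]
    congr 1
    push_cast
    ring

/-- `⋆ γ_k = γ_{n-k}`. -/
theorem sharp_dpow_dpow {γ : Alt n 2} (h : IsPositive γ) {k l : ℕ} (hkl : k + l = n) :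
    sharp γ (toExt (dpow γ k)) (toExt (dpow γ n)) = toExt (dpow γ l) := by
  induction k generalizing l with
  | zero =>
    obtain rfl : l = n := by omega
    rw [toExt_dpow_zero, sharp_one]
  | succ k ih =>
    have hk : ((k : ℂ) + 1) ≠ 0 := by exact_mod_cast k.succ_ne_zero
    apply smul_right_injective _ hk
    simp only
    -- Contracting `γ_{l+1}` with `γ` produces the factor `n - l`, which equals `k + 1` and cancels
    -- the one in `(k+1) γ_{k+1} = γ_k ∧ γ`.
    rw [← LinearMap.smul_apply, ← map_smul, succ_smul_toExt_dpow, sharp_mul, ih (l := l + 1) (by omega),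
      sharp_self_dpow h]
    congr 1
    rw [← hkl]
    push_cast
    ring

/-- The volume form contracted with itself is `1`, so it cannot vanish; no computation in
coordinates is needed. -/
theorem toExt_dpow_top_ne_zero {γ : Alt n 2} (h : IsPositive γ) : toExt (dpow γ n) ≠ 0 := by
  intro h0
  have h1 := sharp_dpow_dpow h (k := n) (l := 0) (by omega)
  rw [h0, map_zero, toExt_dpow_zero] at h1
  exact zero_ne_one h1

/-! ### Symmetry and bijectivity of the Hodge star -/

/-- Both sides are the bilinear pairing induced by the metric times the volume form, and the inverse
Gram matrix is symmetric. -/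
theorem toExt_mul_hodgeStar_comm {γ : Alt n 2} (h : IsType11 γ) {k l : ℕ} (hkl : k + l = 2 * n)
    (a b : Alt n k) : toExt a * toExt (hodgeStar hkl γ b) = toExt b * toExt (hodgeStar hkl γ a) := by
  have key : ∀ a b : Alt n k, toExt a * toExt (hodgeStar hkl γ b) =
      ((1 : ℂ) / (k.factorial : ℂ)) • ∑ p : Fin k → Fin (2 * n), ∑ q : Fin k → Fin (2 * n),
        ((∏ i, gramInv γ (p i) (q i)) * b (fun i => frame n (p i)) * a (fun i => frame n (q i))) •
          toExt (dpow γ n) := by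
    intro a b
    rw [hodgeStar_eq, map_smul, mul_smul_comm, map_sum, Finset.mul_sum]
    refine congrArg _ (Finset.sum_congr rfl fun p _ => ?_)
    rw [map_sum, Finset.mul_sum]
    refine Finset.sum_congr rfl fun q _ => ?_
    rw [map_smul, mul_smul_comm, toExt_mul_contract, smul_smul]
  rw [key, key, Finset.sum_comm]
  refine congrArg _ (Finset.sum_congr rfl fun p _ => Finset.sum_congr rfl fun q _ => ?_)
  have h1 : ∏ i, gramInv γ (q i) (p i) = ∏ i, gramInv γ (p i) (q i) :=
    Finset.prod_congr rfl fun i _ => gramInv_symm h _ _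
  rw [h1, mul_right_comm]

/-- Lowering the indices of the vectors `f_{s_1}, …, f_{s_k}` gives a form whose star is this
contraction. Such forms test every component of another form through the symmetric pairing. -/
theorem exists_toExt_hodgeStar_eq_contract {γ : Alt n 2} (h : IsPositive γ) {k l : ℕ}
    (hkl : k + l = 2 * n) (s : Fin k → Fin (2 * n)) : ∃ a : Alt n k,
      toExt (hodgeStar hkl γ a) = toExt (contract hkl (fun i => frame n (s i)) (dpow γ n)) := by
  induction k generalizing l with
  | zero =>
    refine ⟨dpow γ 0, ?_⟩
    rw [toExt_hodgeStar, toExt_dpow_zero, sharp_one, contract_zero]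
  | succ k ih =>
    obtain ⟨a, ha⟩ := ih (l := l + 1) (by omega) (fun i => s i.castSucc)
    -- The covector `-γ(i f, ·)` is `g(f, ·)`, the metric dual of the last frame vector `f`; raising
    -- its index returns `f`.
    refine ⟨wedge a (-γ.curryLeft (Complex.I • frame n (s (Fin.last k)))), ?_⟩
    rw [toExt_hodgeStar] at ha
    rw [toExt_hodgeStar, toExt_wedge, sharp_mul, ha, map_neg, toExt_curryLeft_two]
    have h1 : (fun i => frame n (s i)) =
        (Fin.snoc (fun i : Fin k => frame n (s i.castSucc)) (frame n (s (Fin.last k))) :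
          Fin (k + 1) → Cn n) := (Fin.snoc_init_self (fun i => frame n (s i))).symm
    rw [h1, toExt_contract_snoc]
    set z := toExt (contract (l := l + 1) (by omega) (fun i : Fin k => frame n (s i.castSucc))
      (dpow γ n))
    set t := s (Fin.last k)
    simp only [map_neg, map_sum, map_smul, LinearMap.neg_apply, LinearMap.sum_apply,
      LinearMap.smul_apply, sharp_cov, conG_eq_sum γ _ z, Finset.smul_sum, smul_smul]
    rw [Finset.sum_comm, ← Finset.sum_neg_distrib, Finset.sum_eq_single t]
    · rw [← Finset.sum_smul, ← neg_smul]
      have h2 : -∑ r, γ ![Complex.I • frame n t, frame n r] * gramInv γ r t = 1 := by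
        rw [← Finset.sum_neg_distrib]
        have h3 := h.sum_gramInv_mul t t
        rw [if_pos rfl] at h3
        rw [← h3]
        refine Finset.sum_congr rfl fun r _ => ?_
        rw [apply_two_swap, gramInv_symm h.type11 r t, neg_mul, neg_neg, mul_comm]
        rfl
      rw [h2, one_smul]
    · intro j _ hj
      rw [← Finset.sum_smul, ← neg_smul]
      have h2 : -∑ r, γ ![Complex.I • frame n t, frame n r] * gramInv γ r j = 0 := by
        rw [← Finset.sum_neg_distrib]
        have h3 := h.sum_gramInv_mul j t
        rw [if_neg hj] at h3
        rw [← h3]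
        refine Finset.sum_congr rfl fun r _ => ?_
        rw [apply_two_swap, gramInv_symm h.type11 r j, neg_mul, neg_neg, mul_comm]
        rfl
      rw [h2, zero_smul]
    · simp

theorem hodgeStar_add (γ : Alt n 2) {k l : ℕ} (h : k + l = 2 * n) (a b : Alt n k) :
    hodgeStar h γ (a + b) = hodgeStar h γ a + hodgeStar h γ b :=
  toExt_injective (by simp only [map_add, toExt_hodgeStar, LinearMap.add_apply])

theorem hodgeStar_smul (γ : Alt n 2) {k l : ℕ} (h : k + l = 2 * n) (c : ℂ) (a : Alt n k) :
    hodgeStar h γ (c • a) = c • hodgeStar h γ a :=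
  toExt_injective (by simp only [map_smul, toExt_hodgeStar, LinearMap.smul_apply])

/-- The Hodge star as a linear map. -/
def hodgeStarLin (γ : Alt n 2) {k l : ℕ} (h : k + l = 2 * n) : Alt n k →ₗ[ℂ] Alt n l where
  toFun := hodgeStar h γ
  map_add' := hodgeStar_add γ h
  map_smul' := hodgeStar_smul γ h

/-- If `⋆b = 0`, choose `a` with `⋆a` the contraction of the volume form by a frame tuple. Then
`b(f_s) γ_n = b ∧ ⋆a = a ∧ ⋆b = 0`, and `γ_n ≠ 0`. -/
theorem hodgeStar_injective {γ : Alt n 2} (h : IsPositive γ) {k l : ℕ} (hkl : k + l = 2 * n) :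
    Function.Injective (hodgeStar hkl γ) := by
  change Function.Injective (hodgeStarLin γ hkl)
  rw [← LinearMap.ker_eq_bot, LinearMap.ker_eq_bot']
  intro b hb
  apply ext_frame
  intro s
  obtain ⟨a, ha⟩ := exists_toExt_hodgeStar_eq_contract h hkl s
  have h1 := toExt_mul_hodgeStar_comm h.type11 hkl a b
  have h2 : hodgeStar hkl γ b = 0 := hb
  rw [h2, map_zero, mul_zero, ha, toExt_mul_contract] at h1
  exact (smul_eq_zero.mp h1.symm).resolve_right (toExt_dpow_top_ne_zero h)

/-- The values of a form on tuples of vectors of the standard frame. -/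
def components (n k : ℕ) : Alt n k →ₗ[ℂ] ((Fin k → Fin (2 * n)) → ℂ) where
  toFun a p := a fun i => frame n (p i)
  map_add' _ _ := rfl
  map_smul' _ _ := rfl

theorem components_injective (n k : ℕ) : Function.Injective (components n k) :=
  fun _ _ h => ext_frame fun p => congrFun h p

instance finiteDimensional (n k : ℕ) : FiniteDimensional ℂ (Alt n k) :=
  FiniteDimensional.of_injective (components n k) (components_injective n k)

/-- The star injects degree `k` into degree `l` and degree `l` into degree `k`, so the dimensions
agree. The value of `⋆⋆` is never needed. -/
theorem hodgeStar_surjective {γ : Alt n 2} (h : IsPositive γ) {k l : ℕ} (hkl : k + l = 2 * n) :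
    Function.Surjective (hodgeStar hkl γ) := by
  have h1 := LinearMap.finrank_le_finrank_of_injective (f := hodgeStarLin γ hkl)
    (hodgeStar_injective h hkl)
  have h2 := LinearMap.finrank_le_finrank_of_injective
    (f := hodgeStarLin γ (k := l) (l := k) (by omega)) (hodgeStar_injective h (by omega))
  exact (LinearMap.injective_iff_surjective_of_finrank_eq_finrank (le_antisymm h1 h2)
    (f := hodgeStarLin γ hkl)).mp (hodgeStar_injective h hkl)

end Alt
end

/-! ### Naturality of the algebraic operations under linear maps. -/

noncomputable section

namespace Alt

variable {n : ℕ}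

/-! ### Pullback by linear maps -/

/-- Pullback of a form by a real-linear map. -/
def pull (L : Cn n →L[ℝ] Cn n) {k : ℕ} (a : Alt n k) : Alt n k := a.compContinuousLinearMap L

@[simp] theorem pull_apply (L : Cn n →L[ℝ] Cn n) {k : ℕ} (a : Alt n k) (v : Fin k → Cn n) :
    pull L a v = a (fun i => L (v i)) := rfl

theorem pull_add (L : Cn n →L[ℝ] Cn n) {k : ℕ} (a b : Alt n k) :
    pull L (a + b) = pull L a + pull L b := rfl

theorem pull_smul (L : Cn n →L[ℝ] Cn n) {k : ℕ} (c : ℂ) (a : Alt n k) :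
    pull L (c • a) = c • pull L a := rfl

theorem pull_pull (L M : Cn n →L[ℝ] Cn n) {k : ℕ} (a : Alt n k) :
    pull L (pull M a) = pull (M.comp L) a := rfl

/-- The transpose of a real-linear map, on complex covectors. -/
def covMap (L : Cn n →L[ℝ] Cn n) : (Fin (2 * n) → ℂ) →ₗ[ℂ] (Fin (2 * n) → ℂ) where
  toFun x r := ∑ p, x p * coords (L (frame n r)) p
  map_add' x y := by
    funext r
    simp [add_mul, Finset.sum_add_distrib]
  map_smul' c x := by
    funext r
    simp [Finset.mul_sum, mul_assoc]

/-- The pullback by a real-linear map on the exterior algebra. -/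
def extMap (L : Cn n →L[ℝ] Cn n) : Ext n →ₐ[ℂ] Ext n := ExteriorAlgebra.map (covMap L)

theorem extMap_cov (L : Cn n →L[ℝ] Cn n) (p : Fin (2 * n)) :
    extMap L (cov p) = ∑ r, coords (L (frame n r)) p • cov r := by
  rw [extMap, cov, ExteriorAlgebra.map_apply_ι]
  have h : covMap L (Pi.single p 1) =
      ∑ r, coords (L (frame n r)) p • (Pi.single r 1 : Fin (2 * n) → ℂ) := by
    funext s
    simp [covMap, Finset.sum_apply, Pi.single_apply]
  rw [h, map_sum]
  simp only [map_smul]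
  rfl

/-- By induction on the degree via Euler's identity: contracting the pullback with `v` is pulling
back the contraction with `L v`. -/
theorem toExt_pull (L : Cn n →L[ℝ] Cn n) {k : ℕ} (a : Alt n k) :
    toExt (pull L a) = extMap L (toExt a) := by
  induction k with
  | zero =>
    rw [toExt_zero_degree, toExt_zero_degree, map_smul, map_one]
    exact congrArg (fun v => a v • (1 : Ext n)) (Subsingleton.elim _ _)
  | succ k ih =>
    have hk : ((k : ℂ) + 1) ≠ 0 := by exact_mod_cast k.succ_ne_zero
    apply smul_right_injective _ hk
    simp only
    rw [← map_smul (extMap L), ← sum_cov_mul_curryLeft, ← sum_cov_mul_curryLeft, map_sum]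
    have h1 : ∀ j, (pull L a).curryLeft (frame n j) = pull L (a.curryLeft (L (frame n j))) := by
      intro j
      ext w
      change a _ = a _
      congr 1
      funext i
      refine Fin.cases ?_ (fun i => ?_) i <;> rfl
    have h2 : ∀ j, cov j * toExt ((pull L a).curryLeft (frame n j)) =
        ∑ q, coords (L (frame n j)) q • (cov j * extMap L (toExt (a.curryLeft (frame n q)))) := by
      intro j
      rw [h1, ih, map_eq_sum_coords a.curryLeft, map_sum, map_sum, Finset.mul_sum]
      simp only [map_smul, mul_smul_comm]
    rw [Finset.sum_congr rfl fun j _ => h2 j, Finset.sum_comm]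
    refine Finset.sum_congr rfl fun q _ => ?_
    rw [map_mul, extMap_cov, Finset.sum_mul]
    simp only [smul_mul_assoc]

theorem pull_wedge (L : Cn n →L[ℝ] Cn n) {k l : ℕ} (a : Alt n k) (b : Alt n l) :
    pull L (wedge a b) = wedge (pull L a) (pull L b) :=
  toExt_injective (by rw [toExt_pull, toExt_wedge, toExt_wedge, map_mul, toExt_pull, toExt_pull])

theorem pull_wedgePow (L : Cn n →L[ℝ] Cn n) (a : Alt n 2) (p : ℕ) :
    pull L (wedgePow a p) = wedgePow (pull L a) p :=
  toExt_injective (by rw [toExt_pull, toExt_wedgePow, toExt_wedgePow, map_pow, toExt_pull])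

theorem pull_dpow (L : Cn n →L[ℝ] Cn n) (a : Alt n 2) (p : ℕ) :
    pull L (dpow a p) = dpow (pull L a) p :=
  toExt_injective (by rw [toExt_pull, toExt_dpow, toExt_dpow, map_smul, map_pow, toExt_pull])

theorem con_extMap (L : Cn n →L[ℝ] Cn n) (d : Fin (2 * n) → ℂ) (x : Ext n) :
    con d (extMap L x) = extMap L (con (fun p => ∑ r, d r * coords (L (frame n r)) p) x) := by
  set d' : Fin (2 * n) → ℂ := fun p => ∑ r, d r * coords (L (frame n r)) p with hd'
  induction x using CliffordAlgebra.left_induction with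
  | algebraMap r =>
    have h1 : (algebraMap ℂ (Ext n) r) = r • (1 : Ext n) := Algebra.algebraMap_eq_smul_one r
    change con d (extMap L (algebraMap ℂ (Ext n) r)) = extMap L (con d' (algebraMap ℂ (Ext n) r))
    rw [h1]
    simp only [map_smul, map_one, con_one, smul_zero, map_zero]
  | add x y hx hy => rw [map_add, map_add, hx, hy, map_add, map_add]
  | ι_mul x m hx =>
    have h1 : ∀ (e m : Fin (2 * n) → ℂ) (x : Ext n), con e (ExteriorAlgebra.ι ℂ m * x) =
        (∑ j, e j * m j) • x - ExteriorAlgebra.ι ℂ m * con e x := fun e m x =>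
      CliffordAlgebra.contractLeft_ι_mul (Q := (0 : QuadraticForm ℂ (Fin (2 * n) → ℂ)))
        (dotProductBilin ℂ ℂ e) m x
    change con d (extMap L (ExteriorAlgebra.ι ℂ m * x)) = extMap L (con d' (ExteriorAlgebra.ι ℂ m * x))
    have h2 : extMap L (ExteriorAlgebra.ι ℂ m) = ExteriorAlgebra.ι ℂ (covMap L m) :=
      ExteriorAlgebra.map_apply_ι _ _
    rw [map_mul, h2, h1, hx, h1, map_sub, map_mul, h2, map_smul]
    congr 2
    simp only [hd', covMap, LinearMap.coe_mk, AddHom.coe_mk, Finset.mul_sum, Finset.sum_mul]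
    rw [Finset.sum_comm]
    exact Finset.sum_congr rfl fun p _ => Finset.sum_congr rfl fun r _ => by ring

/-- The matrix of a real-linear map in the standard frame. -/
def frameMatrix (L : Cn n →L[ℝ] Cn n) : Matrix (Fin (2 * n)) (Fin (2 * n)) ℂ :=
  Matrix.of fun p r => coords (L (frame n r)) p

theorem frameMatrix_comp (L M : Cn n →L[ℝ] Cn n) :
    frameMatrix (L.comp M) = frameMatrix L * frameMatrix M := by
  ext p r
  rw [Matrix.mul_apply]
  change coords (L (M (frame n r))) p = ∑ s, coords (L (frame n s)) p * coords (M (frame n r)) s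
  rw [coords_linear]
  exact Finset.sum_congr rfl fun s _ => mul_comm _ _

theorem frameMatrix_id : frameMatrix (ContinuousLinearMap.id ℝ (Cn n)) = 1 := by
  ext p r
  change coords (frame n r) p = _
  rw [coords_frame, Pi.single_apply, Matrix.one_apply]

/-- A complex-linear automorphism as a real-linear map. -/
abbrev toReal (L : Cn n ≃L[ℂ] Cn n) : Cn n →L[ℝ] Cn n :=
  (L : Cn n →L[ℂ] Cn n).restrictScalars ℝ

theorem frameMatrix_mul_symm (L : Cn n ≃L[ℂ] Cn n) :
    frameMatrix (toReal L) * frameMatrix (toReal L.symm) = 1 := by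
  rw [← frameMatrix_comp, ← frameMatrix_id]
  congr 1
  ext v
  simp

/-- Complex linearity of `L` is essential: the Gram matrix involves `J`, and `L` has to commute with
it for the usual congruence to hold. -/
theorem gram_pull (L : Cn n ≃L[ℂ] Cn n) (γ : Alt n 2) :
    gram (pull (toReal L) γ) =
      (frameMatrix (toReal L)).transpose * gram γ * frameMatrix (toReal L) := by
  ext p q
  have h1 : gram (pull (toReal L) γ) p q =
      γ ![L (frame n p), Complex.I • L (frame n q)] := by
    change γ _ = γ _
    congr 1
    funext i
    fin_cases i
    · rfl
    · exact map_smul L _ _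
  have h2 : ∀ u v : Cn n, γ ![u, Complex.I • v] = ∑ s, coords v s * γ ![u, Complex.I • frame n s] := by
    intro u v
    rw [apply_two_right]
    simp only [coords_I_smul, Finset.sum_mul]
    rw [Finset.sum_comm]
    refine Finset.sum_congr rfl fun s _ => ?_
    rw [apply_two_right _ _ (Complex.I • frame n s), Finset.mul_sum]
    exact Finset.sum_congr rfl fun r _ => by rw [cplx]; ring
  rw [h1, h2, Matrix.mul_apply]
  refine Finset.sum_congr rfl fun s _ => ?_
  rw [apply_two_left, Matrix.mul_apply, mul_comm]
  rfl

theorem gramInv_pull (L : Cn n ≃L[ℂ] Cn n) (γ : Alt n 2) (p q : Fin (2 * n)) :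
    ∑ r, ∑ s, coords (L (frame n r)) p * gramInv (pull (toReal L) γ) r s * coords (L (frame n s)) q =
      gramInv γ p q := by
  set A := frameMatrix (toReal L) with hA
  have hA1 : A * frameMatrix (toReal L.symm) = 1 := frameMatrix_mul_symm L
  have hA2 : A * A⁻¹ = 1 := Matrix.mul_nonsing_inv A (Matrix.isUnit_det_of_right_inverse hA1)
  have h1 : A * (gram (pull (toReal L) γ))⁻¹ * A.transpose = (gram γ)⁻¹ := by
    rw [gram_pull, Matrix.mul_inv_rev, Matrix.mul_inv_rev, ← Matrix.mul_assoc, ← Matrix.mul_assoc, hA2,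
      Matrix.one_mul, Matrix.mul_assoc, ← Matrix.transpose_nonsing_inv, ← Matrix.transpose_mul, hA2,
      Matrix.transpose_one, Matrix.mul_one]
  change _ = (gram γ)⁻¹ p q
  rw [← h1, Matrix.mul_apply, Finset.sum_comm]
  refine Finset.sum_congr rfl fun s _ => ?_
  rw [Matrix.mul_apply, Finset.sum_mul]
  rfl

/-- Raising an index commutes with pullback because the inverse Gram matrix transforms
contragrediently to the Gram matrix (`gramInv_pull`). -/
theorem sharp_extMap_mono (L : Cn n ≃L[ℂ] Cn n) (γ : Alt n 2) {k : ℕ} (p : Fin k → Fin (2 * n))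
    (z : Ext n) : sharp (pull (toReal L) γ) (extMap (toReal L) (mono p)) (extMap (toReal L) z) =
      extMap (toReal L) (sharp γ (mono p) z) := by
  induction k with
  | zero => rw [mono_zero, map_one, sharp_one, sharp_one]
  | succ k ih =>
    rw [← Fin.snoc_init_self p, mono_snoc, map_mul, sharp_mul, ih, sharp_mul, sharp_cov, extMap_cov,
      map_sum, LinearMap.sum_apply]
    simp only [map_smul, LinearMap.smul_apply, sharp_cov]
    simp only [conG]
    have h1 : gramInv γ (p (Fin.last k)) = fun s => ∑ q,
        (∑ r, coords (L (frame n r)) (p (Fin.last k)) * gramInv (pull (toReal L) γ) r q) *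
          coords (L (frame n q)) s := by
      funext s
      rw [← gramInv_pull L, Finset.sum_comm]
      simp only [Finset.sum_mul]
    rw [h1]
    refine Eq.trans ?_ (con_extMap (toReal L) _ _)
    have h2 : (fun q => ∑ r, coords (L (frame n r)) (p (Fin.last k)) *
        gramInv (pull (toReal L) γ) r q) = ∑ r, coords (L (frame n r)) (p (Fin.last k)) •
          gramInv (pull (toReal L) γ) r := by
      funext q
      simp [Finset.sum_apply]
    rw [h2, map_sum, LinearMap.sum_apply]
    simp only [map_smul, LinearMap.smul_apply]
    rfl

theorem pull_hodgeStar (L : Cn n ≃L[ℂ] Cn n) (γ : Alt n 2) {k l : ℕ} (h : k + l = 2 * n)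
    (a : Alt n k) : pull (toReal L) (hodgeStar h γ a) =
      hodgeStar h (pull (toReal L) γ) (pull (toReal L) a) := by
  apply toExt_injective
  rw [toExt_pull, toExt_hodgeStar, toExt_hodgeStar, toExt_pull, ← pull_dpow, toExt_pull, toExt_apply]
  simp only [map_smul, map_sum, LinearMap.smul_apply, LinearMap.sum_apply, sharp_extMap_mono]

theorem toExt_trace (γ : Alt n 2) {k : ℕ} (a : Alt n (k + 2)) :
    toExt (trace γ a) = (2 : ℂ)⁻¹ • ∑ p, ∑ q, gramInv γ p q •
      con (coords (Complex.I • frame n q)) (con (coords (frame n p)) (toExt a)) := by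
  have h : trace γ a = ((1 : ℂ) / 2) • ∑ p : Fin (2 * n), ∑ q : Fin (2 * n),
    (gramInv γ p q) • contract (Nat.add_comm 2 k) ![frame n p, Complex.I • frame n q] a := rfl
  rw [h, map_smul, one_div, map_sum]
  refine congrArg _ (Finset.sum_congr rfl fun p _ => ?_)
  rw [map_sum]
  refine Finset.sum_congr rfl fun q _ => ?_
  rw [map_smul, con_toExt, con_toExt]
  congr 2
  ext w
  change a _ = a _
  congr 1
  funext i
  refine Fin.cases ?_ (fun i => Fin.cases ?_ (fun i => ?_) i) i
  · rfl
  · rfl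
  · have h1 : Fin.cast (Nat.add_comm 2 k).symm i.succ.succ = Fin.natAdd 2 i := by
      ext
      simp
      omega
    change Fin.append _ w (Fin.cast (Nat.add_comm 2 k).symm i.succ.succ) = _
    rw [h1, Fin.append_right]
    rfl

theorem con_sum_left {ι : Type*} (s : Finset ι) (c : ι → ℂ) (d : ι → Fin (2 * n) → ℂ) (x : Ext n) :
    con (fun p => ∑ i ∈ s, c i * d i p) x = ∑ i ∈ s, c i • con (d i) x := by
  have h : (fun p => ∑ i ∈ s, c i * d i p) = ∑ i ∈ s, c i • d i := by
    funext p
    simp [Finset.sum_apply]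
  rw [h, map_sum, LinearMap.sum_apply]
  simp only [map_smul, LinearMap.smul_apply]

theorem con_coords_linear (L : Cn n →L[ℝ] Cn n) (v : Cn n) (x : Ext n) :
    con (coords v) (extMap L x) = extMap L (con (coords (L v)) x) := by
  rw [con_extMap]
  exact congrArg (fun d => extMap L (con d x)) (funext fun p => (coords_linear L v p).symm)

theorem con_coords_eq_sum (L : Cn n →L[ℝ] Cn n) (v : Cn n) (x : Ext n) :
    con (coords (L v)) x = ∑ r, coords v r • con (coords (L (frame n r))) x := by
  rw [← con_sum_left]
  congr 2
  funext p
  exact coords_linear L v p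

theorem pull_trace (L : Cn n ≃L[ℂ] Cn n) (γ : Alt n 2) {k : ℕ} (a : Alt n (k + 2)) :
    pull (toReal L) (trace γ a) = trace (pull (toReal L) γ) (pull (toReal L) a) := by
  apply toExt_injective
  rw [toExt_pull, toExt_trace, toExt_trace, toExt_pull]
  simp only [con_coords_linear]
  simp only [map_smul, map_sum]
  congr 1
  have h1 : ∀ r s : Fin (2 * n), extMap (toReal L) (con (coords (toReal L (Complex.I • frame n s)))
      (con (coords (toReal L (frame n r))) (toExt a))) =
      ∑ q, ∑ p, (coords (L (frame n s)) q * coords (L (frame n r)) p) • extMap (toReal L)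
        (con (coords (Complex.I • frame n q)) (con (coords (frame n p)) (toExt a))) := by
    intro r s
    have h2 : toReal L (Complex.I • frame n s) = mulI n (L (frame n s)) := map_smul L _ _
    rw [h2, con_coords_eq_sum, map_sum]
    refine Finset.sum_congr rfl fun q _ => ?_
    have h3 : con (coords (toReal L (frame n r))) (toExt a) = ∑ p, coords (L (frame n r)) p •
        con (coords (frame n p)) (toExt a) := con_eq_sum _ _
    rw [h3, map_sum, Finset.smul_sum, map_sum]
    refine Finset.sum_congr rfl fun p _ => ?_
    simp only [map_smul, smul_smul, mulI_apply]
  simp only [h1, Finset.smul_sum, smul_smul]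
  rw [sum_comm_four (fun r s q p => (gramInv (pull (toReal L) γ) r s *
    (coords (L (frame n s)) q * coords (L (frame n r)) p)) • extMap (toReal L)
        (con (coords (Complex.I • frame n q)) (con (coords (frame n p)) (toExt a)))), Finset.sum_comm]
  refine Finset.sum_congr rfl fun q _ => Finset.sum_congr rfl fun p _ => ?_
  simp only [← Finset.sum_smul]
  congr 1
  rw [← gramInv_pull L]
  exact Finset.sum_congr rfl fun r _ => Finset.sum_congr rfl fun s _ => by ring

end Alt
end

/-! ### Invariance under `J` and division by `γ_{n-2}`. -/

noncomputable section

namespace Alt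

variable {n : ℕ}

/-! ### Forms invariant under the complex structure -/

/-- Multiplication by `i` as a complex-linear automorphism. -/
def equivI (n : ℕ) : Cn n ≃L[ℂ] Cn n :=
  ContinuousLinearEquiv.equivOfInverse (Complex.I • ContinuousLinearMap.id ℂ (Cn n))
    ((-Complex.I) • ContinuousLinearMap.id ℂ (Cn n)) (fun v => by simp [smul_smul])
    (fun v => by simp [smul_smul])

theorem toReal_equivI : toReal (equivI n) = mulI n := rfl

/-- Invariance under multiplication by `i`; for `2`-forms and `(2n-2)`-forms this is being of type
`(1,1)`, respectively `(n-1,n-1)`. -/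
def JInv {k : ℕ} (a : Alt n k) : Prop := pull (mulI n) a = a

theorem jInv_two_iff (a : Alt n 2) : JInv a ↔ IsType11 a := by
  constructor
  · intro h u v
    conv_rhs => rw [← h]
    rw [pull_apply]
    congr 1
    funext i
    fin_cases i <;> rfl
  · intro h
    ext v
    have h1 : v = ![v 0, v 1] := by
      funext i
      fin_cases i <;> rfl
    have h2 : (fun i => mulI n (v i)) = ![Complex.I • v 0, Complex.I • v 1] := by
      funext i
      fin_cases i <;> rfl
    rw [pull_apply, h2, h, ← h1]

theorem JInv.wedge {k l : ℕ} {a : Alt n k} {b : Alt n l} (ha : JInv a) (hb : JInv b) :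
    JInv (Alt.wedge a b) := by
  rw [JInv, pull_wedge, ha, hb]

theorem JInv.dpow {a : Alt n 2} (ha : IsType11 a) (k : ℕ) : JInv (Alt.dpow a k) := by
  rw [JInv, pull_dpow, (jInv_two_iff a).mpr ha]

theorem JInv.wedgePow {a : Alt n 2} (ha : IsType11 a) (k : ℕ) : JInv (Alt.wedgePow a k) := by
  rw [JInv, pull_wedgePow, (jInv_two_iff a).mpr ha]

theorem pull_mulI_hodgeStar {γ : Alt n 2} (hγ : IsType11 γ) {k l : ℕ} (h : k + l = 2 * n)
    (a : Alt n k) : pull (mulI n) (hodgeStar h γ a) = hodgeStar h γ (pull (mulI n) a) := by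
  have h1 := pull_hodgeStar (equivI n) γ h a
  rwa [toReal_equivI, (jInv_two_iff γ).mpr hγ] at h1

theorem JInv.hodgeStar {γ : Alt n 2} (hγ : IsType11 γ) {k l : ℕ} (h : k + l = 2 * n)
    {a : Alt n k} (ha : JInv a) : JInv (hodgeStar h γ a) := by
  rw [JInv, pull_mulI_hodgeStar hγ, ha]

theorem IsType11.add {a b : Alt n 2} (ha : IsType11 a) (hb : IsType11 b) : IsType11 (a + b) := by
  intro u v
  rw [ContinuousAlternatingMap.add_apply, ContinuousAlternatingMap.add_apply, ha, hb]

theorem IsType11.smul {a : Alt n 2} (c : ℂ) (ha : IsType11 a) : IsType11 (c • a) := by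
  intro u v
  rw [ContinuousAlternatingMap.smul_apply, ContinuousAlternatingMap.smul_apply, ha]

theorem IsType11.neg {a : Alt n 2} (ha : IsType11 a) : IsType11 (-a) := by
  intro u v
  rw [ContinuousAlternatingMap.neg_apply, ContinuousAlternatingMap.neg_apply, ha]

/-! ### Division by `γ_{n-2}` -/

theorem toExt_hodgeStar_two {γ β : Alt n 2} (hγ : IsPositive γ) (hβ : IsType11 β) (hn : 2 ≤ n)
    {l : ℕ} (hl : 2 + l = 2 * n) : toExt (hodgeStar hl γ β) =
      -(toExt (dpow γ (n - 2)) * toExt β) + (trace (k := 0) γ β ![]) • toExt (dpow γ (n - 1)) := by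
  obtain ⟨m, hm⟩ : ∃ m, n = m + 2 := ⟨n - 2, by omega⟩
  have h := sharp_dpow_add_two hγ hβ m
  have h1 : m = n - 2 := by omega
  have h2 : m + 1 = n - 1 := by omega
  rw [← hm, h2, h1] at h
  rw [toExt_hodgeStar, h]

theorem dpow_mul_self {γ : Alt n 2} (hn : 2 ≤ n) :
    toExt (dpow γ (n - 2)) * toExt γ = ((n : ℂ) - 1) • toExt (dpow γ (n - 1)) := by
  obtain ⟨m, hm⟩ : ∃ m, n = m + 2 := ⟨n - 2, by omega⟩
  have h1 : n - 2 = m := by omega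
  have h2 : n - 1 = m + 1 := by omega
  rw [h1, h2, ← succ_smul_toExt_dpow]
  congr 1
  have : (n : ℂ) = m + 2 := by exact_mod_cast hm
  rw [this]
  ring

/-- The formula `⋆η = -γ_{n-2} ∧ η + (Λη) γ_{n-1}` is already divisible in its first term, and
`γ_{n-2} ∧ γ = (n-1) γ_{n-1}` shows which multiple of `γ` accounts for the second. -/
theorem dpow_mul_correction {γ η : Alt n 2} (hγ : IsPositive γ) (hη : IsType11 η) (hn : 2 ≤ n)
    {l : ℕ} (hl : 2 + l = 2 * n) : toExt (dpow γ (n - 2)) *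
      toExt (-η + ((trace (k := 0) γ η ![]) / ((n : ℂ) - 1)) • γ) = toExt (hodgeStar hl γ η) := by
  have hn1 : (n : ℂ) - 1 ≠ 0 := by
    rw [sub_ne_zero]
    exact_mod_cast (by omega : n ≠ 1)
  rw [toExt_hodgeStar_two hγ hη hn, map_add, map_neg, map_smul, mul_add, mul_neg, mul_smul_comm,
    dpow_mul_self hn, smul_smul, div_mul_cancel₀ _ hn1]

theorem trace_zero_smul (γ β : Alt n 2) (c : ℂ) :
    trace (k := 0) γ (c • β) ![] = c * trace (k := 0) γ β ![] := by
  rw [trace_apply_zero, trace_apply_zero]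
  simp only [ContinuousAlternatingMap.smul_apply, smul_eq_mul, Finset.mul_sum]
  exact Finset.sum_congr rfl fun p _ => Finset.sum_congr rfl fun q _ => by ring

/-- Only the trace term of `⋆β` survives, so `⋆β = t γ_{n-1} = t ⋆γ` with `t = Λβ`, hence `β = tγ`.
Taking traces gives `t = tn`, and `n ≠ 1` forces `t = 0`. -/
theorem eq_zero_of_dpow_mul_eq_zero {γ β : Alt n 2} (hγ : IsPositive γ) (hβ : IsType11 β)
    (hn : 2 ≤ n) (h : toExt (dpow γ (n - 2)) * toExt β = 0) : β = 0 := by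
  have hn1 : (n : ℂ) - 1 ≠ 0 := by
    rw [sub_ne_zero]
    exact_mod_cast (by omega : n ≠ 1)
  have hl : 2 + (2 * n - 2) = 2 * n := by omega
  set t := trace (k := 0) γ β ![] with ht
  have h1 := toExt_hodgeStar_two hγ hβ hn hl
  have h2 : toExt (hodgeStar hl γ γ) = toExt (dpow γ (n - 1)) := by
    rw [toExt_hodgeStar, ← toExt_dpow_one, sharp_dpow_dpow hγ (l := n - 1) (by omega)]
  rw [h, neg_zero, zero_add, ← h2, ← map_smul, ← hodgeStar_smul] at h1
  have h3 := hodgeStar_injective hγ hl (toExt_injective h1)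
  have h4 : t = t * n := by
    conv_lhs => rw [ht, h3]
    rw [trace_zero_smul, trace_self hγ]
  have h5 : t * ((n : ℂ) - 1) = 0 := by linear_combination -h4
  rw [h3, ← ht, (mul_eq_zero.mp h5).resolve_right hn1]
  exact zero_smul ℂ γ

/-- Write `b = ⋆η`. The star commutes with `J`, so by its injectivity `η` inherits the invariance of
`b`, and the explicit solution for `⋆η` applies. -/
theorem exists_dpow_mul_eq {γ : Alt n 2} (hγ : IsPositive γ) (hn : 2 ≤ n) {k : ℕ}
    (hk : 2 + k = 2 * n) {b : Alt n k} (hb : JInv b) :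
    ∃ β : Alt n 2, IsType11 β ∧ toExt (dpow γ (n - 2)) * toExt β = toExt b := by
  obtain ⟨η, rfl⟩ := hodgeStar_surjective hγ hk b
  have hη : IsType11 η := by
    rw [← jInv_two_iff]
    apply hodgeStar_injective hγ hk
    rw [← pull_mulI_hodgeStar hγ.type11, hb]
  exact ⟨_, hη.neg.add (hγ.type11.smul _), dpow_mul_correction hγ hη hn hk⟩

/-- `divide` is a choice function that means something only on the image of the wedge map;
invariance under `J` guarantees that `b` lies there. -/
theorem divide_spec {γ : Alt n 2} (hγ : IsPositive γ) (hn : 2 ≤ n) {k : ℕ}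
    (h : 2 * (n - 2) + 2 = k) {b : Alt n k} (hb : JInv b) :
    IsType11 (divide h γ b) ∧ toExt (dpow γ (n - 2)) * toExt (divide h γ b) = toExt b := by
  obtain ⟨β, hβ, hb'⟩ := exists_dpow_mul_eq hγ hn (by omega) hb
  have hex : ∃ β ∈ {β | IsType11 β},
      (fun β : Alt n 2 => castDeg h (wedge (dpow γ (n - 2)) β)) β = b :=
    ⟨β, hβ, toExt_injective (by rw [toExt_castDeg, toExt_wedge, hb'])⟩
  refine ⟨Function.invFunOn_mem hex, ?_⟩
  have h1 : castDeg h (wedge (dpow γ (n - 2)) (divide h γ b)) = b := Function.invFunOn_eq hex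
  conv_rhs => rw [← h1]
  rw [toExt_castDeg, toExt_wedge]

/-- Uniqueness of the quotient identifies the chosen value with a closed formula, from which the
smoothness of `T_γ(η)` can be read off. -/
theorem divide_hodgeStar {γ η : Alt n 2} (hγ : IsPositive γ) (hη : IsType11 η) (hn : 2 ≤ n) {k : ℕ}
    (h : 2 * (n - 2) + 2 = k) (hk : 2 + k = 2 * n) : divide h γ (hodgeStar hk γ η) =
      -η + ((trace (k := 0) γ η ![]) / ((n : ℂ) - 1)) • γ := by
  obtain ⟨h1, h2⟩ := divide_spec hγ hn h (JInv.hodgeStar hγ.type11 hk ((jInv_two_iff η).mpr hη))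
  have h3 := hη.neg.add (hγ.type11.smul ((trace (k := 0) γ η ![]) / ((n : ℂ) - 1)))
  rw [← sub_eq_zero, sub_eq_add_neg]
  apply eq_zero_of_dpow_mul_eq_zero hγ (h1.add h3.neg) hn
  rw [← sub_eq_add_neg, map_sub, mul_sub, h2, dpow_mul_correction hγ hη hn hk, sub_self]

theorem IsPositive.pull {γ : Alt n 2} (h : IsPositive γ) (L : Cn n ≃L[ℂ] Cn n) :
    IsPositive (pull (toReal L) γ) := by
  have h0 : ∀ u v, Alt.pull (toReal L) γ ![u, v] = γ ![L u, L v] := by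
    intro u v
    rw [pull_apply]
    congr 1
    funext i
    fin_cases i <;> rfl
  refine ⟨fun u v => ?_, fun u v => ?_, fun u hu => ?_⟩
  · rw [h0, h0, map_smul, map_smul, h.type11]
  · rw [h0]
    exact h.real _ _
  · rw [h0, map_smul]
    exact h.pos _ (by simpa using hu)

end Alt
end

/-! ### Smoothness of the pointwise operations and the Leibniz rule on `ℂⁿ`. -/

noncomputable section

namespace Alt

variable {n : ℕ}

/-! ### Differential calculus on `ℂⁿ` -/

/-- The exterior derivative twisted by the complex structure. -/
def extDerivI {k : ℕ} (a : Cn n → Alt n k) (y : Cn n) : Alt n (k + 1) :=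
  ContinuousAlternatingMap.alternatizeUncurryFin ((fderiv ℝ a y).comp (mulI n))

/-- The operator `(d + ε d_J) / 2`, which is `∂` for `ε = -i` and `∂̄` for `ε = i`. -/
def dolb (ε : ℂ) {k : ℕ} (a : Cn n → Alt n k) (y : Cn n) : Alt n (k + 1) :=
  ((1 : ℂ) / 2) • (extDeriv a y + ε • extDerivI a y)

theorem del_eq_dolb {k : ℕ} (a : Cn n → Alt n k) (y : Cn n) : del a y = dolb (-Complex.I) a y := by
  have h : fderiv ℝ a y - Complex.I • (fderiv ℝ a y).comp
      (Complex.I • ContinuousLinearMap.id ℝ (Cn n)) = fderiv ℝ a y + (-Complex.I) •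
      (fderiv ℝ a y).comp (Complex.I • ContinuousLinearMap.id ℝ (Cn n)) := by
    ext v w
    simp [sub_eq_add_neg]
  rw [del, h, ContinuousAlternatingMap.alternatizeUncurryFin_smul,
    ContinuousAlternatingMap.alternatizeUncurryFin_add,
    ContinuousAlternatingMap.alternatizeUncurryFin_smul]
  rfl

theorem delbar_eq_dolb {k : ℕ} (a : Cn n → Alt n k) (y : Cn n) :
    delbar a y = dolb Complex.I a y := by
  rw [delbar, ContinuousAlternatingMap.alternatizeUncurryFin_smul,
    ContinuousAlternatingMap.alternatizeUncurryFin_add,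
    ContinuousAlternatingMap.alternatizeUncurryFin_smul]
  rfl

theorem contDiffOn_of_components {k : ℕ} {a : Cn n → Alt n k} {U : Set (Cn n)}
    (h : ∀ p : Fin k → Fin (2 * n), ContDiffOn ℝ (⊤ : ℕ∞) (fun y => a y fun i => frame n (p i)) U) :
    ContDiffOn ℝ (⊤ : ℕ∞) a U := by
  obtain ⟨g, hg⟩ := ((components n k).restrictScalars ℝ).exists_leftInverse_of_injective
    (LinearMap.ker_eq_bot.mpr (components_injective n k))
  have h1 : a = fun y => LinearMap.toContinuousLinearMap g (components n k (a y)) := by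
    funext y
    exact (LinearMap.congr_fun hg (a y)).symm
  rw [h1]
  exact (LinearMap.toContinuousLinearMap g).contDiff.comp_contDiffOn (contDiffOn_pi.mpr h)

theorem contDiffOn_apply {k : ℕ} {a : Cn n → Alt n k} {U : Set (Cn n)} {r : WithTop ℕ∞}
    (h : ContDiffOn ℝ r a U) (v : Fin k → Cn n) : ContDiffOn ℝ r (fun y => a y v) U :=
  (ContinuousAlternatingMap.apply ℝ (Cn n) ℂ v).contDiff.comp_contDiffOn h

/-- The wedge product as a continuous bilinear map. -/
def wedgeCLM (n k l : ℕ) : Alt n k →L[ℝ] Alt n l →L[ℝ] Alt n (k + l) :=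
  (LinearMap.mk₂ ℝ wedge
    (fun a a' b => toExt_injective (by simp only [toExt_wedge, map_add, add_mul]))
    (fun c a b => toExt_injective (by simp only [toExt_wedge, toExt_smul_real, smul_mul_assoc]))
    (fun a b b' => toExt_injective (by simp only [toExt_wedge, map_add, mul_add]))
    (fun c a b => toExt_injective (by simp only [toExt_wedge, toExt_smul_real, mul_smul_comm]))
    ).toContinuousBilinearMap

theorem contDiffOn_wedge {k l : ℕ} {a : Cn n → Alt n k} {b : Cn n → Alt n l} {U : Set (Cn n)}
    (ha : ContDiffOn ℝ (⊤ : ℕ∞) a U) (hb : ContDiffOn ℝ (⊤ : ℕ∞) b U) :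
    ContDiffOn ℝ (⊤ : ℕ∞) (fun y => wedge (a y) (b y)) U := by
  apply contDiffOn_of_components
  intro p
  simp only [wedge_apply]
  exact contDiffOn_const.mul (ContDiffOn.sum fun σ _ => contDiffOn_const.mul
    ((contDiffOn_apply ha _).mul (contDiffOn_apply hb _)))

theorem contDiffOn_const_smul {k : ℕ} {a : Cn n → Alt n k} {U : Set (Cn n)} (c : ℂ)
    (ha : ContDiffOn ℝ (⊤ : ℕ∞) a U) : ContDiffOn ℝ (⊤ : ℕ∞) (fun y => c • a y) U :=
  ha.const_smul c

theorem contDiffOn_wedgePow {a : Cn n → Alt n 2} {U : Set (Cn n)}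
    (ha : ContDiffOn ℝ (⊤ : ℕ∞) a U) (p : ℕ) :
    ContDiffOn ℝ (⊤ : ℕ∞) (fun y => wedgePow (a y) p) U := by
  induction p with
  | zero => exact contDiffOn_const
  | succ p ih => exact contDiffOn_wedge ih ha

theorem contDiffOn_dpow {a : Cn n → Alt n 2} {U : Set (Cn n)}
    (ha : ContDiffOn ℝ (⊤ : ℕ∞) a U) (p : ℕ) :
    ContDiffOn ℝ (⊤ : ℕ∞) (fun y => dpow (a y) p) U :=
  (contDiffOn_wedgePow ha p).const_smul _

theorem contDiffOn_castDeg {k l : ℕ} (h : k = l) {a : Cn n → Alt n k} {U : Set (Cn n)}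
    (ha : ContDiffOn ℝ (⊤ : ℕ∞) a U) : ContDiffOn ℝ (⊤ : ℕ∞) (fun y => castDeg h (a y)) U := by
  subst h
  exact ha

theorem contDiffOn_gramInv {γ : Cn n → Alt n 2} {U : Set (Cn n)}
    (hγ : ContDiffOn ℝ (⊤ : ℕ∞) γ U) (hpos : ∀ y ∈ U, IsPositive (γ y)) (p q : Fin (2 * n)) :
    ContDiffOn ℝ (⊤ : ℕ∞) (fun y => gramInv (γ y) p q) U := by
  have hG : ∀ i j, ContDiffOn ℝ (⊤ : ℕ∞) (fun y => gram (γ y) i j) U := fun i j =>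
    contDiffOn_apply hγ _
  have hdet : ∀ (M : Cn n → Matrix (Fin (2 * n)) (Fin (2 * n)) ℂ),
      (∀ i j, ContDiffOn ℝ (⊤ : ℕ∞) (fun y => M y i j) U) →
      ContDiffOn ℝ (⊤ : ℕ∞) (fun y => (M y).det) U := by
    intro M hM
    simp only [Matrix.det_apply']
    refine ContDiffOn.sum fun σ _ => ?_
    exact contDiffOn_const.mul (contDiffOn_prod fun i _ => hM _ _)
  -- Cramer's rule: an entry of the inverse is a quotient of two polynomials in the entries of the
  -- Gram matrix.
  have h1 : ∀ y, gramInv (γ y) p q = ((gram (γ y)).det)⁻¹ *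
      ((gram (γ y)).updateRow q (Pi.single p 1)).det := by
    intro y
    rw [gramInv, Matrix.inv_def, Matrix.smul_apply, Matrix.adjugate_apply, Ring.inverse_eq_inv',
      smul_eq_mul]
  simp only [h1]
  refine ContDiffOn.mul (ContDiffOn.inv (hdet _ hG) fun y hy => (hpos y hy).isUnit_det_gram.ne_zero)
    (hdet _ fun i j => ?_)
  simp only [Matrix.updateRow_apply]
  split_ifs
  · exact contDiffOn_const
  · exact hG i j

theorem sum_alt_apply {k : ℕ} {ι : Type*} (s : Finset ι) (f : ι → Alt n k) (v : Fin k → Cn n) :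
    (∑ i ∈ s, f i) v = ∑ i ∈ s, f i v := by
  simp

theorem contDiffOn_hodgeStar {γ : Cn n → Alt n 2} {U : Set (Cn n)}
    (hγ : ContDiffOn ℝ (⊤ : ℕ∞) γ U) (hpos : ∀ y ∈ U, IsPositive (γ y)) {k l : ℕ}
    (h : k + l = 2 * n) {a : Cn n → Alt n k} (ha : ContDiffOn ℝ (⊤ : ℕ∞) a U) :
    ContDiffOn ℝ (⊤ : ℕ∞) (fun y => hodgeStar h (γ y) (a y)) U := by
  apply contDiffOn_of_components
  intro p
  simp only [hodgeStar_eq, ContinuousAlternatingMap.smul_apply, sum_alt_apply, contract_apply,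
    smul_eq_mul]
  refine contDiffOn_const.mul (ContDiffOn.sum fun r _ => ContDiffOn.sum fun q _ => ?_)
  refine ContDiffOn.mul (ContDiffOn.mul (contDiffOn_prod fun i _ => contDiffOn_gramInv hγ hpos _ _)
    (contDiffOn_apply ha _)) (contDiffOn_apply (contDiffOn_dpow hγ n) _)

theorem trace_eq (γ : Alt n 2) {k : ℕ} (a : Alt n (k + 2)) :
    trace γ a = ((1 : ℂ) / 2) • ∑ p : Fin (2 * n), ∑ q : Fin (2 * n),
      (gramInv γ p q) • contract (Nat.add_comm 2 k) ![frame n p, Complex.I • frame n q] a := rfl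

theorem contDiffOn_trace {γ : Cn n → Alt n 2} {U : Set (Cn n)}
    (hγ : ContDiffOn ℝ (⊤ : ℕ∞) γ U) (hpos : ∀ y ∈ U, IsPositive (γ y)) {k : ℕ}
    {a : Cn n → Alt n (k + 2)} (ha : ContDiffOn ℝ (⊤ : ℕ∞) a U) :
    ContDiffOn ℝ (⊤ : ℕ∞) (fun y => trace (γ y) (a y)) U := by
  apply contDiffOn_of_components
  intro p
  simp only [trace_eq, ContinuousAlternatingMap.smul_apply, sum_alt_apply, contract_apply,
    smul_eq_mul]
  refine contDiffOn_const.mul (ContDiffOn.sum fun r _ => ContDiffOn.sum fun q _ => ?_)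
  exact ContDiffOn.mul (contDiffOn_gramInv hγ hpos _ _) (contDiffOn_apply ha _)

theorem contDiffOn_extDeriv {k : ℕ} {a : Cn n → Alt n k} {U : Set (Cn n)} (hU : IsOpen U)
    (ha : ContDiffOn ℝ (⊤ : ℕ∞) a U) : ContDiffOn ℝ (⊤ : ℕ∞) (extDeriv a) U :=
  (ContinuousAlternatingMap.alternatizeUncurryFinCLM ℝ (Cn n) ℂ).contDiff.comp_contDiffOn
    (ha.fderiv_of_isOpen hU le_rfl)

theorem contDiffOn_extDerivI {k : ℕ} {a : Cn n → Alt n k} {U : Set (Cn n)} (hU : IsOpen U)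
    (ha : ContDiffOn ℝ (⊤ : ℕ∞) a U) : ContDiffOn ℝ (⊤ : ℕ∞) (extDerivI a) U :=
  (ContinuousAlternatingMap.alternatizeUncurryFinCLM ℝ (Cn n) ℂ).contDiff.comp_contDiffOn
    ((ha.fderiv_of_isOpen hU le_rfl).clm_comp contDiffOn_const)

theorem contDiffOn_dolb (ε : ℂ) {k : ℕ} {a : Cn n → Alt n k} {U : Set (Cn n)} (hU : IsOpen U)
    (ha : ContDiffOn ℝ (⊤ : ℕ∞) a U) : ContDiffOn ℝ (⊤ : ℕ∞) (dolb ε a) U :=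
  contDiffOn_const_smul _ ((contDiffOn_extDeriv hU ha).add
    (contDiffOn_const_smul _ (contDiffOn_extDerivI hU ha)))

theorem differentiableAt_of_contDiffOn {k : ℕ} {a : Cn n → Alt n k} {U : Set (Cn n)} (hU : IsOpen U)
    (ha : ContDiffOn ℝ (⊤ : ℕ∞) a U) {y : Cn n} (hy : y ∈ U) : DifferentiableAt ℝ a y :=
  (ha.contDiffAt (hU.mem_nhds hy)).differentiableAt (by simp)

theorem toExt_dolb (ε : ℂ) {k : ℕ} (a : Cn n → Alt n k) (y : Cn n) :
    toExt (dolb ε a y) = (2 : ℂ)⁻¹ • ∑ j, cov j * (toExt (fderiv ℝ a y (frame n j)) +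
      ε • toExt (fderiv ℝ a y (Complex.I • frame n j))) := by
  rw [dolb, extDeriv, extDerivI, map_smul, map_add, map_smul, toExt_alternatizeUncurryFin,
    toExt_alternatizeUncurryFin, one_div, Finset.smul_sum, ← Finset.sum_add_distrib]
  simp only [mul_add, mul_smul_comm]
  rfl

theorem fderiv_wedge {k l : ℕ} {a : Cn n → Alt n k} {b : Cn n → Alt n l} {y : Cn n}
    (ha : DifferentiableAt ℝ a y) (hb : DifferentiableAt ℝ b y) (v : Cn n) :
    fderiv ℝ (fun y => wedge (a y) (b y)) y v =
      wedge (a y) (fderiv ℝ b y v) + wedge (fderiv ℝ a y v) (b y) := by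
  have h := (wedgeCLM n k l).hasFDerivAt_of_bilinear ha.hasFDerivAt hb.hasFDerivAt
  have h2 : (fun y => wedge (a y) (b y)) = fun y => wedgeCLM n k l (a y) (b y) := rfl
  rw [h2, h.fderiv]
  simp
  rfl

/-- The Leibniz rule. -/
theorem toExt_dolb_wedge (ε : ℂ) {k l : ℕ} {a : Cn n → Alt n k} {b : Cn n → Alt n l} {y : Cn n}
    (ha : DifferentiableAt ℝ a y) (hb : DifferentiableAt ℝ b y) :
    toExt (dolb ε (fun y => wedge (a y) (b y)) y) =
      toExt (dolb ε a y) * toExt (b y) + (-1 : ℂ) ^ k • (toExt (a y) * toExt (dolb ε b y)) := by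
  rw [toExt_dolb, toExt_dolb, toExt_dolb, smul_mul_assoc, mul_smul_comm, smul_comm _ (2 : ℂ)⁻¹,
    ← smul_add, Finset.sum_mul, Finset.mul_sum, Finset.smul_sum (r := (-1 : ℂ) ^ k),
    ← Finset.sum_add_distrib]
  refine congrArg _ (Finset.sum_congr rfl fun j _ => ?_)
  simp only [fderiv_wedge ha hb, map_add, toExt_wedge]
  have h1 : ∀ x, cov j * (toExt (a y) * x) = (-1 : ℂ) ^ k • (toExt (a y) * (cov j * x)) := by
    intro x
    rw [← mul_assoc, cov_mul_toExt, smul_mul_assoc, mul_assoc]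
  simp only [mul_add, add_mul, smul_add, mul_smul_comm, smul_mul_assoc, h1, mul_assoc]
  rw [smul_comm ε]
  abel

end Alt
end

/-! ### `∂` and `∂̄` on `ℂⁿ`: holomorphic naturality, anticommutation, invariance, Stokes. -/

noncomputable section

open Filter Topology

namespace Alt

variable {n : ℕ}

/-- Pullback by a real-linear map as a continuous linear map on forms. -/
def pullCLM (L : Cn n →L[ℝ] Cn n) (k : ℕ) : Alt n k →L[ℝ] Alt n k :=
  ContinuousAlternatingMap.compContinuousLinearMapCLM L

theorem fderiv_pull (L : Cn n →L[ℝ] Cn n) {k : ℕ} {a : Cn n → Alt n k} {y : Cn n}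
    (ha : DifferentiableAt ℝ a y) (v : Cn n) :
    fderiv ℝ (fun y => pull L (a y)) y v = pull L (fderiv ℝ a y v) := by
  have h := (pullCLM L k).hasFDerivAt.comp y ha.hasFDerivAt
  have h2 : (fun y => pull L (a y)) = pullCLM L k ∘ a := rfl
  rw [h2, h.fderiv]
  rfl

theorem differentiableAt_pull (L : Cn n →L[ℝ] Cn n) {k : ℕ} {a : Cn n → Alt n k} {y : Cn n}
    (ha : DifferentiableAt ℝ a y) : DifferentiableAt ℝ (fun y => pull L (a y)) y :=
  (pullCLM L k).differentiableAt.comp y ha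

theorem contDiffOn_pull (L : Cn n →L[ℝ] Cn n) {k : ℕ} {a : Cn n → Alt n k} {U : Set (Cn n)}
    {r : WithTop ℕ∞} (ha : ContDiffOn ℝ r a U) : ContDiffOn ℝ r (fun y => pull L (a y)) U :=
  (pullCLM L k).contDiff.comp_contDiffOn ha

theorem mulI_mulI (v : Cn n) : mulI n (mulI n v) = -v := by
  simp [smul_smul]

theorem pull_neg_mulI_pull {k : ℕ} (a : Alt n k) : pull (-mulI n) (pull (mulI n) a) = a := by
  ext v
  simp only [pull_apply, neg_apply, map_neg, mulI_mulI, neg_neg]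

/-- The twisted derivative is `d` conjugated by `J`. Facts about `d`, such as `d² = 0` and
compatibility with pullback, therefore transfer to it. -/
theorem extDerivI_eq {k : ℕ} {a : Cn n → Alt n k} {y : Cn n} (ha : DifferentiableAt ℝ a y) :
    extDerivI a y = pull (mulI n) (extDeriv (fun y => pull (-mulI n) (a y)) y) := by
  ext v
  rw [pull_apply, extDerivI, extDeriv, ContinuousAlternatingMap.alternatizeUncurryFin_apply,
    ContinuousAlternatingMap.alternatizeUncurryFin_apply]
  refine Finset.sum_congr rfl fun i _ => ?_
  rw [fderiv_pull _ ha, pull_apply]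
  have h : (fun i' => (-mulI n) (i.removeNth (fun i => mulI n (v i)) i')) = i.removeNth v := by
    funext i'
    simp only [Fin.removeNth, neg_apply, mulI_mulI, neg_neg]
  rw [h]
  rfl

theorem extDeriv_congr {k : ℕ} {a b : Cn n → Alt n k} {y : Cn n} (h : a =ᶠ[𝓝 y] b) :
    extDeriv a y = extDeriv b y := h.extDeriv_eq

theorem extDerivI_congr {k : ℕ} {a b : Cn n → Alt n k} {y : Cn n} (h : a =ᶠ[𝓝 y] b) :
    extDerivI a y = extDerivI b y := by
  rw [extDerivI, extDerivI, h.fderiv_eq]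

theorem dolb_congr (ε : ℂ) {k : ℕ} {a b : Cn n → Alt n k} {y : Cn n} (h : a =ᶠ[𝓝 y] b) :
    dolb ε a y = dolb ε b y := by
  rw [dolb, dolb, extDeriv_congr h, extDerivI_congr h]

/-- Naturality of `∂` and `∂̄` under holomorphic maps. -/
theorem dolb_pullback (ε : ℂ) {k : ℕ} {a : Cn n → Alt n k} {f : Cn n → Cn n} {y : Cn n}
    (ha : DifferentiableAt ℝ a (f y)) (hf : ContDiffAt ℝ 2 f y)
    (hI : ∀ᶠ y' in 𝓝 y, ∀ v, fderiv ℝ f y' (Complex.I • v) = Complex.I • fderiv ℝ f y' v) :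
    dolb ε (fun y => pull (fderiv ℝ f y) (a (f y))) y = pull (fderiv ℝ f y) (dolb ε a (f y)) := by
  have hr : minSmoothness ℝ 2 ≤ 2 := by simp
  have hfd : DifferentiableAt ℝ f y := hf.differentiableAt (by simp)
  have hdf : DifferentiableAt ℝ (fderiv ℝ f) y :=
    (hf.fderiv_right (m := 1) (by norm_num)).differentiableAt (by simp)
  have hpd : DifferentiableAt ℝ (fun y => pull (fderiv ℝ f y) (a (f y))) y :=
    DifferentiableAt.continuousAlternatingMapCompContinuousLinearMap (ha.comp y hfd) hdf
  have h1 : extDeriv (fun y => pull (fderiv ℝ f y) (a (f y))) y =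
      pull (fderiv ℝ f y) (extDeriv a (f y)) := extDeriv_pullback ha hf hr
  have h2 : extDerivI (fun y => pull (fderiv ℝ f y) (a (f y))) y =
      pull (fderiv ℝ f y) (extDerivI a (f y)) := by
    rw [extDerivI_eq hpd, extDerivI_eq ha]
    -- Near `y` the derivative of `f` commutes with `J`, so the conjugation passes through the
    -- pullback. An equality at `y` alone would not suffice, since both sides are differentiated.
    have h3 : (fun y => pull (-mulI n) (pull (fderiv ℝ f y) (a (f y)))) =ᶠ[𝓝 y]
        fun y => pull (fderiv ℝ f y) ((fun z => pull (-mulI n) (a z)) (f y)) := by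
      filter_upwards [hI] with y' hy'
      ext v
      simp only [pull_apply, neg_apply, map_neg, mulI_apply, hy']
    have h4 : extDeriv (fun y => pull (fderiv ℝ f y) ((fun z => pull (-mulI n) (a z)) (f y))) y =
        pull (fderiv ℝ f y) (extDeriv (fun z => pull (-mulI n) (a z)) (f y)) :=
      extDeriv_pullback (differentiableAt_pull _ ha) hf hr
    rw [extDeriv_congr h3, h4]
    ext v
    simp only [pull_apply, mulI_apply, hI.self_of_nhds]
  rw [dolb, dolb, h1, h2]
  rfl

theorem extDeriv_const_smul {k : ℕ} {a : Cn n → Alt n k} {y : Cn n} (c : ℂ)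
    (ha : DifferentiableAt ℝ a y) : extDeriv (fun y => c • a y) y = c • extDeriv a y := by
  rw [extDeriv, fderiv_fun_const_smul ha, ContinuousAlternatingMap.alternatizeUncurryFin_smul]
  rfl

theorem extDerivI_const_smul {k : ℕ} {a : Cn n → Alt n k} {y : Cn n} (c : ℂ)
    (ha : DifferentiableAt ℝ a y) : extDerivI (fun y => c • a y) y = c • extDerivI a y := by
  rw [extDerivI, fderiv_fun_const_smul ha, ContinuousLinearMap.smul_comp,
    ContinuousAlternatingMap.alternatizeUncurryFin_smul]
  rfl

theorem extDerivI_add {k : ℕ} {a b : Cn n → Alt n k} {y : Cn n}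
    (ha : DifferentiableAt ℝ a y) (hb : DifferentiableAt ℝ b y) :
    extDerivI (fun y => a y + b y) y = extDerivI a y + extDerivI b y := by
  rw [extDerivI, fderiv_fun_add ha hb, ContinuousLinearMap.add_comp,
    ContinuousAlternatingMap.alternatizeUncurryFin_add]
  rfl

theorem dolb_add (ε : ℂ) {k : ℕ} {a b : Cn n → Alt n k} {y : Cn n}
    (ha : DifferentiableAt ℝ a y) (hb : DifferentiableAt ℝ b y) :
    dolb ε (fun y => a y + b y) y = dolb ε a y + dolb ε b y := by
  rw [dolb, extDerivI_add ha hb, extDeriv_fun_add ha hb, dolb, dolb]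
  module

theorem dolb_const_smul (ε : ℂ) {k : ℕ} {a : Cn n → Alt n k} {y : Cn n} (c : ℂ)
    (ha : DifferentiableAt ℝ a y) : dolb ε (fun y => c • a y) y = c • dolb ε a y := by
  rw [dolb, extDerivI_const_smul c ha, extDeriv_const_smul c ha, dolb]
  module

/-- Expand `(d + ε d_J)(d - ε d_J)/4`. The squares of `d` and `d_J` vanish and only the mixed terms
remain; the result is odd in `ε`, which is the anticommutation of `∂` and `∂̄`. -/
theorem dolb_dolb_neg {ε : ℂ} {k : ℕ} {a : Cn n → Alt n k} {U : Set (Cn n)}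
    (hU : IsOpen U) (ha : ContDiffOn ℝ (⊤ : ℕ∞) a U) {y : Cn n} (hy : y ∈ U) :
    dolb ε (dolb (-ε) a) y =
      ((ε / 4 : ℂ)) • (extDerivI (extDeriv a) y - extDeriv (extDerivI a) y) := by
  have hmin : minSmoothness ℝ 2 ≤ ((⊤ : ℕ∞) : WithTop ℕ∞) := by
    simp only [minSmoothness_of_isRCLikeNormedField]
    exact WithTop.coe_le_coe.mpr (le_top : (2 : ℕ∞) ≤ ⊤)
  have hUy := hU.mem_nhds hy
  have hd := contDiffOn_extDeriv hU ha
  have hdI := contDiffOn_extDerivI hU ha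
  have h1 : extDeriv (extDeriv a) y = 0 := extDeriv_extDeriv_apply (ha.contDiffAt hUy) hmin
  have h2 : extDerivI (extDerivI a) y = 0 := by
    rw [extDerivI_eq (differentiableAt_of_contDiffOn hU hdI hy)]
    have h3 : (fun y => pull (-mulI n) (extDerivI a y)) =ᶠ[𝓝 y]
        extDeriv (fun y => pull (-mulI n) (a y)) := by
      filter_upwards [hUy] with y' hy'
      rw [extDerivI_eq (differentiableAt_of_contDiffOn hU ha hy'), pull_neg_mulI_pull]
    rw [extDeriv_congr h3, extDeriv_extDeriv_apply ((contDiffOn_pull _ ha).contDiffAt hUy) hmin]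
    rfl
  have hd' := differentiableAt_of_contDiffOn hU hd hy
  have hdI' := differentiableAt_of_contDiffOn hU hdI hy
  have h4 : dolb (-ε) a = fun y => ((1 : ℂ) / 2) • (extDeriv a y + (-ε) • extDerivI a y) := rfl
  have hs : DifferentiableAt ℝ (fun y => (-ε) • extDerivI a y) y := hdI'.fun_const_smul _
  rw [h4, dolb_const_smul _ _ (hd'.fun_add hs), dolb_add _ hd' hs, dolb_const_smul _ _ hdI', dolb, dolb,
    h1, h2]
  module

/-- `∂∂̄ = -∂̄∂`. -/
theorem dolb_anticomm (ε : ℂ) {k : ℕ} {a : Cn n → Alt n k} {U : Set (Cn n)}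
    (hU : IsOpen U) (ha : ContDiffOn ℝ (⊤ : ℕ∞) a U) {y : Cn n} (hy : y ∈ U) :
    dolb ε (dolb (-ε) a) y = -dolb (-ε) (dolb ε a) y := by
  have h := dolb_dolb_neg (ε := -ε) hU ha hy
  rw [neg_neg] at h
  rw [dolb_dolb_neg hU ha hy, h]
  module

/-- Pullback by `J` exchanges the two derivatives: `J^* d = d_J J^*` and `J^* d_J = -d J^*`. The
combination `d + ε d_J` is then an eigenvector exactly because `ε² = -1`. -/
theorem pull_mulI_dolb {ε : ℂ} (hε : ε * ε = -1) {k : ℕ} {a : Cn n → Alt n k} {y : Cn n}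
    (ha : DifferentiableAt ℝ a y) :
    pull (mulI n) (dolb ε a y) = -ε • dolb ε (fun y => pull (mulI n) (a y)) y := by
  have h1 : pull (mulI n) (extDeriv a y) = extDerivI (fun y => pull (mulI n) (a y)) y := by
    rw [extDerivI_eq (differentiableAt_pull _ ha)]
    simp only [pull_neg_mulI_pull]
  have h2 : pull (mulI n) (extDerivI a y) = -extDeriv (fun y => pull (mulI n) (a y)) y := by
    ext v
    rw [pull_apply, extDerivI, ContinuousAlternatingMap.neg_apply, extDeriv,
      ContinuousAlternatingMap.alternatizeUncurryFin_apply,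
      ContinuousAlternatingMap.alternatizeUncurryFin_apply, ← Finset.sum_neg_distrib]
    refine Finset.sum_congr rfl fun i _ => ?_
    rw [fderiv_pull _ ha, ContinuousLinearMap.comp_apply, mulI_mulI, map_neg,
      ContinuousAlternatingMap.neg_apply, smul_neg]
    rfl
  rw [dolb, pull_smul, pull_add, pull_smul, h1, h2, dolb]
  have h3 : ε • -extDeriv (fun y => pull (mulI n) (a y)) y =
    -ε • extDeriv (fun y => pull (mulI n) (a y)) y := by module
  rw [h3]
  have h4 : ∀ (u v : Alt n (k + 1)), ((1 : ℂ) / 2) • (v + -ε • u) =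
      -ε • ((1 : ℂ) / 2) • (u + ε • v) := by
    intro u v
    have : -ε • ((1 : ℂ) / 2) • (u + ε • v) = ((1 : ℂ) / 2) • ((-(ε * ε)) • v + -ε • u) := by module
    rw [this, hε]
    module
  exact h4 _ _

/-- The two successive operators contribute the factors `ε` and `-ε`, whose product is `1`. This
takes the place of the statement that `i∂∂̄` raises the bidegree by `(1,1)`. -/
theorem dolb_jInv_jInv {ε : ℂ} (hε : ε * ε = -1) {k : ℕ} {a : Cn n → Alt n k} {U : Set (Cn n)}
    (hU : IsOpen U) (ha : ContDiffOn ℝ (⊤ : ℕ∞) a U) (hJ : ∀ y ∈ U, JInv (a y)) {y : Cn n}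
    (hy : y ∈ U) : JInv (dolb ε (dolb (-ε) a) y) := by
  have hε' : -ε * -ε = -1 := by rw [neg_mul_neg, hε]
  have hd := contDiffOn_dolb (-ε) hU ha
  have h1 : ∀ y ∈ U, pull (mulI n) (dolb (-ε) a y) = ε • dolb (-ε) a y := by
    intro y hy
    rw [pull_mulI_dolb hε' (differentiableAt_of_contDiffOn hU ha hy), neg_neg]
    congr 1
    apply dolb_congr
    filter_upwards [hU.mem_nhds hy] with y' hy'
    exact hJ y' hy'
  have hd' := differentiableAt_of_contDiffOn hU hd hy
  have h2 : (fun y => pull (mulI n) (dolb (-ε) a y)) =ᶠ[𝓝 y] fun y => ε • dolb (-ε) a y := by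
    filter_upwards [hU.mem_nhds hy] with y' hy'
    exact h1 y' hy'
  rw [JInv, pull_mulI_dolb hε hd', dolb_congr _ h2, dolb_const_smul _ _ hd', smul_smul, neg_mul, hε,
    neg_neg, one_smul]

/-- On invariant forms `d_J a = J^* (d a)`, so both halves of `dolb` vanish with `d a`. This
replaces splitting `d a` into its two types. -/
theorem dolb_eq_zero_of_extDeriv_eq_zero (ε : ℂ) {k : ℕ} {a : Cn n → Alt n k} {U : Set (Cn n)}
    (hU : IsOpen U) (ha : ContDiffOn ℝ (⊤ : ℕ∞) a U) (hJ : ∀ y ∈ U, JInv (a y)) {y : Cn n}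
    (hy : y ∈ U) (h : extDeriv a y = 0) : dolb ε a y = 0 := by
  have h1 : (fun y => pull (-mulI n) (a y)) =ᶠ[𝓝 y] a := by
    filter_upwards [hU.mem_nhds hy] with y' hy'
    have h2 : pull (mulI n) (a y') = a y' := hJ y' hy'
    conv_lhs => rw [← h2]
    exact pull_neg_mulI_pull _
  rw [dolb, h, extDerivI_eq (differentiableAt_of_contDiffOn hU ha hy), extDeriv_congr h1, h]
  change ((1 : ℂ) / 2) • (0 + ε • (0 : Alt n (k + 1))) = 0
  module

/-! ### Stokes' theorem on `ℂⁿ` -/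

open MeasureTheory in
-- Integration by parts against the constant `1`, which need not be integrable itself: only its
-- products with `g` and with the derivative of `g` have to be.
theorem integral_fderiv_eq_zero {g : Cn n → ℂ} (hg : ContDiff ℝ (⊤ : ℕ∞) g)
    (hc : HasCompactSupport g) (v : Cn n) : ∫ y, fderiv ℝ g y v = 0 := by
  have hd : Continuous fun y => fderiv ℝ g y v :=
    (hg.continuous_fderiv (by simp)).clm_apply continuous_const
  have hdc : HasCompactSupport fun y => fderiv ℝ g y v := hc.fderiv_apply (𝕜 := ℝ) v
  have h := integral_mul_fderiv_eq_neg_fderiv_mul_of_integrable (μ := volume)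
    (f := fun _ : Cn n => (1 : ℂ)) (g := g) (v := v) (by simp)
    (by simpa using hd.integrable_of_hasCompactSupport hdc)
    (by simpa using hg.continuous.integrable_of_hasCompactSupport hc)
    (fun _ _ => differentiableAt_const _) (fun x _ => hg.differentiable (by simp) x)
  simpa using h

open MeasureTheory in
theorem integral_dolb_eq_zero (ε : ℂ) {k : ℕ} {a : Cn n → Alt n k} (ha : ContDiff ℝ (⊤ : ℕ∞) a)
    (hc : HasCompactSupport a) (v : Fin (k + 1) → Cn n) : ∫ y, dolb ε a y v = 0 := by
  have hD : ∀ (u : Cn n) (w : Fin k → Cn n), ∀ y, fderiv ℝ a y u w =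
      fderiv ℝ (fun y => a y w) y u := by
    intro u w y
    have h := (ContinuousAlternatingMap.apply ℝ (Cn n) ℂ w).hasFDerivAt.comp y
      (ha.differentiable (by simp) y).hasFDerivAt
    have h2 : (fun y => a y w) = (ContinuousAlternatingMap.apply ℝ (Cn n) ℂ w) ∘ a := rfl
    rw [h2, h.fderiv]
    rfl
  have hg : ∀ w : Fin k → Cn n, ContDiff ℝ (⊤ : ℕ∞) fun y => a y w := fun w =>
    (ContinuousAlternatingMap.apply ℝ (Cn n) ℂ w).contDiff.comp ha
  have hgc : ∀ w : Fin k → Cn n, HasCompactSupport fun y => a y w := fun w =>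
    hc.comp_left (g := fun b : Alt n k => b w) rfl
  have hint : ∀ (u : Cn n) (w : Fin k → Cn n), Integrable fun y => fderiv ℝ (fun y => a y w) y u := by
    intro u w
    have hd : Continuous fun y => fderiv ℝ (fun y => a y w) y u :=
      ((hg w).continuous_fderiv (by simp)).clm_apply continuous_const
    exact hd.integrable_of_hasCompactSupport ((hgc w).fderiv_apply (𝕜 := ℝ) u)
  have hexp : ∀ y, dolb ε a y v = ∑ i : Fin (k + 1), (((1 : ℂ) / 2) * (-1) ^ (i : ℕ)) *
      (fderiv ℝ (fun y => a y (i.removeNth v)) y (v i) +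
        ε * fderiv ℝ (fun y => a y (i.removeNth v)) y (Complex.I • v i)) := by
    intro y
    rw [dolb, extDeriv, extDerivI, ContinuousAlternatingMap.smul_apply,
      ContinuousAlternatingMap.add_apply, ContinuousAlternatingMap.smul_apply,
      ContinuousAlternatingMap.alternatizeUncurryFin_apply,
      ContinuousAlternatingMap.alternatizeUncurryFin_apply, smul_eq_mul, smul_eq_mul, Finset.mul_sum,
      ← Finset.sum_add_distrib, Finset.mul_sum]
    refine Finset.sum_congr rfl fun i _ => ?_
    rw [ContinuousLinearMap.comp_apply, hD, hD, mulI_apply, zsmul_eq_mul, zsmul_eq_mul]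
    push_cast
    ring
  simp only [hexp]
  rw [integral_finsetSum]
  · refine Finset.sum_eq_zero fun i _ => ?_
    rw [integral_const_mul, integral_add (hint _ _) ((hint _ _).const_mul ε), integral_const_mul,
      integral_fderiv_eq_zero (hg _) (hgc _), integral_fderiv_eq_zero (hg _) (hgc _)]
    simp
  · intro i _
    exact ((hint _ _).add ((hint _ _).const_mul ε)).const_mul _

end Alt
end

/-! ### From `ℂⁿ` to the manifold: independence of the chart. -/

noncomputable section
open Filter Topology

namespace DForm

variable {X : Type*} {n : ℕ} [TopologicalSpace X] [ChartedSpace (Cn n) X]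

/-- The operator `∂` for `ε = -i` and `∂̄` for `ε = i`. -/
def dolb (ε : ℂ) {k : ℕ} (a : DForm X n k) : DForm X n (k + 1) := fun x =>
  atPoint x (Alt.dolb ε (inChart (chartAt (Cn n) x) a) (chartAt (Cn n) x x))

theorem del_eq_dolb {k : ℕ} (a : DForm X n k) : del a = dolb (-Complex.I) a :=
  funext fun x => congrArg (atPoint x) (Alt.del_eq_dolb _ _)

theorem delbar_eq_dolb {k : ℕ} (a : DForm X n k) : delbar a = dolb Complex.I a :=
  funext fun x => congrArg (atPoint x) (Alt.delbar_eq_dolb _ _)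

theorem inChart_eq_pull {k : ℕ} (e : OpenPartialHomeomorph X (Cn n)) (a : DForm X n k) (y : Cn n) :
    inChart e a y = Alt.pull ((chartSymmDeriv e y).restrictScalars ℝ) (a (e.symm y)) := rfl

variable [IsManifold 𝓘(ℂ, Cn n) (⊤ : ℕ∞) X]

theorem mdifferentiable_of_mem_atlas {e : OpenPartialHomeomorph X (Cn n)} (he : e ∈ atlas (Cn n) X) :
    e.MDifferentiable 𝓘(ℂ, Cn n) 𝓘(ℂ, Cn n) := by
  have : IsManifold 𝓘(ℂ, Cn n) 1 X := IsManifold.of_le (n := ((⊤ : ℕ∞) : WithTop ℕ∞))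
    (WithTop.coe_le_coe.mpr (le_top : (1 : ℕ∞) ≤ ⊤))
  exact _root_.mdifferentiable_of_mem_atlas he

/-- The tangent space at `x` is identified with `ℂⁿ` by the preferred chart at `x`, so that chart
has identity derivative there. Consequently `atPoint` does nothing. -/
theorem chartDeriv_chartAt (x : X) :
    chartDeriv (chartAt (Cn n) x) x = ContinuousLinearMap.id ℂ (Cn n) := by
  have : IsManifold 𝓘(ℂ, Cn n) 1 X := IsManifold.of_le (n := ((⊤ : ℕ∞) : WithTop ℕ∞))
    (WithTop.coe_le_coe.mpr (le_top : (1 : ℕ∞) ≤ ⊤))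
  ext v i
  have h := mfderiv_chartAt_eq_tangentCoordChange (I := 𝓘(ℂ, Cn n)) (x := x) (y := x)
    (mem_chart_source (Cn n) x)
  have h2 := tangentCoordChange_self (I := 𝓘(ℂ, Cn n)) (x := x) (z := x) (v := v)
    (mem_extChartAt_source x)
  have h3 : chartDeriv (chartAt (Cn n) x) x v = v :=
    (congrArg (fun L : Cn n →L[ℂ] Cn n => L v) h).trans h2
  rw [h3]
  rfl

theorem atPoint_eq {k : ℕ} (x : X) (b : Alt n k) : atPoint x b = b := by
  rw [atPoint, chartDeriv_chartAt]
  rfl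

theorem chartSymmDeriv_comp {e : OpenPartialHomeomorph X (Cn n)} (he : e ∈ atlas (Cn n) X) {x : X}
    (hx : x ∈ e.source) :
    (chartSymmDeriv e (e x)).comp (chartDeriv e x) = ContinuousLinearMap.id ℂ (Cn n) :=
  (mdifferentiable_of_mem_atlas he).symm_comp_deriv hx

theorem chartDeriv_comp {e : OpenPartialHomeomorph X (Cn n)} (he : e ∈ atlas (Cn n) X) {y : Cn n}
    (hy : y ∈ e.target) :
    (chartDeriv e (e.symm y)).comp (chartSymmDeriv e y) = ContinuousLinearMap.id ℂ (Cn n) :=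
  (mdifferentiable_of_mem_atlas he).comp_symm_deriv hy

theorem inChart_chartAt {k : ℕ} (a : DForm X n k) (x : X) :
    inChart (chartAt (Cn n) x) a (chartAt (Cn n) x x) = a x := by
  have h := chartSymmDeriv_comp (chart_mem_atlas (Cn n) x) (mem_chart_source (Cn n) x)
  rw [chartDeriv_chartAt, ContinuousLinearMap.comp_id] at h
  rw [inChart, h, (chartAt (Cn n) x).left_inv (mem_chart_source (Cn n) x)]
  rfl

/-- The derivative of an inverse chart is an isomorphism. -/
theorem exists_chartSymmDeriv_eq {e : OpenPartialHomeomorph X (Cn n)} (he : e ∈ atlas (Cn n) X)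
    {y : Cn n} (hy : y ∈ e.target) :
    ∃ L : Cn n ≃L[ℂ] Cn n, (chartSymmDeriv e y).restrictScalars ℝ = Alt.toReal L := by
  have h1 := chartDeriv_comp he hy
  have h2 := chartSymmDeriv_comp he (e.map_target hy)
  rw [e.right_inv hy] at h2
  refine ⟨ContinuousLinearEquiv.equivOfInverse (chartSymmDeriv e y) (chartDeriv e (e.symm y))
    (fun v => ?_) (fun v => ?_), ?_⟩
  · exact congrArg (fun L : Cn n →L[ℂ] Cn n => L v) h1
  · exact congrArg (fun L : Cn n →L[ℂ] Cn n => L v) h2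
  · rfl

section Transition

variable {e e' : OpenPartialHomeomorph X (Cn n)}

theorem chartSymmDeriv_transition (he : e ∈ atlas (Cn n) X) (he' : e' ∈ atlas (Cn n) X) {y : Cn n}
    (hy : y ∈ e.target) (hy' : e.symm y ∈ e'.source) :
    chartSymmDeriv e y = (chartSymmDeriv e' (e' (e.symm y))).comp (fderiv ℂ (e' ∘ e.symm) y) := by
  have hm := mdifferentiable_of_mem_atlas he
  have hm' := mdifferentiable_of_mem_atlas he'
  have h1 : MDifferentiableAt 𝓘(ℂ, Cn n) 𝓘(ℂ, Cn n) (e' ∘ e.symm) y :=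
    (hm'.mdifferentiableAt hy').comp y (hm.mdifferentiableAt_symm hy)
  have h2 := mfderiv_comp y (hm'.mdifferentiableAt_symm (e'.map_source hy')) h1
  have h3 : e'.symm ∘ (e' ∘ e.symm) =ᶠ[𝓝 y] e.symm := by
    filter_upwards [(e.symm.isOpen_inter_preimage e'.open_source).mem_nhds ⟨hy, hy'⟩] with z hz
    exact e'.left_inv hz.2
  rw [h3.mfderiv_eq, mfderiv_eq_fderiv] at h2
  exact h2

theorem contDiffOn_transition (he : e ∈ atlas (Cn n) X) (he' : e' ∈ atlas (Cn n) X) :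
    ContDiffOn ℂ (⊤ : ℕ∞) (e' ∘ e.symm) (e.target ∩ e.symm ⁻¹' e'.source) := by
  have h := (contDiffGroupoid (⊤ : ℕ∞) 𝓘(ℂ, Cn n)).compatible he he'
  rw [contDiffGroupoid, mem_groupoid_of_pregroupoid] at h
  have h1 := h.1
  simp only [contDiffPregroupoid] at h1
  simpa using h1

theorem isOpen_overlap : IsOpen (e.target ∩ e.symm ⁻¹' e'.source) :=
  e.symm.isOpen_inter_preimage e'.open_source

theorem fderiv_transition (he : e ∈ atlas (Cn n) X) (he' : e' ∈ atlas (Cn n) X) {y : Cn n}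
    (hy : y ∈ e.target ∩ e.symm ⁻¹' e'.source) :
    fderiv ℝ (e' ∘ e.symm) y = (fderiv ℂ (e' ∘ e.symm) y).restrictScalars ℝ := by
  have h : DifferentiableAt ℂ (e' ∘ e.symm) y :=
    ((contDiffOn_transition he he').contDiffAt (isOpen_overlap.mem_nhds hy)).differentiableAt (by simp)
  exact h.fderiv_restrictScalars ℝ

theorem inChart_transition (he : e ∈ atlas (Cn n) X) (he' : e' ∈ atlas (Cn n) X) {k : ℕ}
    (a : DForm X n k) {y : Cn n} (hy : y ∈ e.target ∩ e.symm ⁻¹' e'.source) :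
    inChart e a y = Alt.pull (fderiv ℝ (e' ∘ e.symm) y) (inChart e' a ((e' ∘ e.symm) y)) := by
  rw [inChart_eq_pull, inChart_eq_pull, Alt.pull_pull, fderiv_transition he he' hy,
    chartSymmDeriv_transition he he' hy.1 hy.2, Function.comp_apply, e'.left_inv hy.2]
  rfl

theorem dolb_inChart_transition (ε : ℂ) (he : e ∈ atlas (Cn n) X) (he' : e' ∈ atlas (Cn n) X) {k : ℕ}
    {a : DForm X n k} (ha : IsSmooth a) {y : Cn n} (hy : y ∈ e.target ∩ e.symm ⁻¹' e'.source) :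
    Alt.dolb ε (inChart e a) y =
      Alt.pull (fderiv ℝ (e' ∘ e.symm) y) (Alt.dolb ε (inChart e' a) ((e' ∘ e.symm) y)) := by
  have hnhds := (isOpen_overlap (e := e) (e' := e')).mem_nhds hy
  have h1 : inChart e a =ᶠ[𝓝 y]
      fun z => Alt.pull (fderiv ℝ (e' ∘ e.symm) z) (inChart e' a ((e' ∘ e.symm) z)) := by
    filter_upwards [hnhds] with z hz
    exact inChart_transition he he' a hz
  rw [Alt.dolb_congr ε h1]
  refine Alt.dolb_pullback ε ?_ ?_ ?_
  · exact Alt.differentiableAt_of_contDiffOn e'.open_target (ha e' he') (e'.map_source hy.2)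
  · exact (((contDiffOn_transition he he').contDiffAt hnhds).restrict_scalars ℝ).of_le
      (WithTop.coe_le_coe.mpr (le_top : (2 : ℕ∞) ≤ ⊤))
  · filter_upwards [hnhds] with z hz v
    rw [fderiv_transition he he' hz]
    exact map_smul (fderiv ℂ (e' ∘ e.symm) z) Complex.I v

end Transition

/-- At each point the operator is defined in the preferred chart of that point. Holomorphic
naturality carries the computation over to the fixed chart `e`. -/
theorem inChart_dolb (ε : ℂ) {e : OpenPartialHomeomorph X (Cn n)} (he : e ∈ atlas (Cn n) X) {k : ℕ}
    {a : DForm X n k} (ha : IsSmooth a) {y : Cn n} (hy : y ∈ e.target) :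
    inChart e (dolb ε a) y = Alt.dolb ε (inChart e a) y := by
  set x := e.symm y with hx
  have hc := chart_mem_atlas (Cn n) x
  have hy' : y ∈ e.target ∩ e.symm ⁻¹' (chartAt (Cn n) x).source :=
    ⟨hy, mem_chart_source (Cn n) x⟩
  rw [dolb_inChart_transition ε he hc ha hy', inChart_transition he hc _ hy', Function.comp_apply,
    ← hx, inChart_chartAt, dolb, atPoint_eq]

section Local

variable {e : OpenPartialHomeomorph X (Cn n)} {y : Cn n}

theorem inChart_wedge {k l : ℕ} (a : DForm X n k) (b : DForm X n l) :
    inChart e (wedge a b) y = Alt.wedge (inChart e a y) (inChart e b y) :=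
  Alt.pull_wedge _ _ _

theorem inChart_dpow (a : DForm X n 2) (p : ℕ) :
    inChart e (dpow a p) y = Alt.dpow (inChart e a y) p :=
  Alt.pull_dpow _ _ _

theorem inChart_star (he : e ∈ atlas (Cn n) X) (hy : y ∈ e.target) {k l : ℕ} (h : k + l = 2 * n)
    (γ : DForm X n 2) (a : DForm X n k) :
    inChart e (star h γ a) y = Alt.hodgeStar h (inChart e γ y) (inChart e a y) := by
  obtain ⟨L, hL⟩ := exists_chartSymmDeriv_eq he hy
  rw [inChart_eq_pull, inChart_eq_pull, inChart_eq_pull, hL, ← Alt.pull_hodgeStar]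
  rfl

theorem inChart_trace (he : e ∈ atlas (Cn n) X) (hy : y ∈ e.target) {k : ℕ}
    (γ : DForm X n 2) (a : DForm X n (k + 2)) :
    inChart e (trace γ a) y = Alt.trace (inChart e γ y) (inChart e a y) := by
  obtain ⟨L, hL⟩ := exists_chartSymmDeriv_eq he hy
  rw [inChart_eq_pull, inChart_eq_pull, inChart_eq_pull, hL, ← Alt.pull_trace]
  rfl

end Local

theorem IsHermitianMetric.isPositive {ω : DForm X n 2} (h : IsHermitianMetric ω) (x : X) :
    Alt.IsPositive (ω x) := ⟨h.type11 x, h.real x, h.pos x⟩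

theorem IsHermitianMetric.isPositive_inChart {ω : DForm X n 2} (h : IsHermitianMetric ω)
    {e : OpenPartialHomeomorph X (Cn n)} (he : e ∈ atlas (Cn n) X) {y : Cn n} (hy : y ∈ e.target) :
    Alt.IsPositive (inChart e ω y) := by
  obtain ⟨L, hL⟩ := exists_chartSymmDeriv_eq he hy
  rw [inChart_eq_pull, hL]
  exact (h.isPositive _).pull L

theorem jInv_inChart {k : ℕ} {a : DForm X n k} (h : ∀ x, Alt.JInv (a x))
    (e : OpenPartialHomeomorph X (Cn n)) (y : Cn n) : Alt.JInv (inChart e a y) := by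
  have h1 := h (e.symm y)
  rw [Alt.JInv] at h1
  conv_rhs at h1 => rw [← h1]
  rw [Alt.JInv, inChart_eq_pull]
  conv_rhs => rw [← h (e.symm y)]
  rw [Alt.pull_pull, Alt.pull_pull]
  congr 1
  ext v : 1
  exact map_smul (chartSymmDeriv e y) Complex.I v

namespace IsSmooth

theorem wedge {k l : ℕ} {a : DForm X n k} {b : DForm X n l} (ha : IsSmooth a) (hb : IsSmooth b) :
    IsSmooth (wedge a b) := fun e he =>
  (Alt.contDiffOn_wedge (ha e he) (hb e he)).congr fun _ _ => inChart_wedge a b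

theorem dpow {a : DForm X n 2} (ha : IsSmooth a) (p : ℕ) : IsSmooth (dpow a p) := fun e he =>
  (Alt.contDiffOn_dpow (ha e he) p).congr fun _ _ => inChart_dpow a p

theorem dolb (ε : ℂ) {k : ℕ} {a : DForm X n k} (ha : IsSmooth a) : IsSmooth (dolb ε a) :=
  fun e he => (Alt.contDiffOn_dolb ε e.open_target (ha e he)).congr
    fun _ hy => inChart_dolb ε he ha hy

theorem star {k l : ℕ} (h : k + l = 2 * n) {γ : DForm X n 2} (hγ : IsHermitianMetric γ)
    {a : DForm X n k} (ha : IsSmooth a) : IsSmooth (star h γ a) := fun e he =>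
  (Alt.contDiffOn_hodgeStar (hγ.smooth e he) (fun _ hy => hγ.isPositive_inChart he hy) h
    (ha e he)).congr fun _ hy => inChart_star he hy h γ a

theorem trace {k : ℕ} {γ : DForm X n 2} (hγ : IsHermitianMetric γ)
    {a : DForm X n (k + 2)} (ha : IsSmooth a) : IsSmooth (trace γ a) := fun e he =>
  (Alt.contDiffOn_trace (hγ.smooth e he) (fun _ hy => hγ.isPositive_inChart he hy)
    (ha e he)).congr fun _ hy => inChart_trace he hy γ a

theorem add {k : ℕ} {a b : DForm X n k} (ha : IsSmooth a) (hb : IsSmooth b) :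
    IsSmooth (fun x => a x + b x) := fun e he => (ha e he).add (hb e he)

theorem const_smul {k : ℕ} (c : ℂ) {a : DForm X n k} (ha : IsSmooth a) :
    IsSmooth (fun x => c • a x) := fun e he => Alt.contDiffOn_const_smul c (ha e he)

theorem funMul {k : ℕ} {f : DForm X n 0} {a : DForm X n k} (hf : IsSmooth f) (ha : IsSmooth a) :
    IsSmooth (funMul f a) := fun e he => by
  have h1 := Alt.contDiffOn_apply (hf e he) ![]
  have h2 : ContDiffOn ℝ (⊤ : ℕ∞) (fun y => (inChart e f y ![]) • inChart e a y) e.target :=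
    h1.smul (ha e he)
  refine h2.congr fun y _ => ?_
  have h3 : inChart e f y ![] = f (e.symm y) ![] :=
    congrArg (f (e.symm y)) (Subsingleton.elim _ _)
  rw [h3]
  rfl

end IsSmooth

end DForm
end

/-! ### Change of variables and integrability in charts. -/

noncomputable section
open Filter Topology MeasureTheory

namespace Alt

variable {n : ℕ}

/-- The coefficient of a form of top degree with respect to `dx₁ ∧ dy₁ ∧ ⋯ ∧ dx_n ∧ dy_n`. -/
def coef {k : ℕ} (h : k = 2 * n) (a : Alt n k) : ℂ := castDeg h a (frame n)

theorem coef_add {k : ℕ} (h : k = 2 * n) (a b : Alt n k) : coef h (a + b) = coef h a + coef h b :=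
  rfl

theorem coef_smul {k : ℕ} (h : k = 2 * n) (c : ℂ) (a : Alt n k) : coef h (c • a) = c * coef h a :=
  rfl

theorem alternating_comp_det (g : Cn n [⋀^Fin (2 * n)]→ₗ[ℝ] ℝ) (L : Cn n →ₗ[ℝ] Cn n) :
    g (fun i => L (frame n i)) = LinearMap.det L * g (frame n) := by
  have h0 : ⇑(frameBasis n) = frame n := funext fun i => frameBasis_apply i
  have h := g.eq_smul_basis_det (frameBasis n)
  have h1 : (frameBasis n).det (⇑L ∘ ⇑(frameBasis n)) =
      LinearMap.det L * (frameBasis n).det (frameBasis n) := (frameBasis n).det_comp L (frameBasis n)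
  rw [Module.Basis.det_self, mul_one, h0] at h1
  have h2 : (fun i => L (frame n i)) = ⇑L ∘ frame n := rfl
  conv_lhs => rw [h]
  rw [AlternatingMap.smul_apply, h2, h1, h0, smul_eq_mul, mul_comm]

theorem coef_pull {k : ℕ} (h : k = 2 * n) (L : Cn n →L[ℝ] Cn n) (a : Alt n k) :
    coef h (pull L a) = (L.det : ℂ) * coef h a := by
  subst h
  have h1 := alternating_comp_det
    (Complex.reLm.compAlternatingMap a.toAlternatingMap) (L : Cn n →ₗ[ℝ] Cn n)
  have h2 := alternating_comp_det
    (Complex.imLm.compAlternatingMap a.toAlternatingMap) (L : Cn n →ₗ[ℝ] Cn n)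
  apply Complex.ext
  · rw [Complex.re_ofReal_mul]
    exact h1
  · rw [Complex.im_ofReal_mul]
    exact h2

/-- The real determinant of a complex-linear map is the squared modulus of its complex determinant.
Holomorphic transition maps thus preserve orientation, and the absolute value in the change of
variables formula can be dropped. -/
theorem det_restrictScalars_nonneg (L : Cn n →L[ℂ] Cn n) : 0 ≤ (L.restrictScalars ℝ).det := by
  have h : (L.restrictScalars ℝ).det =
      LinearMap.det ((L : Cn n →ₗ[ℂ] Cn n).restrictScalars ℝ) := rfl
  rw [h, LinearMap.det_restrictScalars, Algebra.norm_complex_apply]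
  exact Complex.normSq_nonneg _

theorem contDiffOn_coef {k : ℕ} (h : k = 2 * n) {a : Cn n → Alt n k} {U : Set (Cn n)}
    (ha : ContDiffOn ℝ (⊤ : ℕ∞) a U) : ContDiffOn ℝ (⊤ : ℕ∞) (fun y => coef h (a y)) U :=
  contDiffOn_apply (contDiffOn_castDeg h ha) _

end Alt

namespace DForm

variable {X : Type*} {n : ℕ} [TopologicalSpace X] [ChartedSpace (Cn n) X]
  [IsManifold 𝓘(ℂ, Cn n) (⊤ : ℕ∞) X]

/-- Change of variables for a density `χ b` supported in the domains of two charts. -/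
theorem setIntegral_inChart {e e' : OpenPartialHomeomorph X (Cn n)} (he : e ∈ atlas (Cn n) X)
    (he' : e' ∈ atlas (Cn n) X) {k : ℕ} (h : k = 2 * n) (χ : X → ℝ) (b : DForm X n k)
    (h1 : ∀ y ∈ e.target, e.symm y ∉ e'.source →
      ((χ (e.symm y) : ℝ) : ℂ) * Alt.coef h (inChart e b y) = 0)
    (h2 : ∀ y ∈ e'.target, e'.symm y ∉ e.source →
      ((χ (e'.symm y) : ℝ) : ℂ) * Alt.coef h (inChart e' b y) = 0) :
    ∫ y in e.target, ((χ (e.symm y) : ℝ) : ℂ) * Alt.coef h (inChart e b y) =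
      ∫ y in e'.target, ((χ (e'.symm y) : ℝ) : ℂ) * Alt.coef h (inChart e' b y) := by
  have hopen := isOpen_overlap (e := e) (e' := e')
  have himage : (e' ∘ e.symm) '' (e.target ∩ e.symm ⁻¹' e'.source) =
      e'.target ∩ e'.symm ⁻¹' e.source := by
    ext z
    constructor
    · rintro ⟨y, hy, rfl⟩
      refine ⟨e'.map_source hy.2, ?_⟩
      change e'.symm (e' (e.symm y)) ∈ e.source
      rw [e'.left_inv hy.2]
      exact e.map_target hy.1
    · intro hz
      refine ⟨e (e'.symm z), ⟨e.map_source hz.2, ?_⟩, ?_⟩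
      · change e.symm (e (e'.symm z)) ∈ e'.source
        rw [e.left_inv hz.2]
        exact e'.map_target hz.1
      · rw [Function.comp_apply, e.left_inv hz.2, e'.right_inv hz.1]
  have hinj : Set.InjOn (e' ∘ e.symm) (e.target ∩ e.symm ⁻¹' e'.source) := by
    intro y hy z hz hyz
    have h3 := e'.injOn hy.2 hz.2 hyz
    exact e.symm.injOn hy.1 hz.1 h3
  have hderiv : ∀ y ∈ e.target ∩ e.symm ⁻¹' e'.source, HasFDerivWithinAt (e' ∘ e.symm)
      (fderiv ℝ (e' ∘ e.symm) y) (e.target ∩ e.symm ⁻¹' e'.source) y := by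
    intro y hy
    have h3 : ContDiffAt ℝ (⊤ : ℕ∞) (e' ∘ e.symm) y :=
      ((contDiffOn_transition he he').contDiffAt (hopen.mem_nhds hy)).restrict_scalars ℝ
    exact (h3.differentiableAt (by simp)).hasFDerivAt.hasFDerivWithinAt
  rw [setIntegral_eq_of_subset_of_forall_sdiff_eq_zero e.open_target.measurableSet
      (Set.inter_subset_left (t := e.symm ⁻¹' e'.source))
      (fun y hy => h1 y hy.1 fun h3 => hy.2 ⟨hy.1, h3⟩),
    setIntegral_eq_of_subset_of_forall_sdiff_eq_zero e'.open_target.measurableSet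
      (Set.inter_subset_left (t := e'.symm ⁻¹' e.source))
      (fun y hy => h2 y hy.1 fun h3 => hy.2 ⟨hy.1, h3⟩),
    ← himage, integral_image_eq_integral_abs_det_fderiv_smul volume hopen.measurableSet hderiv hinj]
  refine setIntegral_congr_fun hopen.measurableSet fun y hy => ?_
  have h3 : e'.symm ((e' ∘ e.symm) y) = e.symm y := e'.left_inv hy.2
  have h4 : 0 ≤ (fderiv ℝ (e' ∘ e.symm) y).det := by
    rw [fderiv_transition he he' hy]
    exact Alt.det_restrictScalars_nonneg _
  change _ = |(fderiv ℝ (e' ∘ e.symm) y).det| •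
    (((χ (e'.symm ((e' ∘ e.symm) y)) : ℝ) : ℂ) * Alt.coef h (inChart e' b ((e' ∘ e.symm) y)))
  rw [h3, abs_of_nonneg h4, inChart_transition he he' b hy, Alt.coef_pull, Complex.real_smul]
  ring

/-- The product of a real function with a form. -/
def realMul {k : ℕ} (χ : X → ℝ) (a : DForm X n k) : DForm X n k := fun x => ((χ x : ℝ) : ℂ) • a x

theorem inChart_realMul {k : ℕ} (e : OpenPartialHomeomorph X (Cn n)) (χ : X → ℝ) (a : DForm X n k)
    (y : Cn n) : inChart e (realMul χ a) y = ((χ (e.symm y) : ℝ) : ℂ) • inChart e a y := rfl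

theorem contDiffOn_comp_chart {χ : X → ℝ} (hχ : ContMDiff 𝓘(ℝ, Cn n) 𝓘(ℝ, ℝ) (⊤ : ℕ∞) χ)
    {e : OpenPartialHomeomorph X (Cn n)} (he : e ∈ atlas (Cn n) X) :
    ContDiffOn ℝ (⊤ : ℕ∞) (fun y => χ (e.symm y)) e.target := by
  have := isManifold_real X (n := n)
  have h := contMDiffOn_symm_of_mem_maximalAtlas (I := 𝓘(ℝ, Cn n)) (n := ((⊤ : ℕ∞) : WithTop ℕ∞))
    (IsManifold.subset_maximalAtlas he)
  have h2 := hχ.comp_contMDiffOn h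
  exact h2.contDiffOn

theorem IsSmooth.realMul {k : ℕ} {χ : X → ℝ} (hχ : ContMDiff 𝓘(ℝ, Cn n) 𝓘(ℝ, ℝ) (⊤ : ℕ∞) χ)
    {a : DForm X n k} (ha : IsSmooth a) : IsSmooth (realMul χ a) := fun e he =>
  ContDiffOn.smul (Complex.ofRealCLM.contDiff.comp_contDiffOn (contDiffOn_comp_chart hχ he))
    (ha e he)

/-- Compactness of `X` makes the support of `χ` compact, so `g` is continuous on a compact subset of
the target and zero on the rest of it. Behaviour of `g` near the boundary of the chart is
irrelevant. -/
theorem integrableOn_target [T2Space X] [CompactSpace X] {e : OpenPartialHomeomorph X (Cn n)} {χ : X → ℝ}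
    (hs : tsupport χ ⊆ e.source) {g : Cn n → ℂ} (hg : ContinuousOn g e.target)
    (h0 : ∀ y ∈ e.target, e.symm y ∉ tsupport χ → g y = 0) : IntegrableOn g e.target := by
  have hK : IsCompact (e '' tsupport χ) :=
    (isClosed_tsupport χ).isCompact.image_of_continuousOn (e.continuousOn.mono hs)
  have hKs : e '' tsupport χ ⊆ e.target := by
    rintro _ ⟨x, hx, rfl⟩
    exact e.map_source (hs hx)
  refine ((hg.mono hKs).integrableOn_compact hK).of_forall_sdiff_eq_zero
    e.open_target.measurableSet fun y hy => h0 y hy.1 fun h => hy.2 ⟨_, h, e.right_inv hy.1⟩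

end DForm
end

/-! ### Linearity of the integral and Stokes' theorem on the compact manifold. -/

noncomputable section
open Filter Topology MeasureTheory

namespace Alt

variable {n : ℕ}

theorem zero_smul_alt {k : ℕ} (a : Alt n k) : (0 : ℂ) • a = 0 := zero_smul ℂ a

theorem dolb_zero (ε : ℂ) {k : ℕ} (y : Cn n) : dolb ε (fun _ => (0 : Alt n k)) y = 0 := by
  have h := dolb_const_smul ε 0 (differentiableAt_const (x := y) (0 : Alt n k))
  simp only [zero_smul_alt] at h
  exact h

theorem sum_smul_alt {k : ℕ} {ι : Type*} (s : Finset ι) (c : ι → ℂ) (a : Alt n k) :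
    ∑ i ∈ s, c i • a = (∑ i ∈ s, c i) • a := (Finset.sum_smul (f := c) (x := a)).symm

theorem one_smul_alt {k : ℕ} (a : Alt n k) : (1 : ℂ) • a = a := one_smul ℂ a

end Alt

namespace DForm

variable {X : Type*} {n : ℕ} [TopologicalSpace X] [ChartedSpace (Cn n) X]
  [IsManifold 𝓘(ℂ, Cn n) (⊤ : ℕ∞) X]

theorem dolb_add (ε : ℂ) {k : ℕ} {a b : DForm X n k} (ha : IsSmooth a) (hb : IsSmooth b) :
    dolb ε (fun x => a x + b x) = fun x => dolb ε a x + dolb ε b x := by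
  funext x
  have hc := chart_mem_atlas (Cn n) x
  have hx := mem_chart_target (Cn n) x
  rw [dolb, dolb, dolb, atPoint_eq, atPoint_eq, atPoint_eq, ← Alt.dolb_add ε
    (Alt.differentiableAt_of_contDiffOn (chartAt (Cn n) x).open_target (ha _ hc) hx)
    (Alt.differentiableAt_of_contDiffOn (chartAt (Cn n) x).open_target (hb _ hc) hx)]
  rfl

theorem dolb_const_smul (ε : ℂ) {k : ℕ} (c : ℂ) {a : DForm X n k} (ha : IsSmooth a) :
    dolb ε (fun x => c • a x) = fun x => c • dolb ε a x := by
  funext x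
  have hc := chart_mem_atlas (Cn n) x
  have hx := mem_chart_target (Cn n) x
  rw [dolb, dolb, atPoint_eq, atPoint_eq, ← Alt.dolb_const_smul ε c
    (Alt.differentiableAt_of_contDiffOn (chartAt (Cn n) x).open_target (ha _ hc) hx)]
  rfl

theorem isSmooth_zero {k : ℕ} : IsSmooth (fun _ => 0 : DForm X n k) := fun _ _ =>
  contDiffOn_const (c := (0 : Alt n k))

theorem dolb_zero (ε : ℂ) {k : ℕ} : dolb ε (fun _ => 0 : DForm X n k) = fun _ => 0 := by
  have h := dolb_const_smul ε 0 (isSmooth_zero (X := X) (n := n) (k := k))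
  simp only [Alt.zero_smul_alt] at h
  exact h

variable [T2Space X] [CompactSpace X]

theorem tsupport_chartPartition (x : X) :
    tsupport (chartPartition X (n := n) x) ⊆ (chartAt (Cn n) x).source := by
  have := isManifold_real X (n := n)
  exact (SmoothPartitionOfUnity.exists_isSubordinate_chartAt_source 𝓘(ℝ, Cn n) X).choose_spec x

variable (X n) in
/-- The finitely many indices at which the partition of unity does not vanish. -/
def chartIndices : Finset X :=
  ((chartPartition X (n := n)).locallyFinite.finite_nonempty_of_compact).toFinset

theorem chartPartition_eq_zero {x : X} (hx : x ∉ chartIndices X n) (z : X) :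
    chartPartition X (n := n) x z = 0 := by
  by_contra h
  exact hx ((Set.Finite.mem_toFinset _).mpr ⟨z, h⟩)

theorem sum_chartPartition (z : X) : ∑ x ∈ chartIndices X n, chartPartition X (n := n) x z = 1 := by
  rw [← (chartPartition X (n := n)).sum_eq_one (Set.mem_univ z)]
  refine (finsum_eq_sum_of_support_subset _ fun x hx => ?_).symm
  by_contra h
  exact hx (chartPartition_eq_zero h z)

theorem integral_eq_sum {k : ℕ} (h : k = 2 * n) (a : DForm X n k) :
    integral h a = ∑ x ∈ chartIndices X n, ∫ y in (chartAt (Cn n) x).target,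
      ((chartPartition X (n := n) x ((chartAt (Cn n) x).symm y) : ℝ) : ℂ) *
        Alt.coef h (inChart (chartAt (Cn n) x) a y) := by
  refine finsum_eq_sum_of_support_subset _ fun x hx => ?_
  by_contra h0
  apply hx
  simp only [chartPartition_eq_zero h0, Complex.ofReal_zero, zero_mul, integral_zero]

theorem integrableOn_chartPartition {k : ℕ} (h : k = 2 * n) {a : DForm X n k} (ha : IsSmooth a)
    (x : X) : IntegrableOn (fun y =>
      ((chartPartition X (n := n) x ((chartAt (Cn n) x).symm y) : ℝ) : ℂ) *
        Alt.coef h (inChart (chartAt (Cn n) x) a y)) (chartAt (Cn n) x).target := by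
  have hc := chart_mem_atlas (Cn n) x
  refine integrableOn_target (tsupport_chartPartition (n := n) x) ?_ ?_
  · exact (Complex.continuous_ofReal.comp_continuousOn
      (contDiffOn_comp_chart (chartPartition X (n := n) x).contMDiff hc).continuousOn).mul
      (Alt.contDiffOn_coef h (ha _ hc)).continuousOn
  · intro y _ hy
    rw [image_eq_zero_of_notMem_tsupport hy, Complex.ofReal_zero, zero_mul]

theorem integral_add {k : ℕ} (h : k = 2 * n) {a b : DForm X n k} (ha : IsSmooth a)
    (hb : IsSmooth b) : integral h (fun x => a x + b x) = integral h a + integral h b := by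
  rw [integral_eq_sum, integral_eq_sum, integral_eq_sum, ← Finset.sum_add_distrib]
  refine Finset.sum_congr rfl fun x _ => ?_
  rw [← MeasureTheory.integral_add (integrableOn_chartPartition h ha x)
    (integrableOn_chartPartition h hb x)]
  refine integral_congr_ae (Eventually.of_forall fun y => ?_)
  simp only
  rw [← mul_add, ← Alt.coef_add]
  rfl

theorem integral_const_smul {k : ℕ} (h : k = 2 * n) (c : ℂ) (a : DForm X n k) :
    integral h (fun x => c • a x) = c * integral h a := by
  rw [integral_eq_sum, integral_eq_sum, Finset.mul_sum]
  refine Finset.sum_congr rfl fun x _ => ?_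
  rw [← integral_const_mul]
  refine integral_congr_ae (Eventually.of_forall fun y => ?_)
  simp only
  rw [mul_left_comm, ← Alt.coef_smul]
  rfl

/-- The comparison is made in the exterior algebra, so the two integrands may have differently
written degrees. -/
theorem integral_congr {k k' : ℕ} (h : k = 2 * n) (h' : k' = 2 * n) {a : DForm X n k}
    {b : DForm X n k'} (hab : ∀ x, Alt.toExt (a x) = Alt.toExt (b x)) :
    integral h a = integral h' b := by
  rw [integral_eq_sum, integral_eq_sum]
  refine Finset.sum_congr rfl fun x _ => ?_
  refine integral_congr_ae (Eventually.of_forall fun y => ?_)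
  refine congrArg _ ?_
  have h1 : Alt.toExt (inChart (chartAt (Cn n) x) a y) =
      Alt.toExt (inChart (chartAt (Cn n) x) b y) := by
    rw [inChart_eq_pull, inChart_eq_pull, Alt.toExt_pull, Alt.toExt_pull, hab]
  exact congrArg (fun c : Alt n (2 * n) => c (Alt.frame n)) (Alt.castDeg_eq_of_toExt_eq h h' h1)

theorem integral_zero {k : ℕ} (h : k = 2 * n) : integral h (fun _ => 0 : DForm X n k) = 0 := by
  have h1 := integral_const_smul h 0 (fun _ => 0 : DForm X n k)
  rw [zero_mul] at h1
  rw [← h1]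
  simp only [Alt.zero_smul_alt]

section Stokes

variable {e : OpenPartialHomeomorph X (Cn n)} {χ : X → ℝ}

theorem inChart_realMul_eventuallyEq {k : ℕ} (a : DForm X n k) {y : Cn n} (hy : y ∈ e.target)
    (h : e.symm y ∉ tsupport χ) : inChart e (realMul χ a) =ᶠ[𝓝 y] fun _ => 0 := by
  filter_upwards [(e.symm.isOpen_inter_preimage (isClosed_tsupport χ).isOpen_compl).mem_nhds
    ⟨hy, h⟩] with z hz
  rw [inChart_realMul, image_eq_zero_of_notMem_tsupport hz.2, Complex.ofReal_zero, Alt.zero_smul_alt]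

theorem dolb_realMul_eq_zero (ε : ℂ) {k : ℕ} (a : DForm X n k) {y : Cn n} (hy : y ∈ e.target)
    (h : e.symm y ∉ tsupport χ) : Alt.dolb ε (inChart e (realMul χ a)) y = 0 := by
  rw [Alt.dolb_congr ε (inChart_realMul_eventuallyEq a hy h), Alt.dolb_zero]

theorem setIntegral_dolb_realMul (ε : ℂ) (he : e ∈ atlas (Cn n) X)
    (hχ : ContMDiff 𝓘(ℝ, Cn n) 𝓘(ℝ, ℝ) (⊤ : ℕ∞) χ) (hs : tsupport χ ⊆ e.source) {k : ℕ}
    (h : k + 1 = 2 * n) {a : DForm X n k} (ha : IsSmooth a) :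
    ∫ y in e.target, Alt.coef h (Alt.dolb ε (inChart e (realMul χ a)) y) = 0 := by
  classical
  -- Extension by zero gives a smooth compactly supported form on all of `ℂⁿ`: off the compact image
  -- of the support of `χ` it vanishes, and on that image it agrees locally with the chart
  -- expression.
  set b : Cn n → Alt n k := e.target.indicator (inChart e (realMul χ a)) with hb
  set K : Set (Cn n) := e '' tsupport χ with hKdef
  have hK : IsCompact K :=
    (isClosed_tsupport χ).isCompact.image_of_continuousOn (e.continuousOn.mono hs)
  have hKs : K ⊆ e.target := by
    rintro _ ⟨x, hx, rfl⟩
    exact e.map_source (hs hx)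
  have hoff : ∀ y ∈ e.target, y ∉ K → e.symm y ∉ tsupport χ := fun y hy hyK h =>
    hyK ⟨_, h, e.right_inv hy⟩
  have hbK : ∀ y, y ∉ K → b y = 0 := by
    intro y hy
    by_cases hyt : y ∈ e.target
    · rw [hb, Set.indicator_of_mem hyt]
      exact (inChart_realMul_eventuallyEq a hyt (hoff y hyt hy)).self_of_nhds
    · exact Set.indicator_of_notMem hyt _
  have heq : ∀ y ∈ e.target, b =ᶠ[𝓝 y] inChart e (realMul χ a) := fun y hy => by
    filter_upwards [e.open_target.mem_nhds hy] with z hz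
    exact Set.indicator_of_mem hz _
  have heq0 : ∀ y, y ∉ K → b =ᶠ[𝓝 y] fun _ => 0 := fun y hy => by
    filter_upwards [hK.isClosed.isOpen_compl.mem_nhds hy] with z hz
    exact hbK z hz
  have hsm : ContDiff ℝ (⊤ : ℕ∞) b := by
    rw [contDiff_iff_contDiffAt]
    intro y
    by_cases hy : y ∈ K
    · exact ((ha.realMul hχ e he).contDiffAt (e.open_target.mem_nhds (hKs hy))).congr_of_eventuallyEq
        (heq y (hKs hy))
    · exact contDiffAt_const.congr_of_eventuallyEq (heq0 y hy)
  have hcs : HasCompactSupport b := HasCompactSupport.intro hK fun y hy => hbK y hy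
  have h0 := Alt.integral_dolb_eq_zero ε hsm hcs fun i => Alt.frame n (finCongr h i)
  have h1 : ∀ y ∉ e.target, Alt.dolb ε b y (fun i => Alt.frame n (finCongr h i)) = 0 := by
    intro y hy
    rw [Alt.dolb_congr ε (heq0 y fun h => hy (hKs h)), Alt.dolb_zero]
    rfl
  rw [← setIntegral_eq_integral_of_forall_compl_eq_zero h1] at h0
  rw [← h0]
  refine setIntegral_congr_fun e.open_target.measurableSet fun y hy => ?_
  rw [Alt.dolb_congr ε (heq y hy)]
  rfl

end Stokes

/-- Since `χ_j a` is supported in the chart at `j`, every term of the integral can be moved to that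
chart. There the functions `χ_i` sum to `1`, and Stokes on `ℂⁿ` applies. -/
theorem integral_dolb_chartPartition (ε : ℂ) {k : ℕ} (h : k + 1 = 2 * n) {a : DForm X n k}
    (ha : IsSmooth a) (j : X) :
    integral h (dolb ε (realMul (chartPartition X (n := n) j) a)) = 0 := by
  set χ := chartPartition X (n := n) with hχ
  have hc := chart_mem_atlas (Cn n) j
  have hsm : IsSmooth (realMul (χ j) a) := ha.realMul (χ j).contMDiff
  have hsupp : tsupport (χ j) ⊆ (chartAt (Cn n) j).source := tsupport_chartPartition j
  have h1 : ∀ i, ∫ y in (chartAt (Cn n) i).target, ((χ i ((chartAt (Cn n) i).symm y) : ℝ) : ℂ) *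
        Alt.coef h (inChart (chartAt (Cn n) i) (dolb ε (realMul (χ j) a)) y) =
      ∫ y in (chartAt (Cn n) j).target, ((χ i ((chartAt (Cn n) j).symm y) : ℝ) : ℂ) *
        Alt.coef h (inChart (chartAt (Cn n) j) (dolb ε (realMul (χ j) a)) y) := by
    intro i
    have hci := chart_mem_atlas (Cn n) i
    refine setIntegral_inChart hci hc h (χ i) _ ?_ ?_
    · intro y hy hy'
      rw [inChart_dolb ε hci hsm hy, dolb_realMul_eq_zero ε a hy fun h => hy' (hsupp h)]
      exact mul_zero _
    · intro y _ hy'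
      rw [image_eq_zero_of_notMem_tsupport fun h => hy' (tsupport_chartPartition i h),
        Complex.ofReal_zero, zero_mul]
  rw [integral_eq_sum, Finset.sum_congr rfl fun i _ => h1 i, ← integral_finsetSum]
  · rw [← setIntegral_dolb_realMul ε hc (χ j).contMDiff hsupp h ha]
    refine setIntegral_congr_fun (chartAt (Cn n) j).open_target.measurableSet fun y hy => ?_
    change ∑ i ∈ chartIndices X n, ((χ i ((chartAt (Cn n) j).symm y) : ℝ) : ℂ) *
        Alt.coef h (inChart (chartAt (Cn n) j) (dolb ε (realMul (χ j) a)) y) = _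
    rw [← Finset.sum_mul, ← Complex.ofReal_sum, sum_chartPartition, Complex.ofReal_one, one_mul,
      inChart_dolb ε hc hsm hy]
  · intro i _
    refine integrableOn_target hsupp ?_ ?_
    · exact (Complex.continuous_ofReal.comp_continuousOn
        (contDiffOn_comp_chart (χ i).contMDiff hc).continuousOn).mul
        (Alt.contDiffOn_coef h (hsm.dolb ε _ hc)).continuousOn
    · intro y hy hy'
      rw [inChart_dolb ε hc hsm hy, dolb_realMul_eq_zero ε a hy hy']
      exact mul_zero _

/-- Stokes' theorem for `∂` and `∂̄` on a compact complex manifold. -/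
theorem integral_dolb (ε : ℂ) {k : ℕ} (h : k + 1 = 2 * n) {a : DForm X n k} (ha : IsSmooth a) :
    integral h (dolb ε a) = 0 := by
  classical
  have key : ∀ T : Finset X,
      IsSmooth (fun x => ∑ j ∈ T, realMul (chartPartition X (n := n) j) a x) ∧
      integral h (dolb ε fun x => ∑ j ∈ T, realMul (chartPartition X (n := n) j) a x) = 0 := by
    intro T
    induction T using Finset.induction_on with
    | empty =>
      simp only [Finset.sum_empty]
      exact ⟨isSmooth_zero, by rw [dolb_zero, integral_zero]⟩
    | insert j T hj ih =>
      have hsm : IsSmooth (realMul (chartPartition X (n := n) j) a) :=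
        ha.realMul (chartPartition X (n := n) j).contMDiff
      simp only [Finset.sum_insert hj]
      refine ⟨hsm.add ih.1, ?_⟩
      rw [dolb_add ε hsm ih.1, integral_add h (hsm.dolb ε) (ih.1.dolb ε), ih.2,
        integral_dolb_chartPartition ε h ha j, add_zero]
  have h1 : a = fun x => ∑ j ∈ chartIndices X n, realMul (chartPartition X (n := n) j) a x := by
    funext x
    have h2 := sum_chartPartition (n := n) x
    simp only [realMul]
    rw [Alt.sum_smul_alt, ← Complex.ofReal_sum, h2, Complex.ofReal_one, Alt.one_smul_alt]
  rw [h1]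
  exact (key _).2

end DForm
end

/-! ### Integration by parts, powers of the metric, and the balanced condition. -/

noncomputable section
open Filter Topology

namespace Alt

variable {n : ℕ}

theorem toExt_dpow_mul_comm (a : Alt n 2) (p : ℕ) {k : ℕ} (b : Alt n k) :
    toExt (dpow a p) * toExt b = toExt b * toExt (dpow a p) := by
  rw [toExt_mul_comm, mul_assoc, pow_mul, neg_one_sq, one_pow]
  exact one_smul ℂ _

/-- The Hodge star operator on forms of top degree is division by the volume form. -/
theorem toExt_hodgeStar_top_mul {γ : Alt n 2} (hγ : IsPositive γ) {k : ℕ} (h : k + 0 = 2 * n)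
    (b : Alt n k) : toExt (hodgeStar h γ b) * toExt (dpow γ n) = toExt b := by
  have h1 := toExt_mul_hodgeStar_comm hγ.type11 h (castDeg h.symm (dpow γ n)) b
  rw [toExt_castDeg] at h1
  rw [← toExt_dpow_mul_comm, h1, toExt_hodgeStar, toExt_castDeg, sharp_dpow_dpow hγ (Nat.add_zero n),
    toExt_dpow_zero, mul_one]

/-- `⋆(γ ∧ v)` is divisible by `γ_{n-2}` for every `1`-form `v`. -/
theorem exists_hodgeStar_wedge_eq {γ : Alt n 2} (hγ : IsPositive γ) (hn : 2 ≤ n) (v : Alt n 1) {l : ℕ}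
    (h : 2 + 1 + l = 2 * n) :
    ∃ ξ : Ext n, toExt (hodgeStar h γ (wedge γ v)) = ξ * toExt (dpow γ (n - 2)) := by
  obtain ⟨m, rfl⟩ : ∃ m, n = m + 2 := ⟨n - 2, by omega⟩
  have h1 := sharp_dpow_dpow hγ (show 1 + (m + 1) = m + 2 by omega)
  rw [toExt_dpow_one] at h1
  refine ⟨∑ p, v ![frame (m + 2) p] • jcov p, ?_⟩
  rw [toExt_hodgeStar, toExt_wedge, sharp_mul, h1, toExt_one, map_sum, LinearMap.sum_apply,
    Finset.sum_mul]
  refine Finset.sum_congr rfl fun p _ => ?_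
  rw [map_smul, LinearMap.smul_apply, sharp_cov, conG_dpow_succ hγ, smul_mul_assoc,
    jcov_commute_dpow]
  rfl

end Alt

namespace DForm

variable {X : Type*} {n : ℕ} [TopologicalSpace X] [ChartedSpace (Cn n) X]
  [IsManifold 𝓘(ℂ, Cn n) (⊤ : ℕ∞) X]

theorem IsSmooth.differentiableAt {k : ℕ} {a : DForm X n k} (ha : IsSmooth a) (x : X) :
    DifferentiableAt ℝ (inChart (chartAt (Cn n) x) a) (chartAt (Cn n) x x) :=
  Alt.differentiableAt_of_contDiffOn (chartAt (Cn n) x).open_target (ha _ (chart_mem_atlas _ x))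
    (mem_chart_target _ x)

theorem toExt_dolb_wedge (ε : ℂ) {k l : ℕ} {a : DForm X n k} {b : DForm X n l} (ha : IsSmooth a)
    (hb : IsSmooth b) (x : X) : Alt.toExt (dolb ε (wedge a b) x) =
      Alt.toExt (dolb ε a x) * Alt.toExt (b x) +
        (-1 : ℂ) ^ k • (Alt.toExt (a x) * Alt.toExt (dolb ε b x)) := by
  have h1 : inChart (chartAt (Cn n) x) (wedge a b) = fun y =>
      Alt.wedge (inChart (chartAt (Cn n) x) a y) (inChart (chartAt (Cn n) x) b y) :=
    funext fun y => inChart_wedge a b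
  have h2 := Alt.toExt_dolb_wedge ε (ha.differentiableAt x) (hb.differentiableAt x)
  rw [inChart_chartAt, inChart_chartAt] at h2
  rw [dolb, dolb, dolb, atPoint_eq, atPoint_eq, atPoint_eq, h1, h2]

theorem dolb_anticomm (ε : ℂ) {k : ℕ} {a : DForm X n k} (ha : IsSmooth a) (x : X) :
    dolb ε (dolb (-ε) a) x = -dolb (-ε) (dolb ε a) x := by
  have hc := chart_mem_atlas (Cn n) x
  have hx := mem_chart_target (Cn n) x
  have h1 : ∀ ε' : ℂ, Alt.dolb (-ε') (inChart (chartAt (Cn n) x) (dolb ε' a)) (chartAt (Cn n) x x) =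
      Alt.dolb (-ε') (Alt.dolb ε' (inChart (chartAt (Cn n) x) a)) (chartAt (Cn n) x x) := by
    intro ε'
    refine Alt.dolb_congr _ ?_
    filter_upwards [(chartAt (Cn n) x).open_target.mem_nhds hx] with y hy
    exact inChart_dolb ε' hc ha hy
  have h2 := h1 (-ε)
  rw [neg_neg] at h2
  rw [dolb, dolb, atPoint_eq, atPoint_eq, h2, h1,
    Alt.dolb_anticomm ε (chartAt (Cn n) x).open_target (ha _ hc) hx]

theorem iddbar_eq {k : ℕ} (a : DForm X n k) :
    iddbar a = fun x => Complex.I • dolb (-Complex.I) (dolb Complex.I a) x := by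
  funext x
  rw [iddbar, delbar_eq_dolb, del_eq_dolb]

theorem IsSmooth.iddbar {k : ℕ} {a : DForm X n k} (ha : IsSmooth a) : IsSmooth (iddbar a) := by
  rw [iddbar_eq]
  exact ((ha.dolb _).dolb _).const_smul _

theorem jInv_iddbar {k : ℕ} {a : DForm X n k} (ha : IsSmooth a) (hJ : ∀ x, Alt.JInv (a x)) (x : X) :
    Alt.JInv (iddbar a x) := by
  have hc := chart_mem_atlas (Cn n) x
  have hx := mem_chart_target (Cn n) x
  have h := Alt.dolb_jInv_jInv (ε := -Complex.I) (by simp) (chartAt (Cn n) x).open_target (ha _ hc)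
    (fun y _ => jInv_inChart hJ _ y) hx
  rw [neg_neg] at h
  have h1 : dolb (-Complex.I) (dolb Complex.I a) x = Alt.dolb (-Complex.I)
      (Alt.dolb Complex.I (inChart (chartAt (Cn n) x) a)) (chartAt (Cn n) x x) := by
    rw [dolb, atPoint_eq]
    refine Alt.dolb_congr _ ?_
    filter_upwards [(chartAt (Cn n) x).open_target.mem_nhds hx] with y hy
    exact inChart_dolb _ hc ha hy
  rw [iddbar_eq]
  simp only
  rw [h1, Alt.JInv, Alt.pull_smul, h]

theorem IsSmooth.castDeg {k l : ℕ} (h : k = l) {a : DForm X n k} (ha : IsSmooth a) :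
    IsSmooth (fun x => Alt.castDeg h (a x)) := fun e he => Alt.contDiffOn_castDeg h (ha e he)

/-- Apply the Leibniz rule to `(p+1) ω_{p+1} = ω_p ∧ ω` and induct: divided powers absorb the
numerical factor. With `p = n - 2` this turns `ω_{n-2} ∧ ∂̄ω` into `∂̄ω_{n-1}`, zero in the balanced
case. -/
theorem succ_smul_toExt_dolb_dpow (ε : ℂ) {ω : DForm X n 2} (hω : IsSmooth ω) (p : ℕ) (x : X) :
    Alt.toExt (dolb ε (dpow ω (p + 1)) x) =
      Alt.toExt (dpow ω p x) * Alt.toExt (dolb ε ω x) := by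
  have hrec : ∀ p : ℕ, ((p : ℂ) + 1) • Alt.toExt (dolb ε (dpow ω (p + 1)) x) =
      Alt.toExt (dolb ε (dpow ω p) x) * Alt.toExt (ω x) +
        Alt.toExt (dpow ω p x) * Alt.toExt (dolb ε ω x) := by
    intro p
    have h1 : (fun x => ((p : ℂ) + 1) • dpow ω (p + 1) x) = wedge (dpow ω p) ω := by
      funext z
      apply Alt.toExt_injective
      rw [map_smul]
      exact (Alt.succ_smul_toExt_dpow (ω z) p).trans (Alt.toExt_wedge _ _).symm
    have h2 := toExt_dolb_wedge ε (hω.dpow p) hω x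
    rw [← h1, dolb_const_smul ε _ (hω.dpow (p + 1)), map_smul, pow_mul, neg_one_sq, one_pow] at h2
    rw [h2]
    exact congrArg _ (one_smul ℂ _)
  induction p with
  | zero =>
    have h1 : dpow ω (0 + 1) = ω := funext fun z => Alt.toExt_injective (Alt.toExt_dpow_one (ω z))
    rw [h1]
    exact ((congrArg (· * _) (Alt.toExt_dpow_zero (ω x))).trans (one_mul _)).symm
  | succ p ih =>
    have h1 := hrec (p + 1)
    have h2 : Alt.toExt (dpow ω p x) * Alt.toExt (ω x) =
      ((p : ℂ) + 1) • Alt.toExt (dpow ω (p + 1) x) := (Alt.succ_smul_toExt_dpow (ω x) p).symm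
    rw [ih, mul_assoc, ← Alt.toExt_commute_two, ← mul_assoc, h2, smul_mul_assoc] at h1
    have h3 : (((p + 1 : ℕ) : ℂ) + 1) • (Alt.toExt (dolb ε (dpow ω (p + 1 + 1)) x) -
        Alt.toExt (dpow ω (p + 1) x) * Alt.toExt (dolb ε ω x)) = 0 := by
      rw [smul_sub, h1]
      push_cast
      module
    exact sub_eq_zero.mp ((smul_eq_zero.mp h3).resolve_left (Nat.cast_add_one_ne_zero (p + 1)))

theorem IsHermitianMetric.dolb_dpow_eq_zero {ω : DForm X n 2} (hω : IsHermitianMetric ω)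
    (hb : IsBalanced ω) (ε : ℂ) (x : X) : dolb ε (dpow ω (n - 1)) x = 0 := by
  have hc := chart_mem_atlas (Cn n) x
  have hx := mem_chart_target (Cn n) x
  have h1 : dpow ω (n - 1) =
      fun x => (((n - 1).factorial : ℂ)⁻¹) • Alt.wedgePow (ω x) (n - 1) := by
    funext z
    apply Alt.toExt_injective
    rw [map_smul, Alt.toExt_wedgePow]
    exact Alt.toExt_dpow (ω z) (n - 1)
  have hin : ∀ e : OpenPartialHomeomorph X (Cn n), inChart e (fun x => Alt.wedgePow (ω x) (n - 1)) =
      fun y => Alt.wedgePow (inChart e ω y) (n - 1) := fun e => funext fun y => Alt.pull_wedgePow _ _ _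
  have hs : IsSmooth (fun x => Alt.wedgePow (ω x) (n - 1)) := fun e he => by
    rw [hin]
    exact Alt.contDiffOn_wedgePow (hω.smooth e he) (n - 1)
  have h2 := hb x
  rw [d, atPoint_eq] at h2
  have h3 : dolb ε (fun x => Alt.wedgePow (ω x) (n - 1)) x = 0 := by
    rw [dolb, atPoint_eq, Alt.dolb_eq_zero_of_extDeriv_eq_zero ε (chartAt (Cn n) x).open_target
      (hs _ hc) (fun y _ => jInv_inChart (fun x => Alt.JInv.wedgePow (hω.type11 x) (n - 1)) _ y) hx h2]
  rw [h1, dolb_const_smul ε _ hs]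
  exact (congrArg _ h3).trans (smul_zero (A := Alt n (2 * (n - 1) + 1)) (((n - 1).factorial : ℂ)⁻¹))

variable [T2Space X] [CompactSpace X]

theorem integral_dolb_wedge (ε : ℂ) {k l : ℕ} (h : k + 1 + l = 2 * n) (h' : k + (l + 1) = 2 * n)
    {a : DForm X n k} {b : DForm X n l} (ha : IsSmooth a) (hb : IsSmooth b) :
    integral h (wedge (dolb ε a) b) = -(-1) ^ k * integral h' (wedge a (dolb ε b)) := by
  have h0 := integral_dolb ε (show k + l + 1 = 2 * n by omega) (ha.wedge hb)
  -- The two Leibniz terms are indexed by `k + 1 + l` and `k + (l + 1)`; both are cast to degree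
  -- `2n` before the integrals are added.
  have h1 : IsSmooth (fun x => Alt.castDeg h (wedge (dolb ε a) b x)) :=
    ((ha.dolb ε).wedge hb).castDeg h
  have h2 : IsSmooth (fun x => Alt.castDeg h' (wedge a (dolb ε b) x)) :=
    (ha.wedge (hb.dolb ε)).castDeg h'
  have h3 := integral_add rfl h1 (h2.const_smul ((-1 : ℂ) ^ k))
  rw [integral_const_smul,
    integral_congr rfl h (b := wedge (dolb ε a) b) fun x => Alt.toExt_castDeg _ _,
    integral_congr rfl h' (b := wedge a (dolb ε b)) fun x => Alt.toExt_castDeg _ _,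
    integral_congr rfl (show k + l + 1 = 2 * n by omega) (b := dolb ε (wedge a b)), h0] at h3
  · linear_combination -h3
  · intro x
    rw [toExt_dolb_wedge ε ha hb, map_add, map_smul, Alt.toExt_castDeg, Alt.toExt_castDeg]
    simp only [wedge, Alt.toExt_wedge]

/-- `i∂∂̄` is symmetric on forms of even degree. -/
theorem integral_iddbar_wedge {k l m : ℕ} (hk : k = 2 * m) (h : k + 1 + 1 + l = 2 * n)
    (h' : k + (l + 1 + 1) = 2 * n) {a : DForm X n k} {b : DForm X n l} (ha : IsSmooth a)
    (hb : IsSmooth b) : integral h (wedge (iddbar a) b) = integral h' (wedge a (iddbar b)) := by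
  -- As `k` is even, the first integration by parts has sign `+` and the second `-`; anticommuting
  -- `∂̄∂` into `∂∂̄` supplies the compensating sign.
  have h1 := integral_dolb_wedge (-Complex.I) h (show k + 1 + (l + 1) = 2 * n by omega)
    (ha.dolb Complex.I) hb
  have h2 := integral_dolb_wedge Complex.I (show k + 1 + (l + 1) = 2 * n by omega) h' ha
    (hb.dolb (-Complex.I))
  have h3 : integral h (wedge (iddbar a) b) =
      Complex.I * integral h (wedge (dolb (-Complex.I) (dolb Complex.I a)) b) := by
    rw [← integral_const_smul]
    refine integral_congr h h fun x => ?_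
    rw [map_smul, iddbar_eq]
    simp only [wedge, Alt.toExt_wedge]
    rw [map_smul, smul_mul_assoc]
  have h4 : integral h' (wedge a (iddbar b)) =
      -Complex.I * integral h' (wedge a (dolb Complex.I (dolb (-Complex.I) b))) := by
    rw [← integral_const_smul]
    refine integral_congr h' h' fun x => ?_
    rw [map_smul, iddbar_eq]
    simp only [wedge, Alt.toExt_wedge]
    rw [dolb_anticomm Complex.I hb, map_smul, map_neg, mul_smul_comm, mul_neg]
    module
  have h5 : (-1 : ℂ) ^ k = 1 := by rw [hk, pow_mul, neg_one_sq, one_pow]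
  rw [h3, h4, h1, h2, pow_succ, h5]
  ring

end DForm
end

/-! ### The two integral formulas. -/

noncomputable section

namespace Alt

variable {n : ℕ}

/-- With `β = b/γ_{n-2}`, symmetry of the pairing gives `η ∧ ⋆β = β ∧ ⋆η`. Writing `⋆η` as `γ_{n-2}`
times its quotient lets `γ_{n-2}` recombine with `β` into `b`. -/
theorem toExt_mul_hodgeStar_divide {γ η : Alt n 2} (hγ : IsPositive γ) (hη : IsType11 η) (hn : 2 ≤ n)
    {k l : ℕ} (h : 2 * (n - 2) + 2 = k) (hl : 2 + l = 2 * n) (hk : 2 + k = 2 * n) {b : Alt n k}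
    (hb : JInv b) : toExt η * toExt (hodgeStar hl γ (divide h γ b)) =
      toExt b * toExt (divide h γ (hodgeStar hk γ η)) := by
  have h1 := (divide_spec hγ hn h hb).2
  have h2 := (divide_spec hγ hn h (JInv.hodgeStar hγ.type11 hk ((jInv_two_iff η).mpr hη))).2
  rw [toExt_mul_hodgeStar_comm hγ.type11, toExt_hodgeStar, ← toExt_hodgeStar γ hk, ← h2, ← mul_assoc,
    ← toExt_dpow_mul_comm, h1]

/-- The factor `n - 1` comes from `ω_{n-2} ∧ ω = (n-1) ω_{n-1}`, which makes the division cancel,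
and `n - 2` from `ω_{n-3} ∧ ω = (n-2) ω_{n-2}`. -/
theorem toExt_divide_mul_dpow {ω : Alt n 2} (hω : IsPositive ω) (hn : 3 ≤ n) {k l : ℕ}
    (h : 2 * (n - 2) + 2 = k) (c : Alt n l) {b : Alt n k} (hb : JInv b)
    (hbc : toExt b = toExt c * toExt (dpow ω (n - 3))) :
    ((n : ℂ) - 1) • (toExt (divide h ω b) * toExt (dpow ω (n - 1))) =
      ((n : ℂ) - 2) • (toExt c * toExt (dpow ω (n - 2))) := by
  have h1 := (divide_spec hω (by omega) h hb).2
  have h2 : toExt (dpow ω (n - 3)) * toExt ω = ((n : ℂ) - 2) • toExt (dpow ω (n - 2)) := by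
    have h3 := succ_smul_toExt_dpow ω (n - 3)
    have h4 : n - 3 + 1 = n - 2 := by omega
    rw [h4] at h3
    rw [← h3]
    push_cast [Nat.cast_sub hn]
    congr 1
    ring
  rw [← mul_smul_comm, ← dpow_mul_self (by omega), ← mul_assoc, ← toExt_dpow_mul_comm, h1, hbc,
    mul_assoc, h2, mul_smul_comm]

theorem toExt_mul_dpow_pred (ω : Alt n 2) (hn : 1 ≤ n) :
    toExt ω * toExt (dpow ω (n - 1)) = (n : ℂ) • toExt (dpow ω n) := by
  have h3 := succ_smul_toExt_dpow ω (n - 1)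
  have h4 : n - 1 + 1 = n := by omega
  rw [h4] at h3
  rw [← toExt_dpow_mul_comm, ← h3]
  push_cast [Nat.cast_sub hn]
  congr 1
  ring

end Alt

namespace DForm

variable {X : Type*} {n : ℕ} [TopologicalSpace X] [ChartedSpace (Cn n) X]
  [IsManifold 𝓘(ℂ, Cn n) (⊤ : ℕ∞) X]

theorem IsSmooth.neg {k : ℕ} {a : DForm X n k} (ha : IsSmooth a) : IsSmooth (fun x => -a x) :=
  fun e he => (ha e he).neg

theorem delStar_eq {k : ℕ} (h : k + 1 ≤ 2 * n) (ω : DForm X n 2) (a : DForm X n (k + 1)) :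
    delStar h ω a = fun x => -star (l := k) (by omega) ω
      (dolb Complex.I (star (l := 2 * n - (k + 1)) (by omega) ω a)) x := by
  funext x
  rw [delStar, delbar_eq_dolb]

theorem delbarStar_eq {k : ℕ} (h : k + 1 ≤ 2 * n) (ω : DForm X n 2) (a : DForm X n (k + 1)) :
    delbarStar h ω a = fun x => -star (l := k) (by omega) ω
      (dolb (-Complex.I) (star (l := 2 * n - (k + 1)) (by omega) ω a)) x := by
  funext x
  rw [delbarStar, del_eq_dolb]

theorem IsSmooth.delStar {k : ℕ} (h : k + 1 ≤ 2 * n) {ω : DForm X n 2} (hω : IsHermitianMetric ω)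
    {a : DForm X n (k + 1)} (ha : IsSmooth a) : IsSmooth (delStar h ω a) := by
  rw [delStar_eq]
  exact (((ha.star _ hω).dolb _).star _ hω).neg

theorem IsSmooth.delbarStar {k : ℕ} (h : k + 1 ≤ 2 * n) {ω : DForm X n 2} (hω : IsHermitianMetric ω)
    {a : DForm X n (k + 1)} (ha : IsSmooth a) : IsSmooth (delbarStar h ω a) := by
  rw [delbarStar_eq]
  exact (((ha.star _ hω).dolb _).star _ hω).neg

theorem IsSmooth.del {k : ℕ} {a : DForm X n k} (ha : IsSmooth a) : IsSmooth (del a) := by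
  rw [del_eq_dolb]
  exact ha.dolb _

theorem IsSmooth.delbar {k : ℕ} {a : DForm X n k} (ha : IsSmooth a) : IsSmooth (delbar a) := by
  rw [delbar_eq_dolb]
  exact ha.dolb _

theorem opT_eq (hn : 3 ≤ n) {γ η : DForm X n 2} (hγ : IsHermitianMetric γ) (hη : IsType11 η) :
    opT hn γ η = fun x => -η x + funMul (fun x => (1 / ((n : ℂ) - 1)) • trace γ η x) γ x := by
  funext x
  refine (Alt.divide_hodgeStar (hγ.isPositive x) (hη x) (by omega) rfl (by omega)).trans ?_
  have h : (Alt.trace (k := 0) (γ x) (η x) ![]) / ((n : ℂ) - 1) =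
      ((1 / ((n : ℂ) - 1)) • Alt.trace (k := 0) (γ x) (η x)) ![] := by
    rw [ContinuousAlternatingMap.smul_apply, smul_eq_mul]
    ring
  rw [h]
  rfl

theorem isSmooth_opT (hn : 3 ≤ n) {γ η : DForm X n 2} (hγ : IsHermitianMetric γ) (hη : IsType11 η)
    (hs : IsSmooth η) : IsSmooth (opT hn γ η) := by
  rw [opT_eq hn hγ hη]
  exact hs.neg.add (((IsSmooth.trace (k := 0) hγ hs).const_smul _).funMul hγ.smooth)

theorem isType11_opT (hn : 3 ≤ n) {γ η : DForm X n 2} (hγ : IsHermitianMetric γ) (hη : IsType11 η) :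
    IsType11 (opT hn γ η) := fun x =>
  (Alt.divide_spec (hγ.isPositive x) (by omega) rfl (Alt.JInv.hodgeStar (hγ.type11 x) _
    ((Alt.jInv_two_iff _).mpr (hη x)))).1

theorem toExt_opP_mul_dpow (hn : 3 ≤ n) {ω α : DForm X n 2} (hω : IsHermitianMetric ω)
    (hα : IsSmooth α) (hα' : IsType11 α) (x : X) :
    ((n : ℂ) - 1) • (Alt.toExt (opP hn ω α x) * Alt.toExt (dpow ω (n - 1) x)) =
      ((n : ℂ) - 2) • (Alt.toExt (iddbar α x) * Alt.toExt (dpow ω (n - 2) x)) :=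
  Alt.toExt_divide_mul_dpow (hω.isPositive x) hn _ (iddbar α x)
    ((jInv_iddbar hα (fun x => (Alt.jInv_two_iff _).mpr (hα' x)) x).wedge
      (Alt.JInv.dpow (hω.type11 x) (n - 3))) (Alt.toExt_wedge _ _)

variable [T2Space X] [CompactSpace X]

theorem integral_opP (hn : 3 ≤ n) {ω α : DForm X n 2} (hω : IsHermitianMetric ω)
    (hα : IsSmooth α) (hα' : IsType11 α) (h : 2 + 2 * (n - 1) = 2 * n)
    (h' : 2 * (n - 2) + (2 + 1 + 1) = 2 * n) :
    ((n : ℂ) - 1) * integral h (wedge (opP hn ω α) (dpow ω (n - 1))) =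
      ((n : ℂ) - 2) * integral h' (wedge (dpow ω (n - 2)) (iddbar α)) := by
  rw [← integral_const_smul, ← integral_const_smul]
  refine integral_congr _ _ fun x => ?_
  rw [map_smul, map_smul]
  refine (congrArg _ (Alt.toExt_wedge _ _)).trans
    ((toExt_opP_mul_dpow hn hω hα hα' x).trans (congrArg _ ?_))
  exact (Alt.toExt_dpow_mul_comm _ _ _).symm.trans (Alt.toExt_wedge _ _).symm

/-- The pointwise identity for division turns the integrand into `i∂∂̄ω_{n-2} ∧ T_γ(η)`, and
symmetry of `i∂∂̄` moves the operator to `T_γ(η)`; this is where its smoothness enters. -/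
theorem integral_star_rho (hn : 3 ≤ n) {ω γ η : DForm X n 2} (hω : IsHermitianMetric ω)
    (hγ : IsHermitianMetric γ) (hη : IsSmooth η) (hη' : IsType11 η) {l : ℕ} (hl : 2 + l = 2 * n)
    (h : 2 + l = 2 * n) (h' : 2 * (n - 2) + (2 + 1 + 1) = 2 * n) :
    integral h (wedge η (star hl γ (rho ω γ))) =
      integral h' (wedge (dpow ω (n - 2)) (iddbar (opT hn γ η))) := by
  rw [← integral_iddbar_wedge (m := n - 2) rfl (by omega) h' (hω.smooth.dpow _)
    (isSmooth_opT hn hγ hη' hη)]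
  refine integral_congr _ _ fun x => ?_
  refine (Alt.toExt_wedge _ _).trans (Eq.trans ?_ (Alt.toExt_wedge _ _).symm)
  exact Alt.toExt_mul_hodgeStar_divide (hγ.isPositive x) (hη' x) (by omega) rfl hl (by omega)
    (jInv_iddbar (hω.smooth.dpow _) (fun x => Alt.JInv.dpow (hω.type11 x) _) x)

/-- The pairing of a `2`-form with `ω_{n-1}`. -/
def pairing (ω E : DForm X n 2) (h : 2 + 2 * (n - 1) = 2 * n) : ℂ :=
  integral h (wedge E (dpow ω (n - 1)))

variable {ω : DForm X n 2} (h : 2 + 2 * (n - 1) = 2 * n)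

theorem pairing_add (hω : IsSmooth ω) {E F : DForm X n 2} (hE : IsSmooth E) (hF : IsSmooth F) :
    pairing ω (fun x => E x + F x) h = pairing ω E h + pairing ω F h := by
  rw [pairing, pairing, pairing, ← integral_add h (hE.wedge (hω.dpow _)) (hF.wedge (hω.dpow _))]
  refine integral_congr _ _ fun x => ?_
  simp only [wedge, Alt.toExt_wedge, map_add, add_mul]

theorem pairing_const_smul (c : ℂ) (E : DForm X n 2) :
    pairing ω (fun x => c • E x) h = c * pairing ω E h := by
  rw [pairing, pairing, ← integral_const_smul]
  refine integral_congr _ _ fun x => ?_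
  simp only [wedge, Alt.toExt_wedge, map_smul, smul_mul_assoc]

/-- Additivity of the integral requires smooth integrands, while `opP` is defined pointwise by
choice. Its product with `ω_{n-1}` is however a constant times `i∂∂̄α ∧ ω_{n-2}`, which is smooth,
so smoothness of `opP` itself is not needed. -/
theorem pairing_opP_add (hn : 3 ≤ n) (hω : IsHermitianMetric ω) {α E : DForm X n 2}
    (hα : IsSmooth α) (hα' : IsType11 α) (hE : IsSmooth E) :
    pairing ω (fun x => opP hn ω α x + E x) h = pairing ω (opP hn ω α) h + pairing ω E h := by
  have hn1 : (n : ℂ) - 1 ≠ 0 := by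
    rw [sub_ne_zero]
    exact_mod_cast (by omega : n ≠ 1)
  have h4 : 2 + 1 + 1 + 2 * (n - 2) = 2 + 2 * (n - 1) := by omega
  have h1 : IsSmooth (fun x => (((n : ℂ) - 2) / ((n : ℂ) - 1)) •
      Alt.castDeg h4 (wedge (iddbar α) (dpow ω (n - 2)) x)) :=
    ((hα.iddbar.wedge (hω.smooth.dpow _)).castDeg h4).const_smul _
  have h2 : ∀ x, Alt.toExt ((((n : ℂ) - 2) / ((n : ℂ) - 1)) •
      Alt.castDeg h4 (wedge (iddbar α) (dpow ω (n - 2)) x)) =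
      Alt.toExt (wedge (opP hn ω α) (dpow ω (n - 1)) x) := by
    intro x
    have h3 := toExt_opP_mul_dpow hn hω hα hα' x
    rw [map_smul, Alt.toExt_castDeg]
    simp only [wedge, Alt.toExt_wedge]
    rw [div_eq_inv_mul, mul_smul, ← h3, smul_smul, inv_mul_cancel₀ hn1]
    exact one_smul ℂ _
  rw [pairing, pairing, pairing, ← integral_congr h h h2,
    ← integral_add h h1 (hE.wedge (hω.smooth.dpow _))]
  refine integral_congr _ _ fun x => ?_
  rw [map_add, h2]
  simp only [wedge, Alt.toExt_wedge, map_add, add_mul]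

/-- For `f = -⋆(dolb ε u)` one has `f ω ∧ ω_{n-1} = n f ω_n = -n dolb ε u`, which integrates to zero
by Stokes. The balanced condition plays no part. -/
theorem pairing_funMul_eq_zero (hn : 3 ≤ n) (hω : IsHermitianMetric ω) (ε : ℂ) {k : ℕ}
    (hk : k + 1 + 0 = 2 * n) {u : DForm X n k} (hu : IsSmooth u) :
    pairing ω (funMul (fun x => -star hk ω (dolb ε u) x) ω) h = 0 := by
  have h1 : pairing ω (funMul (fun x => -star hk ω (dolb ε u) x) ω) h =
      -(n : ℂ) * integral hk (dolb ε u) := by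
    rw [pairing, ← integral_const_smul]
    refine integral_congr _ _ fun x => ?_
    have h2 := Alt.toExt_hodgeStar_top_mul (hω.isPositive x) hk (dolb ε u x)
    rw [Alt.toExt_zero_degree, smul_mul_assoc, one_mul] at h2
    have h3 : (-star hk ω (dolb ε u) x) ![] = -(Alt.hodgeStar hk (ω x) (dolb ε u x) ![]) := rfl
    rw [map_smul]
    simp only [wedge, Alt.toExt_wedge, funMul, dpow, map_smul, smul_mul_assoc]
    rw [Alt.toExt_mul_dpow_pred (ω x) (by omega), ← h2, h3]
    module
  rw [h1, integral_dolb ε hk hu, mul_zero]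

/-- Integration by parts puts the derivative on `ω_{n-1}`, where it vanishes by balancedness. -/
theorem pairing_dolb_eq_zero (hω : IsHermitianMetric ω) (hb : IsBalanced ω) (ε : ℂ)
    {t : DForm X n 1} (ht : IsSmooth t) : pairing ω (dolb ε t) h = 0 := by
  rw [pairing, integral_dolb_wedge ε h (by omega) ht (hω.smooth.dpow _),
    integral_congr _ h (b := fun _ => 0), integral_zero, mul_zero]
  intro x
  simp only [wedge, Alt.toExt_wedge]
  rw [hω.dolb_dpow_eq_zero hb, map_zero, map_zero, mul_zero]

/-- Because `⋆ω_{n-1} = ω`, symmetry of the pairing removes the outer star and leaves the integral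
of `dolb ε C ∧ ω`. After integration by parts the integrand is `C ∧ dolb ε ω`, and `C = ⋆(ω ∧ v)`
contains the factor `ω_{n-2}`. -/
theorem pairing_star_dolb_star_eq_zero (hn : 3 ≤ n) (hω : IsHermitianMetric ω) (hb : IsBalanced ω)
    (ε : ℂ) {l : ℕ} (hl : 2 + 1 + l = 2 * n) (hl' : l + 1 + 2 = 2 * n) {v : DForm X n 1}
    (hv : IsSmooth v) :
    pairing ω (fun x => -star hl' ω (dolb ε (star hl ω (wedge ω v))) x) h = 0 := by
  set C := star hl ω (wedge ω v) with hC
  have hCs : IsSmooth C := (hω.smooth.wedge hv).star hl hω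
  have h4 : 2 * (n - 1) = l + 1 := by omega
  have h1 : pairing ω (fun x => -star hl' ω (dolb ε C) x) h =
      -1 * integral hl' (wedge (dolb ε C) ω) := by
    rw [pairing, ← integral_const_smul]
    refine integral_congr _ _ fun x => ?_
    have h2 := Alt.toExt_mul_hodgeStar_comm (hω.type11 x) hl' (Alt.castDeg h4 (dpow ω (n - 1) x))
      (dolb ε C x)
    rw [Alt.toExt_hodgeStar _ _ (Alt.castDeg h4 _), Alt.toExt_castDeg] at h2
    have h3 := Alt.sharp_dpow_dpow (hω.isPositive x) (show n - 1 + 1 = n by omega)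
    rw [Alt.toExt_dpow_one] at h3
    rw [map_smul]
    simp only [wedge, dpow, Alt.toExt_wedge, map_neg]
    rw [neg_mul, ← Alt.toExt_dpow_mul_comm]
    refine (congrArg _ (h2.trans (congrArg _ h3))).trans ?_
    module
  rw [h1, integral_dolb_wedge ε hl' (by omega) hCs hω.smooth,
    integral_congr _ h (b := fun _ => 0), integral_zero, mul_zero, mul_zero]
  intro x
  -- Splitting `C` as `ξ ω_{n-2}` produces `ω_{n-2} ∧ dolb ε ω = dolb ε ω_{n-1} = 0`.
  obtain ⟨ξ, hξ⟩ := Alt.exists_hodgeStar_wedge_eq (hω.isPositive x) (by omega) (v x) hl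
  have h5 := succ_smul_toExt_dolb_dpow ε hω.smooth (n - 2) x
  have h6 : n - 2 + 1 = n - 1 := by omega
  rw [h6, hω.dolb_dpow_eq_zero hb, map_zero] at h5
  simp only [wedge, Alt.toExt_wedge]
  refine (congrArg (· * _) hξ).trans ?_
  rw [mul_assoc]
  refine (congrArg (ξ * ·) h5.symm).trans ?_
  rw [mul_zero, map_zero]

theorem pairing_opQ (hn : 3 ≤ n) (hω : IsHermitianMetric ω) (hb : IsBalanced ω) {α : DForm X n 2}
    (hα : IsSmooth α) (hα' : IsType11 α) : pairing ω (opQ hn ω α) h = pairing ω (opP hn ω α) h := by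
  have hv : IsSmooth (delbarStar (k := 1) (by omega) ω α) := hα.delbarStar (k := 1) _ hω
  have ht : IsSmooth (trace (k := 1) ω (delbar α)) := IsSmooth.trace (k := 1) hω hα.delbar
  have hR : IsSmooth (funMul (delStar (k := 0) (by omega) ω (delbarStar (k := 1) (by omega) ω α)) ω) :=
    (IsSmooth.delStar (k := 0) _ hω hv).funMul hω.smooth
  have hA : IsSmooth (del (trace (k := 1) ω (delbar α))) := ht.del
  have hB : IsSmooth (delStar (k := 2) (by omega) ω
      (wedge ω (delbarStar (k := 1) (by omega) ω α))) :=
    IsSmooth.delStar (k := 2) _ hω (hω.smooth.wedge hv)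
  have hC : IsSmooth (funMul (delbarStar (k := 0) (by omega) ω (trace (k := 1) ω (delbar α))) ω) :=
    (IsSmooth.delbarStar (k := 0) _ hω ht).funMul hω.smooth
  have hR0 : pairing ω (funMul (delStar (k := 0) (by omega) ω
      (delbarStar (k := 1) (by omega) ω α)) ω) h = 0 := by
    rw [delStar_eq]
    exact pairing_funMul_eq_zero h hn hω _ _ (hv.star _ hω)
  have hA0 : pairing ω (del (trace (k := 1) ω (delbar α))) h = 0 := by
    rw [del_eq_dolb]
    exact pairing_dolb_eq_zero h hω hb _ ht
  have hB0 : pairing ω (delStar (k := 2) (by omega) ω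
      (wedge ω (delbarStar (k := 1) (by omega) ω α))) h = 0 := by
    rw [delStar_eq]
    exact pairing_star_dolb_star_eq_zero h hn hω hb _ _ _ hv
  have hC0 : pairing ω (funMul (delbarStar (k := 0) (by omega) ω
      (trace (k := 1) ω (delbar α))) ω) h = 0 := by
    rw [delbarStar_eq]
    exact pairing_funMul_eq_zero h hn hω _ _ (ht.star _ hω)
  set R := funMul (delStar (k := 0) (by omega) ω (delbarStar (k := 1) (by omega) ω α)) ω with hRdef
  set A := del (trace (k := 1) ω (delbar α)) with hAdef
  set B := delStar (k := 2) (by omega) ω (wedge ω (delbarStar (k := 1) (by omega) ω α)) with hBdef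
  set C := funMul (delbarStar (k := 0) (by omega) ω (trace (k := 1) ω (delbar α))) ω with hCdef
  -- The four corrections are grouped into one smooth form, so that `opP`, whose smoothness is not
  -- available, is split off only once.
  have hsum := (hR.const_smul Complex.I).add ((hA.const_smul (-Complex.I)).add
    ((hB.const_smul (-Complex.I)).add (hC.const_smul (-((1 : ℂ) / ((n : ℂ) - 1))))))
  have hQ : opQ hn ω α = fun x => opP hn ω α x + (Complex.I • R x + (-Complex.I • A x +
      (-Complex.I • B x + (-((1 : ℂ) / ((n : ℂ) - 1))) • C x))) := by
    funext x
    have h1 : opQ hn ω α x = opP hn ω α x + Complex.I • R x - Complex.I • A x - Complex.I • B x -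
      ((1 : ℂ) / ((n : ℂ) - 1)) • C x := rfl
    rw [h1]
    module
  rw [hQ, pairing_opP_add h hn hω hα hα' hsum, pairing_add h hω.smooth (hR.const_smul _)
    ((hA.const_smul _).add ((hB.const_smul _).add (hC.const_smul _))),
    pairing_add h hω.smooth (hA.const_smul _) ((hB.const_smul _).add (hC.const_smul _)),
    pairing_add h hω.smooth (hB.const_smul _) (hC.const_smul _), pairing_const_smul,
    pairing_const_smul, pairing_const_smul, pairing_const_smul, hR0, hA0, hB0, hC0]
  ring

end DForm
end

theorem lemma5p22 {n : ℕ} (hn : 3 ≤ n) {X : Type*} [TopologicalSpace X] [T2Space X]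
    [CompactSpace X] [ChartedSpace (Cn n) X] [IsManifold 𝓘(ℂ, Cn n) (⊤ : ℕ∞) X]
    (ω γ : DForm X n 2) (hω : ω.IsHermitianMetric) (hγ : γ.IsHermitianMetric)
    (η : DForm X n 2) (hη : η.IsSmooth) (hη' : η.IsType11) :
    DForm.integral (by omega)
        (η.wedge (DForm.star (k := 2) (l := 2 * n - 2) (by omega) γ (DForm.rho ω γ))) =
      (((n : ℂ) - 1) / ((n : ℂ) - 2)) *
        DForm.integral (by omega)
          ((DForm.opP hn ω (DForm.opT hn γ η)).wedge (ω.dpow (n - 1))) ∧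
    (ω.IsBalanced →
      DForm.integral (by omega)
          (η.wedge (DForm.star (k := 2) (l := 2 * n - 2) (by omega) γ (DForm.rho ω γ))) =
        (((n : ℂ) - 1) / ((n : ℂ) - 2)) *
          DForm.integral (by omega)
            ((DForm.opQ hn ω (DForm.opT hn γ η)).wedge (ω.dpow (n - 1)))) := by
  have hα := DForm.isSmooth_opT hn hγ hη' hη
  have hα' := DForm.isType11_opT hn hγ hη'
  have hn2 : (n : ℂ) - 2 ≠ 0 := by
    rw [sub_ne_zero]
    exact_mod_cast (by omega : n ≠ 2)
  have h1 : DForm.integral (by omega)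
        (η.wedge (DForm.star (k := 2) (l := 2 * n - 2) (by omega) γ (DForm.rho ω γ))) =
      (((n : ℂ) - 1) / ((n : ℂ) - 2)) *
        DForm.integral (by omega)
          ((DForm.opP hn ω (DForm.opT hn γ η)).wedge (ω.dpow (n - 1))) := by
    rw [DForm.integral_star_rho hn hω hγ hη hη' (by omega) (by omega) (by omega), div_mul_eq_mul_div,
      DForm.integral_opP hn hω hα hα' (by omega) (by omega), mul_div_cancel_left₀ _ hn2]
  refine ⟨h1, fun hb => ?_⟩
  rw [h1]
  exact congrArg _ (DForm.pairing_opQ (by omega) hn hω hb hα hα').symm
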